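/- **Conventions.** Let $V$ be a category. A functor $E$ on finite sequences of objects of $V$ is a family of functors $E_n:V^n\to V$ ($n\ge 0$); write $\mathop{E}_i X_i$ or $\mathop{E}_{1\le i\le n}X_i$ for $E_n(X_1,\dots,X_n)$. A *multitensor* on $V$ is such an $E$ with natural maps $u_Z:Z\to E_1Z$ and $\sigma_{Z_{ij}}:\mathop{E}_i\mathop{E}_jZ_{ij}\to\mathop{E}_{ij}Z_{ij}$ (for all doubly nested finite sequences, blocks possibly empty) such that $\sigma\circ uE_i=\mathrm{id}$, $\sigma\circ \mathop{E}_iu=\mathrm{id}$ and $\sigma\circ\sigma \mathop{E}_k=\sigma\circ\mathop{E}_i\sigma:\mathop{E}_i\mathop{E}_j\mathop{E}_kZ_{ijk}\to\mathop{E}_{ijk}Z_{ijk}$. A multitensor map $E\to F$ is a natural family $E_n\to F_n$ compatible with units and substitutions. The maps $u$ and $\sigma$ make $E_1$ a monad. $E$ is *distributive* if every $E_n$ preserves coproducts in each variable. $\mathcal GV$ is the category of $V$-graphs: an object $X$ is a set of objects with an object $X(a,b)$ of $V$ for each pair $(a,b)$ of them, and a morphism is a function on objects with maps on homs; $\mathcal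 G(-)$ of a functor or monad is its application to homs. An *$E$-category* is $X\in\mathcal GV$ with maps $\kappa:\mathop{E}_iX(x_{i-1},x_i)\to X(x_0,x_n)$ for all $n\ge0$ and all $x_0,\dots,x_n$, such that $\kappa\circ u=\mathrm{id}$ and $\kappa\circ\sigma=\kappa\circ\mathop{E}_i\kappa$; $E$-functors are the graph morphisms commuting with all $\kappa$, and $E\text{-Cat}$ is the resulting category. If $V$ has coproducts and $E$ is distributive, $\Gamma E$ is the monad on $\mathcal GV$ for which $\Gamma E(X)$ has the objects of $X$ and $$\Gamma E(X)(a,b)=\coprod_{a=x_0,\dots,x_n=b}\mathop{E}_iX(x_{i-1},x_i),$$ with coproduct inclusions $k_{x_i}$; its unit and multiplication are identities on objects, and on homs the unit is $k\circ u$ and the multiplication is the map $\mu$ determined by $\mu\circ k\circ\mathop{E}_ik=k\circ\sigma$ for all doubly nested sequences of objects. **Theorem.** Let $V$ be a category, $(E,u,\sigma)$ a multitensor on $V$ and $(T,\eta,\mu)$ a monad on $V$, with category of algebras $U^T:V^T\to V$. Write $EM(T)$ for the family of functors $(X_1,\dots,X_n)\mapsto\mathop{E}_iTX_i$. There are bijections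 between the following types of data. 1. Opmonoidal monad coherences for $T$: natural maps $\tau_{X_i}:T\mathop{E}_iX_i\to\mathop{E}_iTX_i$, for all finite sequences, such that $\tau\circ Tu=uT$, $\ \tau\circ T\sigma=\sigma T\circ\mathop{E}_i\tau\circ\tau\mathop{E}_j$, $\ \tau\circ\eta\mathop{E}_i=\mathop{E}_i\eta$, $\ \tau\circ\mu\mathop{E}_i=\mathop{E}_i\mu\circ\tau T\circ T\tau$. 2. Natural maps $\sigma'_{X_{ij}}:\mathop{E}_iT\mathop{E}_jTX_{ij}\to\mathop{E}_{ij}TX_{ij}$ which, together with $u'_X=u_{TX}\eta_X$, make $EM(T)$ a multitensor, such that $E\eta:E\to EM(T)$ is a multitensor map, $uT:T\to E_1T$ is a monad map, and the composite $\mathop{E}_iTX_i\to\mathop{E}_iTE_1TX_i\to\mathop{E}_iTX_i$ of $\mathop{E}_i(\eta uT)$ and $\sigma'$ is the identity. 3. Liftings of $E$ to $V^T$, that is, multitensors $(E',u',\sigma')$ on $V^T$ with $U^TE'_n=E_n(U^T)^n$ for all $n$, whose unit and substitution have those of $E$ (at the underlying objects) as underlying maps in $V$. The data corresponding to $\tau$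 are given by $\sigma'=\mathop{E}_{ij}\mu\circ\sigma TT\circ\mathop{E}_i\tau T$, and by the $T$-algebra structure $\mathop{E}_ix_i\circ\tau_{X_i}$ on $\mathop{E}_iX_i$ for $T$-algebras $(X_i,x_i)$. For any instance of such corresponding data there is an isomorphism of categories $$EM(T)\text{-Cat}\;\cong\;E'\text{-Cat}$$ commuting with the forgetful functors into $\mathcal GV$. If in addition $V$ has coproducts, $T$ preserves them and $E$ is distributive, then these data are also in bijection with 4. Identity-on-objects morphisms $\lambda_X:\mathcal G(T)\,\Gamma E(X)\to\Gamma E\,\mathcal G(T)(X)$, natural in $X\in\mathcal GV$, which form a distributive law of the monad $\Gamma E$ over the monad $\mathcal G(T)$ (that is, with $S=\Gamma E$ and $R=\mathcal G(T)$, a transformation $\lambda:RS\to SR$ compatible with the units and multiplications of both monads), where $\lambda$ corresponds to $\tau$ when $\lambda_X\circ T(k_{x_i})=k_{x_i}\circ\tau_{X(x_{i-1},x_i)}$ for every $X$ and every sequence $(x_0,\dots,x_n)$ of its objects. -/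

import Mathlib

open CategoryTheory CategoryTheory.Limits

attribute [-instance] CategoryTheory.catToReflQuiver

universe v u v₁ u₁ w

namespace MultitensorLaw

/-! ### Sequences and their subdivisions into consecutive blocks -/

/-- A subdivision of the sequence of positions `0, …, N - 1` into `k` consecutive (possibly empty)
blocks. Block `i` begins at `cut i.castSucc`, ends just before `cut i.succ`, and has `len i`
elements. Thus a doubly nested sequence `X_ij` (`1 ≤ i ≤ k`, `1 ≤ j ≤ len i`) is the same as a
sequence of length `N` together with a subdivision of it. -/
structure Subdivision (N k : ℕ) where
  cut : Fin (k + 1) → Fin (N + 1)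
  len : Fin k → ℕ
  cut_zero : cut 0 = 0
  cut_last : cut (Fin.last k) = Fin.last N
  cut_succ : ∀ i : Fin k, (cut i.succ : ℕ) = (cut i.castSucc : ℕ) + len i

namespace Subdivision

variable {N M k : ℕ}

/-- The position, in the whole sequence, of the `j`-th element of the `i`-th block. -/
def index (d : Subdivision N k) (i : Fin k) (j : Fin (d.len i)) : Fin N :=
  ⟨(d.cut i.castSucc : ℕ) + j, by
    have h1 := d.cut_succ i
    have h2 := (d.cut i.succ).isLt
    have h3 := j.isLt
    omega⟩

theorem cut_mono (d : Subdivision N k) : Monotone d.cut :=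
  Fin.monotone_iff_le_succ.2 fun i => by
    have h1 := d.cut_succ i
    rw [Fin.le_def]
    omega

/-- The subdivision into a single block. -/
def whole (N : ℕ) : Subdivision N 1 where
  cut := Fin.cases 0 fun _ => Fin.last N
  len := fun _ => N
  cut_zero := rfl
  cut_last := rfl
  cut_succ := fun i => by
    obtain rfl : i = 0 := Subsingleton.elim _ _
    exact (Nat.zero_add N).symm

/-- The subdivision into blocks of length one. -/
def singles (N : ℕ) : Subdivision N N where
  cut := fun i => i
  len := fun _ => 1
  cut_zero := rfl
  cut_last := rfl
  cut_succ := fun i => by simp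

/-- If `N` positions are divided into `M` blocks and these `M` blocks are divided into `k` groups,
then the `N` positions are divided into `k` large blocks. -/
def comp (d : Subdivision N M) (c : Subdivision M k) : Subdivision N k where
  cut := fun i => d.cut (c.cut i)
  len := fun i => (d.cut (c.cut i.succ) : ℕ) - (d.cut (c.cut i.castSucc) : ℕ)
  cut_zero := by rw [c.cut_zero, d.cut_zero]
  cut_last := by rw [c.cut_last, d.cut_last]
  cut_succ := fun i => by
    have h := d.cut_mono (c.cut_mono (Fin.castSucc_lt_succ (i := i)).le)
    rw [Fin.le_def] at h
    omega

theorem cut_bound (c : Subdivision M k) (i : Fin k) (j : Fin (c.len i + 1)) :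
    (c.cut i.castSucc : ℕ) + j < M + 1 := by
  have h1 := c.cut_succ i
  have h2 := (c.cut i.succ).isLt
  have h3 := j.isLt
  omega

/-- The subdivision of the `i`-th large block of `d.comp c` into those blocks of `d` which make it
up. -/
def restrict (d : Subdivision N M) (c : Subdivision M k) (i : Fin k) :
    Subdivision ((d.comp c).len i) (c.len i) where
  cut := fun j =>
    ⟨(d.cut ⟨(c.cut i.castSucc : ℕ) + j, c.cut_bound i j⟩ : ℕ) - (d.cut (c.cut i.castSucc) : ℕ), by
      have h : d.cut ⟨(c.cut i.castSucc : ℕ) + j, c.cut_bound i j⟩ ≤ d.cut (c.cut i.succ) := by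
        apply d.cut_mono
        rw [Fin.le_def, c.cut_succ i]
        have h3 := j.isLt
        simp only
        omega
      rw [Fin.le_def] at h
      simp only [comp]
      omega⟩
  len := fun j => d.len (c.index i j)
  cut_zero := by
    ext
    simp
  cut_last := by
    ext
    have h : (⟨(c.cut i.castSucc : ℕ) + (Fin.last (c.len i) : Fin (c.len i + 1)),
        c.cut_bound i _⟩ : Fin (M + 1)) = c.cut i.succ := by
      ext
      simp [c.cut_succ i]
    simp only [h]
    rfl
  cut_succ := fun j => by
    have h1 := d.cut_succ (c.index i j)
    have h2 : d.cut (c.cut i.castSucc) ≤ d.cut (c.index i j).castSucc := by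
      apply d.cut_mono
      rw [Fin.le_def]
      simp [index]
    rw [Fin.le_def] at h2
    change (d.cut (c.index i j).succ : ℕ) - (d.cut (c.cut i.castSucc) : ℕ) =
      ((d.cut (c.index i j).castSucc : ℕ) - (d.cut (c.cut i.castSucc) : ℕ)) + d.len (c.index i j)
    omega

theorem index_whole (N : ℕ) (i : Fin 1) (j : Fin N) : (whole N).index i j = j := by
  obtain rfl : i = 0 := Subsingleton.elim _ _
  ext
  simp [index, whole]

/-- Passing to positions in two steps agrees with passing to positions in one step. -/
theorem index_comp (d : Subdivision N M) (c : Subdivision M k) (i : Fin k) (j : Fin (c.len i))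
    (l : Fin (d.len (c.index i j))) :
    (d.comp c).index i ((d.restrict c i).index j l) = d.index (c.index i j) l := by
  have h2 : d.cut (c.cut i.castSucc) ≤ d.cut (c.index i j).castSucc := by
    apply d.cut_mono
    rw [Fin.le_def]
    simp [index]
  rw [Fin.le_def] at h2
  ext
  change (d.cut (c.cut i.castSucc) : ℕ) +
      (((d.cut (c.index i j).castSucc : ℕ) - (d.cut (c.cut i.castSucc) : ℕ)) + l) =
    (d.cut (c.index i j).castSucc : ℕ) + l
  omega

end Subdivision

/-! ### Multitensors -/

/-- A functor `E : MV → V` on the category of finite sequences of objects of `V`: since maps of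
sequences only exist between sequences of the same length, this is a functor `Eₙ : Vⁿ → V` for
every `n`. -/
abbrev TensorFamily (V : Type u) [Category.{v} V] := ∀ n : ℕ, (Fin n → V) ⥤ V

section

variable {V : Type u} [Category.{v} V]

/-- The action of `E` on a sequence of maps. -/
def TensorFamily.tmap (E : TensorFamily V) {n : ℕ} {X Y : Fin n → V} (f : ∀ i, X i ⟶ Y i) :
    (E n).obj X ⟶ (E n).obj Y :=
  (E n).map f

/-- The unit and substitution making a functor `E : MV → V` into a multitensor.

The unit at a sequence `(X₀)` of length one is a map `X₀ ⟶ E (X₀)`. The substitution is indexed by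
a sequence `X` of length `N` together with a subdivision `d` of it, and is a map
`E_i E_j X_ij ⟶ E_ij X_ij` where `X_ij` is the `j`-th element of the `i`-th block. -/
@[ext]
structure MultitensorStruct (E : TensorFamily V) where
  unit : ∀ X : Fin 1 → V, X 0 ⟶ (E 1).obj X
  sub : ∀ {N k : ℕ} (d : Subdivision N k) (X : Fin N → V),
    (E k).obj (fun i => (E (d.len i)).obj fun j => X (d.index i j)) ⟶ (E N).obj X
  unit_naturality : ∀ {X Y : Fin 1 → V} (f : ∀ i, X i ⟶ Y i),
    f 0 ≫ unit Y = unit X ≫ E.tmap f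
  sub_naturality : ∀ {N k : ℕ} (d : Subdivision N k) {X Y : Fin N → V} (f : ∀ i, X i ⟶ Y i),
    E.tmap (fun i => E.tmap fun j => f (d.index i j)) ≫ sub d Y = sub d X ≫ E.tmap f
  /-- The composite `E_i X_i ⟶ E₁ E_i X_i ⟶ E_i X_i` is the identity. The `eqToHom` identifies
  `X` with the sequence of elements of its only block. -/
  unit_sub : ∀ {N : ℕ} (X : Fin N → V),
    unit (fun i : Fin 1 => (E N).obj fun j => X ((Subdivision.whole N).index i j)) ≫
        sub (Subdivision.whole N) X =
      E.tmap fun j => eqToHom (congrArg X (Subdivision.index_whole N 0 j))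
  /-- The composite `E_i X_i ⟶ E_i E₁ X_i ⟶ E_i X_i` is the identity. -/
  sub_unit : ∀ {N : ℕ} (X : Fin N → V),
    E.tmap (fun i => unit fun j => X ((Subdivision.singles N).index i j)) ≫
        sub (Subdivision.singles N) X =
      𝟙 ((E N).obj X)
  /-- The two composites `E_i E_j E_l X_ijl ⟶ E_ijl X_ijl` agree. The `eqToHom` identifies the
  two ways of addressing the element `X_ijl`. -/
  assoc : ∀ {N M k : ℕ} (d : Subdivision N M) (c : Subdivision M k) (X : Fin N → V),
    sub c (fun a => (E (d.len a)).obj fun l => X (d.index a l)) ≫ sub d X =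
      E.tmap (fun i =>
          E.tmap (fun j => E.tmap fun l =>
            eqToHom (congrArg X (Subdivision.index_comp d c i j l).symm)) ≫
          sub (d.restrict c i) fun l => X ((d.comp c).index i l)) ≫
        sub (d.comp c) X

end

/-- A multitensor (that is, a lax monoidal structure) on a category. -/
structure Multitensor (V : Type u) [Category.{v} V] where
  tensor : TensorFamily V
  str : MultitensorStruct tensor


section

variable {V : Type u} [Category.{v} V]

theorem TensorFamily.tmap_id (E : TensorFamily V) {n : ℕ} (X : Fin n → V) :
    E.tmap (fun i => 𝟙 (X i)) = 𝟙 ((E n).obj X) :=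
  (E n).map_id X

theorem TensorFamily.tmap_comp (E : TensorFamily V) {n : ℕ} {X Y Z : Fin n → V}
    (f : ∀ i, X i ⟶ Y i) (g : ∀ i, Y i ⟶ Z i) :
    E.tmap f ≫ E.tmap g = E.tmap fun i => f i ≫ g i :=
  ((E n).map_comp f g).symm

theorem Subdivision.eq_whole (d : Subdivision 1 1) : d = Subdivision.whole 1 := by
  obtain ⟨cut, len, h0, h1, h2⟩ := d
  have hc : cut = (Subdivision.whole 1).cut := by
    funext i
    fin_cases i
    · exact h0
    · exact h1
  subst hc
  have hl : len = (Subdivision.whole 1).len := by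
    funext i
    have h3 := h2 i
    rw [(Subdivision.whole 1).cut_succ i] at h3
    omega
  subst hl
  rfl

theorem MultitensorStruct.sub_sub_one {E : TensorFamily V} (S : MultitensorStruct E) (X : V)
    (e : Subdivision 1 1) (r : ∀ i : Fin 1, Subdivision (e.len i) 1) :
    HEq (E.tmap (fun i => S.sub (r i) fun _ => X) ≫ S.sub e fun _ => X)
      (E.tmap (fun _ : Fin 1 => S.sub (Subdivision.whole 1) fun _ => X) ≫
        S.sub (Subdivision.whole 1) fun _ => X) := by
  obtain rfl := e.eq_whole
  obtain rfl : r = fun _ => Subdivision.whole 1 := funext fun i => (r i).eq_whole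
  rfl

/-- The monad on `V` whose endofunctor is `E₁`, the restriction of the multitensor `E` to sequences
of length one. -/
def Multitensor.unaryMonad (E : Multitensor V) : Monad V where
  obj X := (E.tensor 1).obj fun _ => X
  map f := E.tensor.tmap fun _ => f
  map_id X := E.tensor.tmap_id _
  map_comp f g := (E.tensor.tmap_comp _ _).symm
  η := { app := fun X => E.str.unit fun _ => X
         naturality := fun X Y f => E.str.unit_naturality fun _ => f }
  μ := { app := fun X => E.str.sub (Subdivision.whole 1) fun _ => X
         naturality := fun X Y f => E.str.sub_naturality (Subdivision.whole 1) fun _ => f }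
  assoc X := by
    have h := E.str.assoc (Subdivision.whole 1) (Subdivision.whole 1) fun _ => X
    simp only [eqToHom_refl, TensorFamily.tmap_id] at h
    have h1 := h.trans (congrArg (fun F => E.tensor.tmap F ≫ E.str.sub _ fun _ => X)
      (funext fun i => Category.id_comp _))
    exact eq_of_heq ((E.str.sub_sub_one X ((Subdivision.whole 1).comp (Subdivision.whole 1))
      ((Subdivision.whole 1).restrict (Subdivision.whole 1))).symm.trans (heq_of_eq h1.symm))
  left_unit X := by
    have h := E.str.unit_sub (fun _ : Fin 1 => X)
    simpa [TensorFamily.tmap_id] using h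
  right_unit X := by
    have h := E.str.sub_unit (fun _ : Fin 1 => X)
    have e : (E.str.sub (Subdivision.singles 1) fun _ => X) =
        E.str.sub (Subdivision.whole 1) fun _ => X := by
      apply eq_of_heq
      have : ∀ d : Subdivision 1 1, d = Subdivision.whole 1 → HEq (E.str.sub d fun _ => X)
          (E.str.sub (Subdivision.whole 1) fun _ => X) := by
        rintro d rfl
        rfl
      exact this _ (Subdivision.eq_whole _)
    exact (congrArg (fun g => (E.tensor.tmap fun _ => E.str.unit fun _ => X) ≫ g) e).symm.trans h

end

/-! ### Enriched graphs -/

/-- A graph enriched in `V`. -/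
structure EnrichedGraph (V : Type u) [Category.{v} V] where
  carrier : Type w
  hom : carrier → carrier → V

namespace EnrichedGraph

section

variable {V : Type u} [Category.{v} V] {W : Type u₁} [Category.{v₁} W]

/-- Morphisms of enriched graphs. -/
@[ext]
structure Hom (X Y : EnrichedGraph.{v, u, w} V) where
  obj : X.carrier → Y.carrier
  map : ∀ a b : X.carrier, X.hom a b ⟶ Y.hom (obj a) (obj b)

instance : Category (EnrichedGraph.{v, u, w} V) where
  Hom := Hom
  id X := ⟨fun a => a, fun _ _ => 𝟙 _⟩
  comp f g := ⟨fun a => g.obj (f.obj a), fun a b => f.map a b ≫ g.map (f.obj a) (f.obj b)⟩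
  id_comp f := by simp
  comp_id f := by simp
  assoc f g h := by simp

@[simp] theorem id_obj (X : EnrichedGraph.{v, u, w} V) (a : X.carrier) : Hom.obj (𝟙 X) a = a := rfl

@[simp] theorem id_map (X : EnrichedGraph.{v, u, w} V) (a b : X.carrier) :
    Hom.map (𝟙 X) a b = 𝟙 (X.hom a b) := rfl

@[simp] theorem comp_obj {X Y Z : EnrichedGraph.{v, u, w} V} (f : X ⟶ Y) (g : Y ⟶ Z)
    (a : X.carrier) : Hom.obj (f ≫ g) a = g.obj (f.obj a) := rfl

@[simp] theorem comp_map {X Y Z : EnrichedGraph.{v, u, w} V} (f : X ⟶ Y) (g : Y ⟶ Z)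
    (a b : X.carrier) : Hom.map (f ≫ g) a b = f.map a b ≫ g.map (f.obj a) (f.obj b) := rfl

/-- The identity-on-objects morphism given by a family of maps between the homs. -/
def Hom.ofHoms {S : Type w} {X Y : S → S → V} (f : ∀ a b, X a b ⟶ Y a b) :
    (⟨S, X⟩ : EnrichedGraph.{v, u, w} V) ⟶ ⟨S, Y⟩ :=
  ⟨fun a => a, f⟩

/-- Applying a functor to the homs of a graph. -/
def mapFunctor (F : V ⥤ W) : EnrichedGraph.{v, u, w} V ⥤ EnrichedGraph.{v₁, u₁, w} W where
  obj X := ⟨X.carrier, fun a b => F.obj (X.hom a b)⟩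
  map f := ⟨f.obj, fun a b => F.map (f.map a b)⟩
  map_id X := by
    refine Hom.ext rfl (heq_of_eq ?_)
    funext a b
    exact F.map_id _
  map_comp f g := by
    refine Hom.ext rfl (heq_of_eq ?_)
    funext a b
    exact F.map_comp _ _

/-- The monad `G(T)` on graphs induced by a monad `T`. -/
def mapMonad (T : Monad V) : Monad (EnrichedGraph.{v, u, w} V) where
  toFunctor := mapFunctor T.toFunctor
  η :=
    { app := fun X => Hom.ofHoms fun a b => T.η.app (X.hom a b)
      naturality := fun X Y f => by
        refine Hom.ext rfl (heq_of_eq ?_)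
        funext a b
        exact T.η.naturality _ }
  μ :=
    { app := fun X => Hom.ofHoms fun a b => T.μ.app (X.hom a b)
      naturality := fun X Y f => by
        refine Hom.ext rfl (heq_of_eq ?_)
        funext a b
        exact T.μ.naturality _ }
  assoc X := by
    refine Hom.ext rfl (heq_of_eq ?_)
    funext a b
    exact T.assoc _
  left_unit X := by
    refine Hom.ext rfl (heq_of_eq ?_)
    funext a b
    exact T.left_unit _
  right_unit X := by
    refine Hom.ext rfl (heq_of_eq ?_)
    funext a b
    exact T.right_unit _

end

end EnrichedGraph

/-- A finite sequence `(x₀, …, xₙ)` with `x₀ = a` and `xₙ = b`. -/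
structure Chain {S : Type w} (a b : S) where
  len : ℕ
  pt : Fin (len + 1) → S
  pt_zero : pt 0 = a
  pt_last : pt (Fin.last len) = b

namespace Chain

variable {S : Type w} {R : Type v}

/-- The sequence `(a, b)`. -/
abbrev pair (a b : S) : Chain a b where
  len := 1
  pt := Fin.cases a fun _ => b
  pt_zero := rfl
  pt_last := rfl

/-- The image of a sequence under a function. -/
abbrev image (f : S → R) {a b : S} (p : Chain a b) : Chain (f a) (f b) where
  len := p.len
  pt := fun i => f (p.pt i)
  pt_zero := congrArg f p.pt_zero
  pt_last := congrArg f p.pt_last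

/-- The sequence of end points of the blocks of a subdivided sequence. -/
abbrev coarse {a b : S} (p : Chain a b) {k : ℕ} (d : Subdivision p.len k) : Chain a b where
  len := k
  pt := fun i => p.pt (d.cut i)
  pt_zero := by rw [d.cut_zero, p.pt_zero]
  pt_last := by rw [d.cut_last, p.pt_last]

/-- The part of a subdivided sequence which lies over its `i`-th block. -/
abbrev block {a b : S} (p : Chain a b) {k : ℕ} (d : Subdivision p.len k) (i : Fin k) :
    Chain (p.pt (d.cut i.castSucc)) (p.pt (d.cut i.succ)) where
  len := d.len i
  pt := fun j => p.pt ⟨(d.cut i.castSucc : ℕ) + j, d.cut_bound i j⟩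
  pt_zero := rfl
  pt_last := by
    congr 1
    ext
    exact (d.cut_succ i).symm

end Chain

/-- The sequence `X(x₀, x₁), …, X(xₙ₋₁, xₙ)` of homs along a sequence of objects of a graph. -/
abbrev EnrichedGraph.homs {V : Type u} [Category.{v} V] (X : EnrichedGraph.{v, u, w} V)
    {a b : X.carrier} (p : Chain a b) : Fin p.len → V :=
  fun i => X.hom (p.pt i.castSucc) (p.pt i.succ)

/-! ### Categories enriched in a multitensor -/

/-- A category enriched in a multitensor `E`. -/
structure MultitensorCat {V : Type u} [Category.{v} V] (E : Multitensor V) where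
  graph : EnrichedGraph.{v, u, w} V
  κ : ∀ {a b : graph.carrier} (p : Chain a b),
    (E.tensor p.len).obj (graph.homs p) ⟶ graph.hom a b
  unit_κ : ∀ a b : graph.carrier,
    E.str.unit (graph.homs (Chain.pair a b)) ≫ κ (Chain.pair a b) = 𝟙 (graph.hom a b)
  sub_κ : ∀ {a b : graph.carrier} (p : Chain a b) {k : ℕ} (d : Subdivision p.len k),
    E.str.sub d (graph.homs p) ≫ κ p =
      E.tensor.tmap (fun i => κ (p.block d i)) ≫ κ (p.coarse d)

namespace MultitensorCat

variable {V : Type u} [Category.{v} V] {E : Multitensor V}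

/-- A morphism of graphs underlies an `E`-functor when it is compatible with all compositions. -/
@[ext]
structure Hom (C D : MultitensorCat.{v, u, w} E) where
  toHom : C.graph ⟶ D.graph
  κ_map : ∀ {a b : C.graph.carrier} (p : Chain a b),
    C.κ p ≫ toHom.map a b =
      E.tensor.tmap (fun i => toHom.map (p.pt i.castSucc) (p.pt i.succ)) ≫ D.κ (p.image toHom.obj)

instance : Category (MultitensorCat.{v, u, w} E) where
  Hom := Hom
  id C := ⟨𝟙 C.graph, fun p => by
    simp only [EnrichedGraph.id_map, Category.comp_id]
    exact ((congrArg (· ≫ C.κ p) (E.tensor.tmap_id (C.graph.homs p))).trans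
      (Category.id_comp _)).symm⟩
  comp {C D F} f g := ⟨f.toHom ≫ g.toHom, fun {a b} p => by
    have h1 := f.κ_map p
    have h2 := g.κ_map (p.image f.toHom.obj)
    rw [EnrichedGraph.comp_map, ← Category.assoc, h1, Category.assoc, h2, ← Category.assoc,
      TensorFamily.tmap_comp]
    rfl⟩
  id_comp f := Hom.ext (Category.id_comp _)
  comp_id f := Hom.ext (Category.comp_id _)
  assoc f g h := Hom.ext (Category.assoc _ _ _)

/-- The forgetful functor from `E`-categories to graphs. -/
def forget (E : Multitensor V) : MultitensorCat.{v, u, w} E ⥤ EnrichedGraph.{v, u, w} V where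
  obj C := C.graph
  map f := f.toHom

end MultitensorCat

/-! ### Distributive multitensors -/

section

variable {V : Type u} [Category.{v} V]

/-- The functor `V → Vⁿ` which varies the `i`-th entry of a sequence, keeping the other entries
fixed. -/
def slot {n : ℕ} (X : Fin n → V) (i : Fin n) : V ⥤ (Fin n → V) :=
  Functor.pi' fun j => if j = i then 𝟭 V else (Functor.const V).obj (X j)

/-- A multitensor is distributive when each `Eₙ` preserves coproducts in each variable. -/
def Multitensor.IsDistributive (E : Multitensor V) : Prop :=
  ∀ (n : ℕ) (X : Fin n → V) (i : Fin n) (J : Type w),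
    PreservesColimitsOfShape (Discrete J) (slot X i ⋙ E.tensor n)

/-- The universal property of a coproduct. -/
def IsCoprod {J : Type w} {A : J → V} {C : V} (inj : ∀ j, A j ⟶ C) : Prop :=
  ∀ (Q : V) (h : ∀ j, A j ⟶ Q), ∃! f : C ⟶ Q, ∀ j, inj j ≫ f = h j

namespace IsCoprod

theorem of_isColimit {J : Type w} {A : J → V} {C : V} (inj : ∀ j, A j ⟶ C)
    (hc : IsColimit (Cofan.mk C inj)) : IsCoprod inj := by
  intro Q h
  refine ⟨Cofan.IsColimit.desc hc h, fun j => Cofan.IsColimit.fac hc h j, fun g hg => ?_⟩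
  refine Cofan.IsColimit.hom_ext hc _ _ fun j => ?_
  exact (hg j).trans (Cofan.IsColimit.fac hc h j).symm

theorem isColimit {J : Type w} {A : J → V} {C : V} {inj : ∀ j, A j ⟶ C}
    (hc : IsCoprod inj) : Nonempty (IsColimit (Cofan.mk C inj)) :=
  ⟨Cofan.IsColimit.mk _ (fun t => (hc t.pt t.inj).choose)
    (fun t j => (hc t.pt t.inj).choose_spec.1 j)
    fun t m hm => (hc t.pt t.inj).choose_spec.2 m hm⟩

theorem map {J : Type w} {A : J → V} {C : V} {inj : ∀ j, A j ⟶ C}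
    (hc : IsCoprod inj) (F : V ⥤ V) [PreservesColimitsOfShape (Discrete J) F] :
    IsCoprod fun j => F.map (inj j) :=
  of_isColimit _ (isColimitCofanMkObjOfIsColimit F _ _ hc.isColimit.some)

theorem sigma {J : Type w} (A : J → V) [HasCoproduct A] : IsCoprod (Sigma.ι A) :=
  of_isColimit _ (coproductIsCoproduct A)

theorem hom_ext {J : Type w} {A : J → V} {C : V} {inj : ∀ j, A j ⟶ C}
    (hc : IsCoprod inj) {Q : V} {f g : C ⟶ Q} (h : ∀ j, inj j ≫ f = inj j ≫ g) : f = g :=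
  (hc Q fun j => inj j ≫ g).unique h fun _ => rfl

/-- Coproducts may be reindexed along a bijection, and the objects involved may be replaced by
isomorphic ones. -/
theorem reindex {J : Type w} {A : J → V} {C : V} {inj : ∀ j, A j ⟶ C} (hc : IsCoprod inj)
    {K : Type u₁} (e : K → J) (he : Function.Bijective e) {B : K → V} (α : ∀ x, B x ≅ A (e x))
    {D : V} (β : C ≅ D) (inj' : ∀ x, B x ⟶ D)
    (h : ∀ x, inj' x = (α x).hom ≫ inj (e x) ≫ β.hom) : IsCoprod inj' := by
  intro Q g
  have h1 : ∀ j, ∃ r : A j ⟶ Q, ∀ (x : K) (hx : e x = j),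
      r = eqToHom (by rw [hx]) ≫ (α x).inv ≫ g x := by
    intro j
    obtain ⟨x, rfl⟩ := he.2 j
    refine ⟨(α x).inv ≫ g x, fun y hy => ?_⟩
    obtain rfl := he.1 hy
    simp
  choose r hr using h1
  obtain ⟨f, hf, hu⟩ := hc Q r
  refine ⟨β.inv ≫ f, fun x => ?_, fun f' hf' => ?_⟩
  · have h2 := hr (e x) x rfl
    simp only [eqToHom_refl, Category.id_comp] at h2
    simp [h, hf, h2]
  · rw [Iso.eq_inv_comp]
    apply hu
    intro j
    obtain ⟨x, rfl⟩ := he.2 j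
    have h2 := hr (e x) x rfl
    simp only [eqToHom_refl, Category.id_comp] at h2
    have h3 := hf' x
    rw [h] at h3
    simp only [h2, ← h3, Category.assoc, Iso.inv_hom_id_assoc]

/-- A coproduct of coproducts is a coproduct. -/
theorem trans {J : Type w} {B : J → V} {C : V} {p : ∀ x, B x ⟶ C} (hp : IsCoprod p)
    {K : J → Type u₁} {A : ∀ x, K x → V} {q : ∀ x y, A x y ⟶ B x} (hq : ∀ x, IsCoprod (q x)) :
    IsCoprod fun y : (Σ x, K x) => q y.1 y.2 ≫ p y.1 := by
  intro Q h
  choose f hf hu using fun x => hq x Q fun y => h ⟨x, y⟩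
  obtain ⟨g, hg, hv⟩ := hp Q f
  refine ⟨g, fun y => ?_, fun g' hg' => hv _ fun x => hu _ _ fun y => ?_⟩
  · simp [hg, hf]
  · have := hg' ⟨x, y⟩
    simpa using this

end IsCoprod

/-- The preservation of coproducts in each variable, in terms of universal properties. -/
def PreservesInEach {k : ℕ} (F : (Fin k → V) ⥤ V) : Prop :=
  ∀ (i : Fin k) (J : Type w) (B : J → Fin k → V) (C : Fin k → V) (inj : ∀ x j, B x j ⟶ C j),
    (∀ x j, j ≠ i → IsIso (inj x j)) → IsCoprod (fun x => inj x i) →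
      IsCoprod (A := fun x => F.obj (B x)) (C := F.obj C) fun x => F.map (inj x)

theorem slot_eval_self {n : ℕ} (X : Fin n → V) (i : Fin n) :
    slot X i ⋙ Pi.eval _ i = 𝟭 V := by
  rw [slot, Functor.pi'_eval, if_pos rfl]

theorem slot_eval_ne {n : ℕ} (X : Fin n → V) (i j : Fin n) (h : j ≠ i) :
    slot X i ⋙ Pi.eval _ j = (Functor.const V).obj (X j) := by
  rw [slot, Functor.pi'_eval, if_neg h]

theorem preservesInEach_of_slot {k : ℕ} (F : (Fin k → V) ⥤ V)
    (hF : ∀ (X : Fin k → V) (i : Fin k) (J : Type w),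
      PreservesColimitsOfShape (Discrete J) (slot X i ⋙ F)) : PreservesInEach.{v, u, w} F := by
  intro i J B C inj hiso hc
  have := hF C i J
  have h1 : ∀ j, ∃ β : (slot C i).obj (C i) j ≅ C j, ∀ x,
      ∃ α : B x j ≅ (slot C i).obj (B x i) j,
        inj x j = α.hom ≫ (slot C i).map (inj x i) j ≫ β.hom := by
    intro j
    by_cases hj : j = i
    · subst hj
      let s := eqToIso (slot_eval_self C j)
      refine ⟨s.app (C j), fun x => ⟨(s.app (B x j)).symm, ?_⟩⟩
      exact (NatIso.naturality_1 s (inj x j)).symm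
    · let s := eqToIso (slot_eval_ne C i j hj)
      refine ⟨s.app (C i), fun x => ?_⟩
      have := hiso x j hj
      refine ⟨asIso (inj x j) ≪≫ (s.app (B x i)).symm, ?_⟩
      exact ((Category.assoc _ _ _).trans ((congrArg (inj x j ≫ ·)
        (NatIso.naturality_1 s (inj x i))).trans (Category.comp_id _))).symm
  choose β α h2 using h1
  refine (hc.map (slot C i ⋙ F)).reindex id Function.bijective_id
    (fun x => F.mapIso (Pi.isoMk fun j => α j x)) (F.mapIso (Pi.isoMk β)) _ fun x => ?_
  have h3 : (inj x : B x ⟶ C) = (Pi.isoMk fun j => α j x : B x ≅ (slot C i).obj (B x i)).hom ≫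
      (slot C i).map (inj x i) ≫ (Pi.isoMk β : (slot C i).obj (C i) ≅ C).hom :=
    funext fun j => h2 j x
  refine (congrArg F.map h3).trans ?_
  rw [F.map_comp, F.map_comp]
  rfl

/-- Adjoining a fixed first entry to a sequence. -/
def consLeft {k : ℕ} (Z : V) : (Fin k → V) ⥤ (Fin (k + 1) → V) where
  obj X := Fin.cases Z X
  map f := Fin.cases (𝟙 Z) f
  map_id X := by
    funext i
    exact Fin.cases rfl (fun _ => rfl) i
  map_comp f g := by
    funext i
    exact Fin.cases (Category.id_comp _).symm (fun _ => rfl) i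

/-- A functor of several variables which preserves coproducts in each variable sends a sequence of
coproducts to a coproduct. -/
theorem isCoprod_multi : ∀ {k : ℕ} (F : (Fin k → V) ⥤ V) (_ : PreservesInEach.{v, u, w} F)
    {J : Fin k → Type w} {A : ∀ i, J i → V} {C : Fin k → V} (inj : ∀ i x, A i x ⟶ C i)
    (_ : ∀ i, IsCoprod (inj i)),
    IsCoprod (A := fun z : ∀ i, J i => F.obj fun i => A i (z i)) (C := F.obj C)
      fun z => F.map fun i => inj i (z i)
  | 0, F, hF, J, A, C, inj, h => by
    intro Q g
    let z₀ : ∀ i : Fin 0, J i := fun i => i.elim0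
    have hu : ∀ z : ∀ i, J i, z = z₀ := fun z => funext fun i => i.elim0
    let θ : C ⟶ fun i => A i (z₀ i) := fun i => i.elim0
    let θ' : (fun i => A i (z₀ i)) ⟶ C := fun i => inj i (z₀ i)
    have h1 : θ ≫ θ' = 𝟙 _ := funext fun i => i.elim0
    have h2 : θ' ≫ θ = 𝟙 _ := funext fun i => i.elim0
    refine ⟨F.map θ ≫ g z₀, fun z => ?_, fun f hf => ?_⟩
    · obtain rfl := hu z
      change F.map θ' ≫ F.map θ ≫ _ = _
      rw [← Category.assoc, ← F.map_comp, h2, F.map_id, Category.id_comp]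
    · have h3 : F.map θ' ≫ f = g z₀ := hf z₀
      rw [← h3, ← Category.assoc, ← F.map_comp, h1, F.map_id, Category.id_comp]
  | k + 1, F, hF, J, A, C, inj, h => by
    let C' : Fin k → V := fun i => C i.succ
    let p : ∀ x : J 0, ∀ j, (Fin.cases (A 0 x) C' : Fin (k + 1) → V) j ⟶ C j :=
      fun x => Fin.cases (inj 0 x) fun i => 𝟙 _
    have h0 : IsCoprod fun x => F.map (p x : (Fin.cases (A 0 x) C' : Fin (k + 1) → V) ⟶ C) := by
      refine hF 0 (J 0) _ C p (fun x j => ?_) (h 0)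
      refine Fin.cases (fun h => absurd rfl h) (fun i _ => ?_) j
      exact (inferInstance : IsIso (𝟙 (C i.succ)))
    have h1 : ∀ x : J 0, IsCoprod fun z : ∀ i : Fin k, J i.succ =>
        (consLeft (A 0 x) ⋙ F).map fun i => inj i.succ (z i) := by
      intro x
      refine isCoprod_multi (consLeft (A 0 x) ⋙ F) (fun i J' B D inj' hiso hD => ?_)
        (fun (i : Fin k) (y : J i.succ) => inj i.succ y) fun i => h i.succ
      refine hF i.succ J' (fun y => (consLeft (A 0 x)).obj (B y)) ((consLeft (A 0 x)).obj D)
        (fun y => (consLeft (A 0 x)).map (inj' y)) (fun y j => ?_) hD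
      refine Fin.cases (fun _ => ?_) (fun j hj => ?_) j
      · exact (inferInstance : IsIso (𝟙 (A 0 x)))
      · exact hiso y j fun e => hj (congrArg Fin.succ e)
    have h2 := h0.trans h1
    let ψ : ∀ B : Fin (k + 1) → V, B ≅ (Fin.cases (B 0) (fun i => B i.succ) : Fin (k + 1) → V) :=
      fun B => Pi.isoMk (Fin.cases (Iso.refl _) fun i => Iso.refl _)
    refine h2.reindex (fun z : ∀ i, J i => ⟨z 0, fun i => z i.succ⟩) ⟨fun z z' e => ?_, fun y => ?_⟩
      (fun z => F.mapIso (ψ fun i => A i (z i))) (Iso.refl _) _ fun z => ?_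
    · funext i
      have e1 := congrArg Sigma.fst e
      have e2 := e
      simp only [Sigma.mk.injEq] at e2
      exact Fin.cases e2.1 (fun i => congrFun (eq_of_heq e2.2) i) i
    · exact ⟨Fin.cases y.1 y.2, rfl⟩
    · have h3 : (fun i => inj i (z i) : (fun i => A i (z i)) ⟶ C) =
          (ψ fun i => A i (z i)).hom ≫
          (consLeft (A 0 (z 0))).map (fun i => inj i.succ (z i.succ)) ≫ p (z 0) := by
        funext i
        refine Fin.cases ?_ (fun i => ?_) i
        · change _ = 𝟙 _ ≫ 𝟙 _ ≫ inj 0 (z 0)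
          simp
        · change _ = 𝟙 _ ≫ inj i.succ (z i.succ) ≫ 𝟙 _
          simp
      refine (congrArg F.map h3).trans ?_
      rw [F.map_comp]
      refine congrArg (F.map (ψ fun i => A i (z i)).hom ≫ ·) ?_
      refine (F.map_comp _ _).trans ?_
      exact (Category.comp_id _).symm

end

/-! ### Doubly nested sequences -/

namespace Subdivision

variable {N k : ℕ}

theorem exists_index (d : Subdivision N k) (s : Fin N) :
    ∃ (i : Fin k) (j : Fin (d.len i)), d.index i j = s := by
  have h : ∀ m : Fin (k + 1), (s : ℕ) < d.cut m →
      ∃ (i : Fin k) (j : Fin (d.len i)), d.index i j = s := by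
    intro m
    induction m using Fin.induction with
    | zero =>
      intro h
      rw [d.cut_zero] at h
      exact absurd h (Nat.not_lt_zero _)
    | succ i ih =>
      intro h
      by_cases h' : (s : ℕ) < d.cut i.castSucc
      · exact ih h'
      · have h1 := d.cut_succ i
        refine ⟨i, ⟨(s : ℕ) - d.cut i.castSucc, by omega⟩, ?_⟩
        ext
        simp only [index]
        omega
  refine h (Fin.last k) ?_
  rw [d.cut_last]
  exact s.isLt

theorem index_lt (d : Subdivision N k) {i i' : Fin k} (h : i < i') (j : Fin (d.len i))
    (j' : Fin (d.len i')) : d.index i j < d.index i' j' := by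
  have h1 := d.cut_succ i
  have h2 : d.cut i.succ ≤ d.cut i'.castSucc := by
    apply d.cut_mono
    rw [Fin.le_def]
    rw [Fin.lt_def] at h
    simp only [Fin.val_succ, Fin.val_castSucc]
    omega
  rw [Fin.le_def] at h2
  have h3 := j.isLt
  rw [Fin.lt_def]
  simp only [index]
  omega

theorem index_inj (d : Subdivision N k) {i i' : Fin k} {j : Fin (d.len i)} {j' : Fin (d.len i')}
    (h : d.index i j = d.index i' j') : i = i' ∧ (j : ℕ) = j' := by
  have hi : i = i' := by
    rcases lt_trichotomy i i' with h1 | h1 | h1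
    · exact absurd h (d.index_lt h1 j j').ne
    · exact h1
    · exact absurd h (d.index_lt h1 j' j).ne'
  subst hi
  refine ⟨rfl, ?_⟩
  have := congrArg Fin.val h
  simpa [index] using this

theorem exists_extend (d : Subdivision N k) {P : Fin N → Type w}
    (z : ∀ i j, P (d.index i j)) : ∃ z' : ∀ s, P s, ∀ i j, z' (d.index i j) = z i j := by
  have h : ∀ s, ∃ q : P s, ∀ i j, d.index i j = s → HEq q (z i j) := by
    intro s
    obtain ⟨i, j, rfl⟩ := d.exists_index s
    refine ⟨z i j, fun i' j' h => ?_⟩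
    obtain ⟨rfl, h2⟩ := d.index_inj h
    obtain rfl := Fin.ext h2
    rfl
  choose z' hz using h
  exact ⟨z', fun i j => eq_of_heq (hz _ i j rfl)⟩

theorem eq_of_len {d d' : Subdivision N k} (h : d.len = d'.len) : d = d' := by
  obtain ⟨cut, len, h0, h1, h2⟩ := d
  obtain ⟨cut', len', h0', h1', h2'⟩ := d'
  obtain rfl : len = len' := h
  obtain rfl : cut = cut' := by
    funext i
    induction i using Fin.induction with
    | zero => rw [h0, h0']
    | succ i ih =>
      ext
      rw [h2, h2', ih]
  rfl

theorem total_eq_of_len {N' : ℕ} {d : Subdivision N k} {d' : Subdivision N' k}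
    (h : d.len = d'.len) : N = N' := by
  have : ∀ i, (d.cut i : ℕ) = d'.cut i := by
    intro i
    induction i using Fin.induction with
    | zero => rw [d.cut_zero, d'.cut_zero]; rfl
    | succ i ih => rw [d.cut_succ, d'.cut_succ, ih, h]
  have := this (Fin.last k)
  rwa [d.cut_last, d'.cut_last] at this

end Subdivision

/-- Joining sequences end to end. -/
theorem exists_join {S : Type w} (n : ℕ → ℕ) (z : ℕ → ℕ → S)
    (hz : ∀ i, z (i + 1) 0 = z i (n i)) (m : ℕ) :
    ∃ f : ℕ → S, f (∑ x ∈ Finset.range m, n x) = z m 0 ∧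
      ∀ i < m, ∀ j ≤ n i, f ((∑ x ∈ Finset.range i, n x) + j) = z i j := by
  induction m with
  | zero => exact ⟨fun _ => z 0 0, rfl, fun i hi => absurd hi (Nat.not_lt_zero _)⟩
  | succ m ih =>
    obtain ⟨f, hf, hf'⟩ := ih
    have key : ∀ j ≤ n m, (if (∑ x ∈ Finset.range m, n x) + j ≤ ∑ x ∈ Finset.range m, n x then
        f ((∑ x ∈ Finset.range m, n x) + j) else
        z m ((∑ x ∈ Finset.range m, n x) + j - ∑ x ∈ Finset.range m, n x)) = z m j := by
      intro j _
      split_ifs with h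
      · obtain rfl : j = 0 := by omega
        exact hf
      · rw [Nat.add_sub_cancel_left]
    refine ⟨fun s => if s ≤ ∑ x ∈ Finset.range m, n x then f s else
      z m (s - ∑ x ∈ Finset.range m, n x), ?_, fun i hi j hj => ?_⟩
    · rw [Finset.sum_range_succ, hz]
      exact key _ le_rfl
    · rcases Nat.lt_succ_iff_lt_or_eq.1 hi with h | rfl
      · have h1 : (∑ x ∈ Finset.range i, n x) + j ≤ ∑ x ∈ Finset.range m, n x := by
          have h2 : ∑ x ∈ Finset.range (i + 1), n x ≤ ∑ x ∈ Finset.range m, n x :=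
            Finset.sum_le_sum_of_subset (Finset.range_subset_range.2 h)
          rw [Finset.sum_range_succ] at h2
          omega
        simp only [if_pos h1]
        exact hf' i h j hj
      · exact key j hj

namespace Chain

variable {S : Type w}

/-- The underlying sequence of a chain. -/
def data {a b : S} (p : Chain a b) : Σ n : ℕ, Fin (n + 1) → S := ⟨p.len, p.pt⟩

theorem ext_data {a b : S} {p q : Chain a b} (h : p.data = q.data) : p = q := by
  obtain ⟨n, f, h0, h1⟩ := p
  obtain ⟨m, g, h0', h1'⟩ := q
  obtain ⟨h2, h3⟩ := Sigma.mk.inj h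
  simp only at h2
  subst h2
  obtain rfl := eq_of_heq h3
  rfl

/-- A sequence together with a chain between any two consecutive elements. -/
abbrev Nested (a b : S) := Σ y : Chain a b, ∀ i : Fin y.len, Chain (y.pt i.castSucc) (y.pt i.succ)

/-- A sequence together with a subdivision. -/
abbrev Divided (a b : S) := Σ p : Chain a b, Σ k : ℕ, Subdivision p.len k

/-- A subdivided sequence regarded as a doubly nested sequence. -/
def Divided.nested {a b : S} (t : Divided a b) : Nested a b :=
  ⟨t.1.coarse t.2.2, fun i => t.1.block t.2.2 i⟩

theorem nested_injective {a b : S} :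
    Function.Injective (Divided.nested : Divided a b → Nested a b) := by
  rintro ⟨p, k, d⟩ ⟨p', k', d'⟩ h
  have h1 := congrArg (fun t : Nested a b =>
    (⟨t.1.len, fun i => (t.2 i).data⟩ : Σ k : ℕ, Fin k → Σ n : ℕ, Fin (n + 1) → S)) h
  obtain ⟨h2, h3⟩ := Sigma.mk.inj h1
  change k = k' at h2
  subst h2
  have h4 : ∀ i, (p.block d i).data = (p'.block d' i).data := congrFun (eq_of_heq h3)
  have hl : d.len = d'.len := funext fun i => congrArg Sigma.fst (h4 i)
  obtain ⟨n, f, h0, hn⟩ := p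
  obtain ⟨n', f', h0', hn'⟩ := p'
  obtain rfl : n = n' := Subdivision.total_eq_of_len hl
  obtain rfl := Subdivision.eq_of_len hl
  obtain rfl : f = f' := by
    funext s
    refine Fin.cases (h0.trans h0'.symm) (fun s => ?_) s
    obtain ⟨i, j, rfl⟩ := d.exists_index s
    have h5 := eq_of_heq (Sigma.mk.inj (h4 i)).2
    exact congrFun h5 j.succ
  rfl

theorem nested_surjective {a b : S} :
    Function.Surjective (Divided.nested : Divided a b → Nested a b) := by
  rintro ⟨y, z⟩
  let n : ℕ → ℕ := fun i => if h : i < y.len then (z ⟨i, h⟩).len else 0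
  let zz : ℕ → ℕ → S := fun i j => if h : i < y.len then
    (if h' : j < (z ⟨i, h⟩).len + 1 then (z ⟨i, h⟩).pt ⟨j, h'⟩ else b) else b
  have hn : ∀ i : Fin y.len, n i = (z i).len := fun i => dif_pos i.isLt
  have hzz : ∀ (i : Fin y.len) (j : Fin ((z i).len + 1)), zz i j = (z i).pt j := by
    intro i j
    change dite _ _ _ = _
    rw [dif_pos i.isLt]
    exact dif_pos j.isLt
  have hzs : ∀ i : Fin y.len, zz i 0 = y.pt i.castSucc := fun i =>
    (hzz i 0).trans (z i).pt_zero
  have hze : ∀ i : Fin y.len, zz i (n i) = y.pt i.succ := fun i => by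
    rw [hn]
    exact (hzz i (Fin.last _)).trans (z i).pt_last
  have hb : ∀ i, y.len ≤ i → ∀ j, zz i j = b := fun i hi j => dif_neg (by omega)
  have hz : ∀ i, zz (i + 1) 0 = zz i (n i) := by
    intro i
    rcases lt_trichotomy (i + 1) y.len with h | h | h
    · have h1 := hzs ⟨i + 1, h⟩
      have h2 := hze ⟨i, by omega⟩
      exact h1.trans h2.symm
    · have h2 := hze ⟨i, by omega⟩
      rw [hb _ h.ge]
      refine (Eq.trans h2 ?_).symm
      refine Eq.trans ?_ y.pt_last
      congr 1
      ext
      exact h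
    · rw [hb _ h.le, hb _ (by omega)]
  obtain ⟨f, hf, hf'⟩ := exists_join n zz hz y.len
  let c : ℕ → ℕ := fun i => ∑ x ∈ Finset.range i, n x
  have hc : ∀ i ≤ y.len, c i ≤ c y.len := fun i hi =>
    Finset.sum_le_sum_of_subset (Finset.range_subset_range.2 hi)
  have hcz : ∀ i : Fin (y.len + 1), f (c i) = y.pt i := by
    intro i
    refine Fin.lastCases ?_ (fun i => ?_) i
    · refine hf.trans ((hb _ le_rfl _).trans y.pt_last.symm)
    · exact (hf' i i.isLt 0 (Nat.zero_le _)).trans (hzs i)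
  let p : Chain a b :=
    { len := c y.len
      pt := fun i => f i
      pt_zero := (hcz 0).trans y.pt_zero
      pt_last := (hcz (Fin.last _)).trans y.pt_last }
  let d : Subdivision p.len y.len :=
    { cut := fun i => ⟨c i, Nat.lt_succ_of_le (hc i (Nat.le_of_lt_succ i.isLt))⟩
      len := fun i => (z i).len
      cut_zero := rfl
      cut_last := rfl
      cut_succ := fun i => by
        simp only [Fin.val_succ, Fin.val_castSucc]
        rw [← hn i]
        exact Finset.sum_range_succ _ _ }
  refine ⟨⟨p, y.len, d⟩, ?_⟩
  have hy : p.coarse d = y := by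
    refine ext_data ?_
    have : (p.coarse d).pt = y.pt := funext hcz
    exact congrArg (Sigma.mk y.len) this
  have hblock : ∀ i : Fin y.len, (p.block d i).data = (z i).data := by
    intro i
    have : (p.block d i).pt = (z i).pt := by
      funext j
      refine Eq.trans ?_ (hzz i j)
      refine hf' i i.isLt j ?_
      rw [hn]
      exact Nat.le_of_lt_succ j.isLt
    exact congrArg (Sigma.mk (z i).len) this
  have gen : ∀ (y' : Chain a b) (_ : y' = y)
      (z' : ∀ i : Fin y'.len, Chain (y'.pt i.castSucc) (y'.pt i.succ)),
      (∀ (i : Fin y'.len) (i' : Fin y.len), (i : ℕ) = i' → (z' i).data = (z i').data) →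
      (⟨y', z'⟩ : Nested a b) = ⟨y, z⟩ := by
    rintro y' rfl z' h
    obtain rfl : z' = z := funext fun i => ext_data (h i i rfl)
    rfl
  refine gen _ hy _ fun i i' h => ?_
  obtain rfl : i = i' := Fin.ext h
  exact hblock i

end Chain

/-! ### The monad on enriched graphs associated to a distributive multitensor -/

namespace Gamma

variable {V : Type u} [Category.{v} V] [HasCoproducts.{w} V] (E : Multitensor V)

/-- The graph `Γ(E)(X)`: it has the objects of `X`, and its hom from `a` to `b` is the coproduct of
the objects `E_i X(x_{i-1}, x_i)` over all sequences `a = x₀, …, xₙ = b`. -/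
noncomputable def onObj (X : EnrichedGraph.{v, u, w} V) : EnrichedGraph.{v, u, w} V where
  carrier := X.carrier
  hom a b := ∐ fun p : Chain a b => (E.tensor p.len).obj (X.homs p)

/-- The inclusion of the summand indexed by a sequence. -/
noncomputable def inj (X : EnrichedGraph.{v, u, w} V) {a b : X.carrier} (p : Chain a b) :
    (E.tensor p.len).obj (X.homs p) ⟶ (onObj E X).hom a b :=
  Sigma.ι (fun p : Chain a b => (E.tensor p.len).obj (X.homs p)) p

theorem isCoprod_inj (X : EnrichedGraph.{v, u, w} V) (a b : X.carrier) :
    IsCoprod fun p : Chain a b => inj E X p :=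
  IsCoprod.sigma _

/-- The action of `Γ(E)` on a morphism of graphs. -/
noncomputable def onMap {X Y : EnrichedGraph.{v, u, w} V} (f : X ⟶ Y) : onObj E X ⟶ onObj E Y where
  obj := f.obj
  map a b := Sigma.desc fun p : Chain a b =>
    E.tensor.tmap (fun i => f.map (p.pt i.castSucc) (p.pt i.succ)) ≫ inj E Y (p.image f.obj)

theorem inj_onMap {X Y : EnrichedGraph.{v, u, w} V} (f : X ⟶ Y) {a b : X.carrier}
    (p : Chain a b) : inj E X p ≫ (onMap E f).map a b =
      E.tensor.tmap (fun i => f.map (p.pt i.castSucc) (p.pt i.succ)) ≫ inj E Y (p.image f.obj) :=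
  Sigma.ι_desc _ _

/-- The endofunctor `Γ(E)`. -/
noncomputable def functor : EnrichedGraph.{v, u, w} V ⥤ EnrichedGraph.{v, u, w} V where
  obj := onObj E
  map := onMap E
  map_id X := by
    refine EnrichedGraph.Hom.ext rfl (heq_of_eq ?_)
    funext a b
    refine (isCoprod_inj E X a b).hom_ext fun p => (inj_onMap E (𝟙 X) p).trans ?_
    refine (congrArg (· ≫ inj E X p) (E.tensor.tmap_id (X.homs p))).trans ?_
    exact (Category.id_comp _).trans (Category.comp_id _).symm
  map_comp {X Y Z} f g := by
    refine EnrichedGraph.Hom.ext rfl (heq_of_eq ?_)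
    funext a b
    refine (isCoprod_inj E X a b).hom_ext fun p => (inj_onMap E (f ≫ g) p).trans ?_
    refine Eq.trans ?_ (Category.assoc _ _ _)
    refine Eq.trans ?_ (congrArg (· ≫ (onMap E g).map (f.obj a) (f.obj b)) (inj_onMap E f p)).symm
    refine Eq.trans ?_ (Category.assoc _ _ _).symm
    refine Eq.trans ?_ (congrArg (E.tensor.tmap _ ≫ ·) (inj_onMap E g (p.image f.obj))).symm
    refine Eq.trans ?_ (Category.assoc _ _ _)
    exact congrArg (· ≫ inj E Z (p.image (f ≫ g).obj)) (E.tensor.tmap_comp _ _).symm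

/-- The inclusion of `E_i E_j X(x_{ij-1}, x_ij)` into a hom of `Γ(E)(Γ(E)(X))`. -/
noncomputable def inj₂ (X : EnrichedGraph.{v, u, w} V) {a b : X.carrier} (p : Chain a b) {k : ℕ}
    (d : Subdivision p.len k) :
    (E.tensor k).obj (fun i => (E.tensor (d.len i)).obj fun j => X.homs p (d.index i j)) ⟶
      (onObj E (onObj E X)).hom a b :=
  E.tensor.tmap (fun i => inj E X (p.block d i)) ≫ inj E (onObj E X) (p.coarse d)

/-- The general form of `inj₂`, for nested sequences. -/
noncomputable def injNested (X : EnrichedGraph.{v, u, w} V) {a b : X.carrier}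
    (t : Chain.Nested a b) :
    (E.tensor t.1.len).obj (fun i => (E.tensor (t.2 i).len).obj (X.homs (t.2 i))) ⟶
      (onObj E (onObj E X)).hom a b :=
  E.tensor.tmap (fun i => inj E X (t.2 i)) ≫ inj E (onObj E X) t.1

variable {E}

theorem isCoprod_inj₂ (hE : Multitensor.IsDistributive.{v, u, w} E) (X : EnrichedGraph.{v, u, w} V)
    (a b : X.carrier) : IsCoprod fun t : Chain.Divided a b => inj₂ E X t.1 t.2.2 := by
  have h := (isCoprod_inj E (onObj E X) a b).trans fun y : Chain a b =>
    isCoprod_multi (E.tensor y.len) (preservesInEach_of_slot _ (hE y.len))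
      (fun i (z : Chain (y.pt i.castSucc) (y.pt i.succ)) => inj E X z)
      fun i => isCoprod_inj E X _ _
  refine h.reindex Chain.Divided.nested ⟨Chain.nested_injective, Chain.nested_surjective⟩
    (fun t => Iso.refl _) (Iso.refl _) _ fun t => ?_
  exact ((Category.id_comp _).trans (Category.comp_id _)).symm

/-- The hom maps of the multiplication of `Γ(E)`, determined by `inj₂_mul`. -/
noncomputable def mulHom (hE : Multitensor.IsDistributive.{v, u, w} E)
    (X : EnrichedGraph.{v, u, w} V) (a b : X.carrier) :
    (onObj E (onObj E X)).hom a b ⟶ (onObj E X).hom a b :=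
  (isCoprod_inj₂ hE X a b _ fun t => E.str.sub t.2.2 (X.homs t.1) ≫ inj E X t.1).choose

theorem inj₂_mul (hE : Multitensor.IsDistributive.{v, u, w} E) (X : EnrichedGraph.{v, u, w} V)
    {a b : X.carrier} (p : Chain a b) {k : ℕ} (d : Subdivision p.len k) :
    inj₂ E X p d ≫ mulHom hE X a b = E.str.sub d (X.homs p) ≫ inj E X p :=
  (isCoprod_inj₂ hE X a b _ fun t =>
    E.str.sub t.2.2 (X.homs t.1) ≫ inj E X t.1).choose_spec.1 ⟨p, k, d⟩

variable (E)

/-- The hom maps of the unit of `Γ(E)`. -/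
noncomputable def unitHom (X : EnrichedGraph.{v, u, w} V) (a b : X.carrier) :
    X.hom a b ⟶ (onObj E X).hom a b :=
  E.str.unit (X.homs (Chain.pair a b)) ≫ inj E X (Chain.pair a b)

variable {E}

theorem inj₂_onMap {X Y : EnrichedGraph.{v, u, w} V} (f : X ⟶ Y) {a b : X.carrier}
    (p : Chain a b) {k : ℕ} (d : Subdivision p.len k) :
    inj₂ E X p d ≫ (onMap E (onMap E f)).map a b =
      E.tensor.tmap (fun i => E.tensor.tmap fun j =>
        f.map (p.pt (d.index i j).castSucc) (p.pt (d.index i j).succ)) ≫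
          inj₂ E Y (p.image f.obj) d := by
  refine (Category.assoc _ _ _).trans ?_
  refine (congrArg (E.tensor.tmap _ ≫ ·) (inj_onMap E (onMap E f) (p.coarse d))).trans ?_
  refine (Category.assoc _ _ _).symm.trans ?_
  refine Eq.trans ?_ (Category.assoc _ _ _)
  refine congrArg (· ≫ inj E (onObj E Y) ((p.image f.obj).coarse d)) ?_
  refine (E.tensor.tmap_comp _ _).trans (Eq.trans ?_ (E.tensor.tmap_comp _ _).symm)
  exact congrArg E.tensor.tmap (funext fun i => inj_onMap E f (p.block d i))

theorem unit_inj_congr (X : EnrichedGraph.{v, u, w} V) {a b : X.carrier}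
    {f g : Fin 2 → X.carrier} (h : f = g) (hf : f 0 = a) (hf' : f (Fin.last 1) = b) (hg : g 0 = a)
    (hg' : g (Fin.last 1) = b) :
    HEq (E.str.unit (X.homs (⟨1, f, hf, hf'⟩ : Chain a b)) ≫ inj E X ⟨1, f, hf, hf'⟩)
      (E.str.unit (X.homs (⟨1, g, hg, hg'⟩ : Chain a b)) ≫ inj E X ⟨1, g, hg, hg'⟩) := by
  subst h
  rfl

theorem inj_congr (X : EnrichedGraph.{v, u, w} V) {a b : X.carrier} {n : ℕ}
    {f g : Fin (n + 1) → X.carrier} (h : f = g) (hf : f 0 = a) (hf' : f (Fin.last n) = b)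
    (hg : g 0 = a) (hg' : g (Fin.last n) = b)
    (e : ∀ j : Fin n, X.hom (f j.castSucc) (f j.succ) = X.hom (g j.castSucc) (g j.succ)) :
    E.tensor.tmap (fun j => eqToHom (e j)) ≫ inj E X (⟨n, g, hg, hg'⟩ : Chain a b) =
      inj E X ⟨n, f, hf, hf'⟩ := by
  subst h
  simp only [eqToHom_refl]
  exact (congrArg (· ≫ inj E X (⟨n, f, hf, hf'⟩ : Chain a b)) (E.tensor.tmap_id
    (fun j => X.hom (f j.castSucc) (f j.succ)))).trans (Category.id_comp _)

theorem injNested_congr (X : EnrichedGraph.{v, u, w} V) {a b : X.carrier} {n : ℕ} {m : Fin n → ℕ}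
    {f g : Fin (n + 1) → X.carrier} (h : f = g) (hf : f 0 = a) (hf' : f (Fin.last n) = b)
    (hg : g 0 = a) (hg' : g (Fin.last n) = b) {F G : ∀ j : Fin n, Fin (m j + 1) → X.carrier}
    (H : F = G) (hF : ∀ j, F j 0 = f j.castSucc) (hF' : ∀ j, F j (Fin.last _) = f j.succ)
    (hG : ∀ j, G j 0 = g j.castSucc) (hG' : ∀ j, G j (Fin.last _) = g j.succ)
    (e : ∀ (j : Fin n) (l : Fin (m j)), X.hom (F j l.castSucc) (F j l.succ) =
      X.hom (G j l.castSucc) (G j l.succ)) :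
    E.tensor.tmap (fun j => E.tensor.tmap fun l => eqToHom (e j l)) ≫
        injNested E X ⟨(⟨n, g, hg, hg'⟩ : Chain a b), fun j => ⟨m j, G j, hG j, hG' j⟩⟩ =
      injNested E X ⟨(⟨n, f, hf, hf'⟩ : Chain a b), fun j => ⟨m j, F j, hF j, hF' j⟩⟩ := by
  subst h
  subst H
  simp only [eqToHom_refl, TensorFamily.tmap_id]
  exact Category.id_comp _

/-- The unit of `Γ(E)`. -/
noncomputable def unit : 𝟭 (EnrichedGraph.{v, u, w} V) ⟶ functor E where
  app X := EnrichedGraph.Hom.ofHoms (unitHom E X)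
  naturality X Y f := by
    refine EnrichedGraph.Hom.ext rfl (heq_of_eq ?_)
    funext a b
    change f.map a b ≫ E.str.unit (Y.homs (Chain.pair (f.obj a) (f.obj b))) ≫
        inj E Y (Chain.pair (f.obj a) (f.obj b)) =
      (E.str.unit (X.homs (Chain.pair a b)) ≫ inj E X (Chain.pair a b)) ≫ (onMap E f).map a b
    have e : (Chain.pair (f.obj a) (f.obj b)).pt = ((Chain.pair a b).image f.obj).pt := by
      funext i
      exact Fin.cases rfl (fun _ => rfl) i
    have h1 := eq_of_heq (unit_inj_congr (E := E) Y e (Chain.pair _ _).pt_zero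
      (Chain.pair _ _).pt_last ((Chain.pair a b).image f.obj).pt_zero
      ((Chain.pair a b).image f.obj).pt_last)
    refine (congrArg (f.map a b ≫ ·) h1).trans ?_
    refine Eq.trans ?_ (Category.assoc _ _ _).symm
    refine Eq.trans ?_ (congrArg (E.str.unit _ ≫ ·) (inj_onMap E f (Chain.pair a b))).symm
    refine (Category.assoc _ _ _).symm.trans (Eq.trans ?_ (Category.assoc _ _ _))
    exact congrArg (· ≫ inj E Y ((Chain.pair a b).image f.obj))
      (E.str.unit_naturality fun i : Fin 1 =>
        f.map ((Chain.pair a b).pt i.castSucc) ((Chain.pair a b).pt i.succ))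

/-- The multiplication of `Γ(E)`. -/
noncomputable def mul (hE : Multitensor.IsDistributive.{v, u, w} E) :
    functor E ⋙ functor E ⟶ (functor E : EnrichedGraph.{v, u, w} V ⥤ EnrichedGraph.{v, u, w} V)
    where
  app X := EnrichedGraph.Hom.ofHoms (mulHom hE X)
  naturality X Y f := by
    refine EnrichedGraph.Hom.ext rfl (heq_of_eq ?_)
    funext a b
    change (onMap E (onMap E f)).map a b ≫ mulHom hE Y (f.obj a) (f.obj b) =
      mulHom hE X a b ≫ (onMap E f).map a b
    refine (isCoprod_inj₂ hE X a b).hom_ext fun ⟨p, k, d⟩ => ?_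
    refine (Category.assoc _ _ _).symm.trans (Eq.trans ?_ (Category.assoc _ _ _))
    refine (congrArg (· ≫ mulHom hE Y (f.obj a) (f.obj b)) (inj₂_onMap f p d)).trans ?_
    refine Eq.trans ?_ (congrArg (· ≫ (onMap E f).map a b) (inj₂_mul hE X p d)).symm
    refine (Category.assoc _ _ _).trans (Eq.trans ?_ (Category.assoc _ _ _).symm)
    refine (congrArg (E.tensor.tmap _ ≫ ·) (inj₂_mul hE Y (p.image f.obj) d)).trans ?_
    refine Eq.trans ?_ (congrArg (E.str.sub d _ ≫ ·) (inj_onMap E f p)).symm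
    refine (Category.assoc _ _ _).symm.trans (Eq.trans ?_ (Category.assoc _ _ _))
    exact congrArg (· ≫ inj E Y (p.image f.obj)) (E.str.sub_naturality d fun s =>
      f.map (p.pt s.castSucc) (p.pt s.succ))

theorem unit_mul (hE : Multitensor.IsDistributive.{v, u, w} E) (X : EnrichedGraph.{v, u, w} V)
    (a b : X.carrier) : unitHom E (onObj E X) a b ≫ mulHom hE X a b = 𝟙 _ := by
  refine (isCoprod_inj E X a b).hom_ext fun p => ?_
  obtain ⟨n, pt, rfl, rfl⟩ := p
  let p : Chain (pt 0) (pt (Fin.last n)) := ⟨n, pt, rfl, rfl⟩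
  let d := Subdivision.whole n
  have e : (Chain.pair (pt 0) (pt (Fin.last n))).pt = (p.coarse d).pt := by
    funext i
    exact Fin.cases rfl (fun _ => rfl) i
  have h1 : unitHom E (onObj E X) (pt 0) (pt (Fin.last n)) =
      E.str.unit ((onObj E X).homs (p.coarse d)) ≫ inj E (onObj E X) (p.coarse d) :=
    eq_of_heq (unit_inj_congr (E := E) (onObj E X) e (Chain.pair _ _).pt_zero
      (Chain.pair _ _).pt_last (p.coarse d).pt_zero (p.coarse d).pt_last)
  have e2 : ((p.block d 0).pt : Fin (n + 1) → X.carrier) = pt := by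
    funext j
    refine congrArg pt (Fin.ext ?_)
    exact Nat.zero_add _
  have h2 := inj_congr (E := E) X e2 (p.block d 0).pt_zero (p.block d 0).pt_last rfl rfl fun j =>
    congrArg (X.homs p) (Subdivision.index_whole n 0 j)
  have h3 := E.str.unit_naturality (fun i : Fin 1 => inj E X (p.block d i))
  have h4 := E.str.unit_sub (X.homs p)
  have h5 := inj₂_mul hE X p d
  refine Eq.trans ?_ (Category.comp_id _).symm
  refine (congrArg (fun q => inj E X p ≫ q ≫ mulHom hE X _ _) h1).trans ?_
  -- replace `inj p` by the inclusion at the only block of `p`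
  have iso : IsIso (E.tensor.tmap fun j => eqToHom
      (congrArg (X.homs p) (Subdivision.index_whole n 0 j))) :=
    ((E.tensor n).mapIso (Pi.isoMk fun j =>
      eqToIso (congrArg (X.homs p) (Subdivision.index_whole n 0 j)))).isIso_hom
  refine (cancel_epi (E.tensor.tmap fun j => eqToHom
      (congrArg (X.homs p) (Subdivision.index_whole n 0 j)))).1 ?_
  refine (Category.assoc _ _ _).symm.trans ?_
  refine (congrArg (· ≫ (E.str.unit ((onObj E X).homs (p.coarse d)) ≫
    inj E (onObj E X) (p.coarse d)) ≫ mulHom hE X _ _) h2).trans ?_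
  refine (congrArg (inj E X (p.block d 0) ≫ ·) (Category.assoc _ _ _)).trans ?_
  refine (Category.assoc _ _ _).symm.trans ?_
  refine (congrArg (· ≫ inj E (onObj E X) (p.coarse d) ≫ mulHom hE X _ _) h3).trans ?_
  refine (Category.assoc _ _ _).trans ?_
  refine (congrArg (E.str.unit _ ≫ ·) (Category.assoc _ _ _).symm).trans ?_
  refine (congrArg (E.str.unit _ ≫ ·) h5).trans ?_
  refine (Category.assoc _ _ _).symm.trans ?_
  exact congrArg (· ≫ inj E X p) h4

theorem map_unit_mul (hE : Multitensor.IsDistributive.{v, u, w} E)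
    (X : EnrichedGraph.{v, u, w} V) (a b : X.carrier) :
    (onMap E (unit.app X)).map a b ≫ mulHom hE X a b = 𝟙 _ := by
  refine (isCoprod_inj E X a b).hom_ext fun p => ?_
  let d := Subdivision.singles p.len
  refine Eq.trans ?_ (Category.comp_id _).symm
  refine (Category.assoc _ _ _).symm.trans ?_
  refine (congrArg (· ≫ mulHom hE X a b) (inj_onMap E (unit.app X) p)).trans ?_
  have h1 : ∀ i : Fin p.len, unitHom E X (p.pt i.castSucc) (p.pt i.succ) =
      E.str.unit (X.homs (p.block d i)) ≫ inj E X (p.block d i) := by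
    intro i
    have e : (Chain.pair (p.pt i.castSucc) (p.pt i.succ)).pt = (p.block d i).pt := by
      funext j
      exact Fin.cases rfl (fun j => Fin.cases rfl (fun j => j.elim0) j) j
    exact eq_of_heq (unit_inj_congr (E := E) X e (Chain.pair _ _).pt_zero
      (Chain.pair _ _).pt_last (p.block d i).pt_zero (p.block d i).pt_last)
  have h2 := inj₂_mul hE X p d
  have h3 := E.str.sub_unit (X.homs p)
  refine (congrArg (fun q => (E.tensor.tmap q ≫ inj E (onObj E X) (p.coarse d)) ≫
    mulHom hE X a b) (funext h1)).trans ?_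
  refine (congrArg (fun q => (q ≫ inj E (onObj E X) (p.coarse d)) ≫
    mulHom hE X a b) (E.tensor.tmap_comp _ _).symm).trans ?_
  refine (congrArg (· ≫ mulHom hE X a b) (Category.assoc _ _ _)).trans ?_
  refine (Category.assoc _ _ _).trans ?_
  refine (congrArg (E.tensor.tmap _ ≫ ·) h2).trans ?_
  refine (Category.assoc _ _ _).symm.trans ?_
  exact (congrArg (· ≫ inj E X p) h3).trans (Category.id_comp _)

/-- The inclusion of `E_i E_j E_l X(x_{ijl-1}, x_ijl)` into a hom of `Γ(E)(Γ(E)(Γ(E)(X)))`. -/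
noncomputable def inj₃ (E : Multitensor V) (X : EnrichedGraph.{v, u, w} V) {a b : X.carrier}
    (p : Chain a b) {M k : ℕ} (d : Subdivision p.len M) (c : Subdivision M k) :
    (E.tensor k).obj (fun i => (E.tensor (c.len i)).obj fun j =>
        (E.tensor (d.len (c.index i j))).obj fun l => X.homs p (d.index (c.index i j) l)) ⟶
      (onObj E (onObj E (onObj E X))).hom a b :=
  E.tensor.tmap (fun i => E.tensor.tmap fun j => inj E X (p.block d (c.index i j))) ≫
    inj₂ E (onObj E X) (p.coarse d) c

theorem inj₃_hom_ext (hE : Multitensor.IsDistributive.{v, u, w} E)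
    (X : EnrichedGraph.{v, u, w} V) {a b : X.carrier} {Q : V}
    {f g : (onObj E (onObj E (onObj E X))).hom a b ⟶ Q}
    (h : ∀ (p : Chain a b) (M k : ℕ) (d : Subdivision p.len M) (c : Subdivision M k),
      inj₃ E X p d c ≫ f = inj₃ E X p d c ≫ g) : f = g := by
  refine (isCoprod_inj₂ hE (onObj E X) a b).hom_ext fun ⟨y, k, c⟩ => ?_
  have h1 := isCoprod_multi (E.tensor k) (preservesInEach_of_slot _ (hE k))
    (J := fun i => ∀ j : Fin (c.len i),
      Chain (y.pt (c.index i j).castSucc) (y.pt (c.index i j).succ))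
    (A := fun i z => (E.tensor (c.len i)).obj fun j => (E.tensor (z j).len).obj (X.homs (z j)))
    (C := fun i => (E.tensor (c.len i)).obj fun j =>
      (onObj E X).hom (y.pt (c.index i j).castSucc) (y.pt (c.index i j).succ))
    (fun i (z : ∀ j : Fin (c.len i), Chain (y.pt (c.index i j).castSucc) (y.pt (c.index i j).succ)) =>
      E.tensor.tmap fun j => inj E X (z j))
    fun i => isCoprod_multi (E.tensor (c.len i)) (preservesInEach_of_slot _ (hE _))
      (fun (j : Fin (c.len i)) (z : Chain (y.pt (c.index i j).castSucc) (y.pt (c.index i j).succ)) =>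
        inj E X z) fun j => isCoprod_inj E X _ _
  refine h1.hom_ext fun z => ?_
  obtain ⟨z', hz⟩ := c.exists_extend
    (P := fun s => Chain (y.pt s.castSucc) (y.pt s.succ)) z
  obtain rfl : (fun i j => z' (c.index i j)) = z := funext fun i => funext fun j => hz i j
  obtain ⟨⟨p, M, d⟩, hp⟩ := Chain.nested_surjective (⟨y, z'⟩ : Chain.Nested a b)
  cases hp
  exact (Category.assoc _ _ _).symm.trans ((h p M k d c).trans (Category.assoc _ _ _))

theorem inj_block_block (X : EnrichedGraph.{v, u, w} V) {a b : X.carrier} (p : Chain a b)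
    {M k : ℕ} (d : Subdivision p.len M) (c : Subdivision M k) (i : Fin k) :
    E.tensor.tmap (fun j => inj E X (p.block d (c.index i j))) ≫
        inj E (onObj E X) ((p.coarse d).block c i) =
      E.tensor.tmap (fun j => E.tensor.tmap fun l => eqToHom
        (congrArg (X.homs p) (Subdivision.index_comp d c i j l).symm)) ≫
          inj₂ E X (p.block (d.comp c) i) (d.restrict c i) := by
  have h1 : ∀ j : Fin (c.len i + 1), (d.cut (c.cut i.castSucc) : ℕ) ≤
      d.cut ⟨(c.cut i.castSucc : ℕ) + j, c.cut_bound i j⟩ := by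
    intro j
    have : d.cut (c.cut i.castSucc) ≤ d.cut ⟨(c.cut i.castSucc : ℕ) + j, c.cut_bound i j⟩ := by
      apply d.cut_mono
      rw [Fin.le_def]
      simp
    exact this
  refine (injNested_congr (E := E) X (a := p.pt (d.cut (c.cut i.castSucc)))
    (b := p.pt (d.cut (c.cut i.succ))) (n := c.len i) (m := fun j => d.len (c.index i j))
    (f := ((p.coarse d).block c i).pt)
    (g := ((p.block (d.comp c) i).coarse (d.restrict c i)).pt) ?_
    ((p.coarse d).block c i).pt_zero ((p.coarse d).block c i).pt_last
    ((p.block (d.comp c) i).coarse (d.restrict c i)).pt_zero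
    ((p.block (d.comp c) i).coarse (d.restrict c i)).pt_last
    (F := fun j => (p.block d (c.index i j)).pt)
    (G := fun j => ((p.block (d.comp c) i).block (d.restrict c i) j).pt) ?_
    (fun j => (p.block d (c.index i j)).pt_zero) (fun j => (p.block d (c.index i j)).pt_last)
    (fun j => ((p.block (d.comp c) i).block (d.restrict c i) j).pt_zero)
    (fun j => ((p.block (d.comp c) i).block (d.restrict c i) j).pt_last)
    fun j l => congrArg (X.homs p) (Subdivision.index_comp d c i j l).symm).symm
  · funext j
    refine congrArg p.pt (Fin.ext ?_)
    exact (Nat.add_sub_cancel' (h1 j)).symm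
  · funext j l
    refine congrArg p.pt (Fin.ext ?_)
    have h2 := h1 j.castSucc
    change (d.cut (c.index i j).castSucc : ℕ) + l = (d.cut (c.cut i.castSucc) : ℕ) +
      (((d.cut (c.index i j).castSucc : ℕ) - (d.cut (c.cut i.castSucc) : ℕ)) + l)
    change (d.cut (c.cut i.castSucc) : ℕ) ≤ (d.cut (c.index i j).castSucc : ℕ) at h2
    omega

theorem mul_mul (hE : Multitensor.IsDistributive.{v, u, w} E)
    (X : EnrichedGraph.{v, u, w} V) (a b : X.carrier) :
    (onMap E ((mul hE).app X)).map a b ≫ mulHom hE X a b =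
      mulHom hE (onObj E X) a b ≫ mulHom hE X a b := by
  refine inj₃_hom_ext hE X fun p M k d c => ?_
  have hR : inj₃ E X p d c ≫ mulHom hE (onObj E X) a b ≫ mulHom hE X a b =
      (E.str.sub c (fun s => (E.tensor (d.len s)).obj fun l => X.homs p (d.index s l)) ≫
        E.str.sub d (X.homs p)) ≫ inj E X p := by
    refine (Category.assoc _ _ _).trans ?_
    refine (congrArg (E.tensor.tmap _ ≫ ·) (Category.assoc _ _ _).symm).trans ?_
    refine (congrArg (fun q => E.tensor.tmap _ ≫ q ≫ mulHom hE X a b)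
      (inj₂_mul hE (onObj E X) (p.coarse d) c)).trans ?_
    refine (congrArg (E.tensor.tmap _ ≫ ·) (Category.assoc _ _ _)).trans ?_
    refine (Category.assoc _ _ _).symm.trans ?_
    refine (congrArg (· ≫ inj E (onObj E X) (p.coarse d) ≫ mulHom hE X a b)
      (E.str.sub_naturality c fun s => inj E X (p.block d s))).trans ?_
    refine (Category.assoc _ _ _).trans ?_
    refine (congrArg (E.str.sub c _ ≫ ·) (Category.assoc _ _ _).symm).trans ?_
    refine (congrArg (E.str.sub c _ ≫ ·) (inj₂_mul hE X p d)).trans ?_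
    exact (Category.assoc _ _ _).symm
  have hL : inj₃ E X p d c ≫ (onMap E ((mul hE).app X)).map a b =
      E.tensor.tmap (fun i =>
          E.tensor.tmap (fun j => E.tensor.tmap fun l =>
            eqToHom (congrArg (X.homs p) (Subdivision.index_comp d c i j l).symm)) ≫
          E.str.sub (d.restrict c i) fun l => X.homs p ((d.comp c).index i l)) ≫
        inj₂ E X p (d.comp c) := by
    refine (Category.assoc _ _ _).trans ?_
    refine (congrArg (E.tensor.tmap _ ≫ ·) (Category.assoc _ _ _)).trans ?_
    refine (congrArg (fun q => E.tensor.tmap _ ≫ E.tensor.tmap _ ≫ q)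
      (inj_onMap E ((mul hE).app X) ((p.coarse d).coarse c))).trans ?_
    refine (congrArg (E.tensor.tmap _ ≫ ·) (Category.assoc _ _ _).symm).trans ?_
    refine (Category.assoc _ _ _).symm.trans (Eq.trans ?_ (Category.assoc _ _ _))
    refine congrArg (· ≫ inj E (onObj E X) ((p.coarse d).coarse c)) ?_
    refine (congrArg (E.tensor.tmap _ ≫ ·) (E.tensor.tmap_comp _ _)).trans ?_
    refine (E.tensor.tmap_comp _ _).trans (Eq.trans ?_ (E.tensor.tmap_comp _ _).symm)
    refine congrArg E.tensor.tmap (funext fun i => ?_)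
    refine (Category.assoc _ _ _).symm.trans ?_
    refine (congrArg (· ≫ mulHom hE X _ _) (inj_block_block X p d c i)).trans ?_
    refine (Category.assoc _ _ _).trans (Eq.trans ?_ (Category.assoc _ _ _).symm)
    exact congrArg (E.tensor.tmap _ ≫ ·)
      (inj₂_mul hE X (p.block (d.comp c) i) (d.restrict c i))
  refine Eq.trans ?_ hR.symm
  refine (Category.assoc _ _ _).symm.trans ?_
  refine (congrArg (· ≫ mulHom hE X a b) hL).trans ?_
  refine (Category.assoc _ _ _).trans ?_
  refine (congrArg (E.tensor.tmap _ ≫ ·) (inj₂_mul hE X p (d.comp c))).trans ?_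
  refine (Category.assoc _ _ _).symm.trans ?_
  exact congrArg (· ≫ inj E X p) (E.str.assoc d c (X.homs p)).symm

/-- The monad `Γ(E)` on graphs associated to a distributive multitensor `E`. -/
noncomputable def monad (hE : Multitensor.IsDistributive.{v, u, w} E) :
    Monad (EnrichedGraph.{v, u, w} V) where
  toFunctor := functor E
  η := unit
  μ := mul hE
  assoc X := by
    refine EnrichedGraph.Hom.ext rfl (heq_of_eq ?_)
    funext a b
    exact mul_mul hE X a b
  left_unit X := by
    refine EnrichedGraph.Hom.ext rfl (heq_of_eq ?_)
    funext a b
    exact unit_mul hE X a b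
  right_unit X := by
    refine EnrichedGraph.Hom.ext rfl (heq_of_eq ?_)
    funext a b
    exact map_unit_mul hE X a b

end Gamma

/-! ### The four kinds of data -/

section

variable {V : Type u} [Category.{v} V]

/-- Coherence maps making a monad `T` into an opmonoidal monad on `(V, E)`, that is, a monad in the
2-category of lax monoidal categories, oplax monoidal functors and monoidal transformations. The
fields `unit_τ` and `sub_τ` say that `(T, τ)` is an oplax monoidal functor, and the fields `η_τ` and
`μ_τ` say that the unit and the multiplication of `T` are monoidal transformations. -/
@[ext]
structure OpmonoidalCoherence (E : Multitensor V) (T : Monad V) where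
  τ : ∀ {n : ℕ} (X : Fin n → V),
    T.obj ((E.tensor n).obj X) ⟶ (E.tensor n).obj fun i => T.obj (X i)
  naturality : ∀ {n : ℕ} {X Y : Fin n → V} (f : ∀ i, X i ⟶ Y i),
    T.map (E.tensor.tmap f) ≫ τ Y = τ X ≫ E.tensor.tmap fun i => T.map (f i)
  unit_τ : ∀ X : Fin 1 → V, T.map (E.str.unit X) ≫ τ X = E.str.unit fun i => T.obj (X i)
  sub_τ : ∀ {N k : ℕ} (d : Subdivision N k) (X : Fin N → V),
    T.map (E.str.sub d X) ≫ τ X =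
      τ (fun i => (E.tensor (d.len i)).obj fun j => X (d.index i j)) ≫
        E.tensor.tmap (fun i => τ fun j => X (d.index i j)) ≫
          E.str.sub d fun s => T.obj (X s)
  η_τ : ∀ {n : ℕ} (X : Fin n → V),
    T.η.app ((E.tensor n).obj X) ≫ τ X = E.tensor.tmap fun i => T.η.app (X i)
  μ_τ : ∀ {n : ℕ} (X : Fin n → V),
    T.μ.app ((E.tensor n).obj X) ≫ τ X =
      T.map (τ X) ≫ τ (fun i => T.obj (X i)) ≫ E.tensor.tmap fun i => T.μ.app (X i)

/-- The functor `EM(T)`, which sends `(X₁, …, Xₙ)` to `E_i T X_i`. -/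
def TensorFamily.precomp (E : TensorFamily V) (T : V ⥤ V) : TensorFamily V :=
  fun n => Functor.pi (fun _ : Fin n => T) ⋙ E n

/-- A multitensor map: a natural transformation compatible with units and substitutions. -/
structure IsMultitensorMap (E F : Multitensor V) (φ : ∀ n, E.tensor n ⟶ F.tensor n) : Prop where
  unit : ∀ X : Fin 1 → V, E.str.unit X ≫ (φ 1).app X = F.str.unit X
  sub : ∀ {N k : ℕ} (d : Subdivision N k) (X : Fin N → V),
    E.str.sub d X ≫ (φ N).app X =
      E.tensor.tmap (fun i => (φ (d.len i)).app fun j => X (d.index i j)) ≫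
        (φ k).app (fun i => (F.tensor (d.len i)).obj fun j => X (d.index i j)) ≫ F.str.sub d X

/-- The transformation `Eη : E ⟶ EM(T)`. -/
def TensorFamily.precompUnit (E : TensorFamily V) (T : Monad V) (n : ℕ) :
    E n ⟶ E.precomp T.toFunctor n where
  app X := E.tmap fun i => T.η.app (X i)
  naturality X Y f := by
    refine (E.tmap_comp _ _).trans (Eq.trans ?_ (E.tmap_comp _ _).symm)
    exact congrArg E.tmap (funext fun i => T.η.naturality (f i))

/-- A multitensor structure on `EM(T)` which is compatible with the multitensor `E` and the monad
`T`. Since the unit is prescribed, this amounts to substitution maps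
`E_i T E_j T X_ij ⟶ E_ij T X_ij`. -/
structure CompositeMultitensor (E : Multitensor V) (T : Monad V) where
  str : MultitensorStruct (E.tensor.precomp T.toFunctor)
  /-- The unit at `X` is `u_{TX} ∘ η_X`. -/
  unit_eq : ∀ X : Fin 1 → V, str.unit X = T.η.app (X 0) ≫ E.str.unit fun i => T.obj (X i)
  /-- `Eη` is a multitensor map. -/
  isMultitensorMap : IsMultitensorMap E ⟨E.tensor.precomp T.toFunctor, str⟩ (E.tensor.precompUnit T)
  /-- `uT : T ⟶ E₁T` is a monad map. -/
  isMonadMap : ∃ φ : T ⟶ Multitensor.unaryMonad ⟨E.tensor.precomp T.toFunctor, str⟩,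
    ∀ X : V, φ.app X = E.str.unit fun _ : Fin 1 => T.obj X
  /-- The composite `E_i T X_i ⟶ E_i T E₁ T X_i ⟶ E_i T X_i` is the identity. -/
  middle_unit : ∀ {n : ℕ} (X : Fin n → V),
    E.tensor.tmap (fun i : Fin n =>
        E.str.unit (fun j => T.obj (X ((Subdivision.singles n).index i j))) ≫
          T.η.app ((E.tensor 1).obj fun j => T.obj (X ((Subdivision.singles n).index i j)))) ≫
      str.sub (Subdivision.singles n) X =
    𝟙 ((E.tensor n).obj fun i => T.obj (X i))

/-- The multitensor given by a `CompositeMultitensor`. -/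
def CompositeMultitensor.multitensor {E : Multitensor V} {T : Monad V}
    (S : CompositeMultitensor E T) : Multitensor V :=
  ⟨E.tensor.precomp T.toFunctor, S.str⟩

/-- A lifting of a multitensor `E` to the category of algebras of `T`. -/
structure Lifting (E : Multitensor V) (T : Monad V) where
  lift : Multitensor T.Algebra
  tensor_forget : ∀ n : ℕ,
    lift.tensor n ⋙ T.forget = Functor.pi (fun _ : Fin n => T.forget) ⋙ E.tensor n
  unit_forget : ∀ X : Fin 1 → T.Algebra,
    HEq (lift.str.unit X).f (E.str.unit fun i => (X i).A)
  sub_forget : ∀ {N k : ℕ} (d : Subdivision N k) (X : Fin N → T.Algebra),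
    HEq (lift.str.sub d X).f (E.str.sub d fun s => (X s).A)

end

/-- A distributive law of a monad `S` over a monad `T`: a transformation `TS ⟶ ST` compatible with
the units and multiplications. -/
@[ext]
structure DistributiveLaw {C : Type u₁} [Category.{v₁} C] (S T : Monad C) where
  law : S.toFunctor ⋙ T.toFunctor ⟶ T.toFunctor ⋙ S.toFunctor
  map_η_law : ∀ X : C, T.map (S.η.app X) ≫ law.app X = S.η.app (T.obj X)
  η_law : ∀ X : C, T.η.app (S.obj X) ≫ law.app X = S.map (T.η.app X)
  map_μ_law : ∀ X : C, T.map (S.μ.app X) ≫ law.app X =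
    law.app (S.obj X) ≫ S.map (law.app X) ≫ S.μ.app (T.obj X)
  μ_law : ∀ X : C, T.μ.app (S.obj X) ≫ law.app X =
    T.map (law.app X) ≫ law.app (T.obj X) ≫ S.map (T.μ.app X)

/-- The distributive laws of `Γ(E)` over `G(T)` whose components are identities on objects. -/
def GraphDistributiveLaw {V : Type u} [Category.{v} V] [HasCoproducts.{w} V] {E : Multitensor V}
    (hE : Multitensor.IsDistributive.{v, u, w} E) (T : Monad V) :=
  { L : DistributiveLaw (Gamma.monad hE) (EnrichedGraph.mapMonad.{v, u, w} T) //
    ∀ (X : EnrichedGraph.{v, u, w} V) (a : X.carrier),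
      EnrichedGraph.Hom.obj (L.law.app X) a = a }

end MultitensorLaw

open MultitensorLaw

/-!
An opmonoidal coherence `τ` for `T` is the same thing as an action of `T` on `E_i X_i`, natural
in the `T`-algebras `X_i`, for which the unit and the substitution of `E` are morphisms of
algebras: from `τ` one obtains the action `E_i x_i ∘ τ`, and `τ` is recovered by precomposing the
action on the free algebras `T X_i` with `T E_i η`. Such actions are the liftings of `E` to
`T`-algebras.

Given a multitensor structure `σ'` on `EM(T)`, `T` acts on `E_i T X_i` through `uT` and `σ'`.
Associativity of `σ'` and the monad map `uT : T ⟶ E₁ T` show that `E_i μ` is an instance of `σ'`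
preceded by `E_i T u`. Hence `σ'` commutes with multiplications in each variable, and it is `σ`
preceded by these actions.

In an `EM(T)`-category the compositions of sequences of length one make the homs into
`T`-algebras, and the other compositions are then determined by their restriction along `E η`.

Finally, `Γ E` has a single noninitial summand at the two ends of the linear graph whose edges are
labelled by a sequence `X_i`, namely `E_i X_i`, so a distributive law restricts there to a map
`T E_i X_i ⟶ E_i T X_i`; every other component of the law is determined by naturality along the
morphisms from linear graphs to paths.
-/

namespace MultitensorLaw

namespace Subdivision

variable {N k : ℕ}

theorem index_singles (i : Fin N) (j : Fin 1) : (singles N).index i j = i := by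
  obtain rfl : j = 0 := Subsingleton.elim _ _
  rfl

theorem singles_comp (d : Subdivision N k) : (singles N).comp d = d :=
  eq_of_len <| funext fun i => by
    have h := d.cut_succ i
    simp only [comp, singles]
    omega

theorem comp_singles (d : Subdivision N k) : d.comp (singles k) = d :=
  eq_of_len <| funext fun i => by
    have h := d.cut_succ i
    simp only [comp, singles]
    omega

theorem comp_whole (d : Subdivision N k) : d.comp (whole k) = whole N :=
  eq_of_len <| funext fun i => by
    obtain rfl : i = 0 := Subsingleton.elim _ _
    change (d.cut (Fin.last k) : ℕ) - (d.cut 0 : ℕ) = N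
    rw [d.cut_last, d.cut_zero]
    simp

end Subdivision

section

variable {V : Type u} [Category.{v} V]

theorem TensorFamily.tmap_eqToHom (E : TensorFamily V) {n : ℕ} {X Y : Fin n → V}
    (h : ∀ i, X i = Y i) :
    E.tmap (fun i => eqToHom (h i)) = eqToHom (congrArg (E n).obj (funext h)) := by
  obtain rfl : X = Y := funext h
  simp [TensorFamily.tmap_id]

namespace MultitensorStruct

variable {E : TensorFamily V} (S : MultitensorStruct E) {N M k : ℕ}

/-- Substitution along `d` preceded by maps into the entries `X_ij`. Taking these maps to be
`eqToHom`s gives the substitution of a doubly nested sequence whose entries are only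
propositionally equal to those which `d` reads off from `X`. -/
def subMap (d : Subdivision N k) {X : Fin N → V} {Y : ∀ i, Fin (d.len i) → V}
    (f : ∀ i j, Y i j ⟶ X (d.index i j)) :
    (E k).obj (fun i => (E (d.len i)).obj (Y i)) ⟶ (E N).obj X :=
  E.tmap (fun i => E.tmap (f i)) ≫ S.sub d X

theorem subMap_id (d : Subdivision N k) (X : Fin N → V) :
    S.subMap d (X := X) (fun _ _ => 𝟙 _) = S.sub d X := by
  simp only [subMap, TensorFamily.tmap_id, Category.id_comp]

theorem subMap_naturality (d : Subdivision N k) {X X' : Fin N → V}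
    {Y Y' : ∀ i, Fin (d.len i) → V} {f : ∀ i j, Y i j ⟶ X (d.index i j)}
    {f' : ∀ i j, Y' i j ⟶ X' (d.index i j)} (g : ∀ i j, Y i j ⟶ Y' i j) (h : ∀ s, X s ⟶ X' s)
    (w : ∀ i j, g i j ≫ f' i j = f i j ≫ h (d.index i j)) :
    E.tmap (fun i => E.tmap (g i)) ≫ S.subMap d f' = S.subMap d f ≫ E.tmap h := by
  rw [subMap, subMap, Category.assoc, ← S.sub_naturality]
  simp only [← Category.assoc, TensorFamily.tmap_comp, w]

/-- The subdivisions `e` and `r i` stand for `d.comp c` and `d.restrict c i`, to which they are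
often equal without being definitionally so. -/
theorem subMap_eqToHom_assoc (d : Subdivision N M) (c : Subdivision M k) (e : Subdivision N k)
    (r : ∀ i, Subdivision (e.len i) (c.len i)) (he : d.comp c = e)
    (hr : ∀ i j, (r i).len j = d.len (c.index i j)) {X : Fin N → V}
    {Z : ∀ a, Fin (d.len a) → V} (hZ : ∀ a l, Z a l = X (d.index a l))
    {Y : ∀ i, Fin (e.len i) → V} (hY : ∀ i l, Y i l = X (e.index i l))
    {W : ∀ i j, Fin ((r i).len j) → V} (hW : ∀ i j l, W i j l = Y i ((r i).index j l))
    (hWZ : ∀ i j, (E ((r i).len j)).obj (W i j) =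
      (E (d.len (c.index i j))).obj (Z (c.index i j))) :
    S.subMap c (X := fun a => (E (d.len a)).obj (Z a)) (fun i j => eqToHom (hWZ i j)) ≫
        S.subMap d (fun a l => eqToHom (hZ a l)) =
      E.tmap (fun i => S.subMap (r i) fun j l => eqToHom (hW i j l)) ≫
        S.subMap e fun i l => eqToHom (hY i l) := by
  subst he
  obtain rfl : r = d.restrict c := funext fun i => Subdivision.eq_of_len (funext fun j => hr i j)
  obtain rfl : Z = fun a l => X (d.index a l) := funext fun a => funext fun l => hZ a l
  obtain rfl : Y = fun i l => X ((d.comp c).index i l) := funext fun i => funext fun l => hY i l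
  obtain rfl : W = fun i j l => X ((d.comp c).index i ((d.restrict c i).index j l)) :=
    funext fun i => funext fun j => funext fun l => hW i j l
  simp only [eqToHom_refl, subMap_id]
  rw [subMap, Category.assoc, S.assoc d c X, ← Category.assoc, TensorFamily.tmap_comp]
  congr! 3 with i
  simp only [TensorFamily.tmap_eqToHom]
  exact (eqToHom_trans_assoc _ _ _).trans (Category.id_comp _)

/-- The substitution `E₁ E_i X_i ⟶ E_i X_i`. -/
def sub₁ (X : Fin N → V) : (E 1).obj (fun _ => (E N).obj X) ⟶ (E N).obj X :=
  S.subMap (Subdivision.whole N) fun i j =>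
    eqToHom (congrArg X (Subdivision.index_whole N i j).symm)

/-- The substitution `E_i E₁ X_i ⟶ E_i X_i`. -/
def subₛ (X : Fin N → V) : (E N).obj (fun i => (E 1).obj fun _ => X i) ⟶ (E N).obj X :=
  S.subMap (Subdivision.singles N) fun i j =>
    eqToHom (congrArg X (Subdivision.index_singles i j).symm)

theorem tmap_sub₁ {X Y : Fin N → V} (f : ∀ i, X i ⟶ Y i) :
    E.tmap (fun _ => E.tmap f) ≫ S.sub₁ Y = S.sub₁ X ≫ E.tmap f :=
  S.subMap_naturality (Subdivision.whole N) (fun _ => f) f fun i j =>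
    eqToHom_naturality f (Subdivision.index_whole N i j).symm

theorem unit_sub₁ (X : Fin N → V) : S.unit (fun _ => (E N).obj X) ≫ S.sub₁ X = 𝟙 _ := by
  have h := S.unit_naturality fun i : Fin 1 => E.tmap fun j =>
    eqToHom (congrArg X (Subdivision.index_whole N i j).symm)
  refine (reassoc_of% h) (S.sub (Subdivision.whole N) X) |>.symm.trans ?_
  rw [S.unit_sub, TensorFamily.tmap_comp]
  simp [TensorFamily.tmap_id]

theorem sub_subₛ (d : Subdivision N k) (X : Fin N → V) :
    S.sub d (fun s => (E 1).obj fun _ => X s) ≫ S.subₛ X =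
      E.tmap (fun i => S.subₛ fun j => X (d.index i j)) ≫ S.sub d X := by
  rw [← subMap_id, ← subMap_id]
  exact S.subMap_eqToHom_assoc (Subdivision.singles N) d d (fun _ => Subdivision.singles _)
    d.singles_comp (fun _ _ => rfl) (X := X)
    (Z := fun s _ => X s) (fun a l => congrArg X (Subdivision.index_singles a l).symm)
    (Y := fun i j => X (d.index i j)) (fun _ _ => rfl) (W := fun i j _ => X (d.index i j))
    (fun i j l => congrArg (fun s => X (d.index i s)) (Subdivision.index_singles j l).symm)
    fun _ _ => rfl

theorem subₛ_subMap (d : Subdivision N k) {X : Fin N → V} {Y : ∀ i, Fin (d.len i) → V}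
    (h : ∀ i j, Y i j = X (d.index i j)) :
    S.subₛ (fun i => (E (d.len i)).obj (Y i)) ≫ S.subMap d (fun i j => eqToHom (h i j)) =
      E.tmap (fun i => S.sub₁ (Y i)) ≫ S.subMap d fun i j => eqToHom (h i j) :=
  S.subMap_eqToHom_assoc d (Subdivision.singles k) d (fun _ => Subdivision.whole _)
    d.comp_singles (fun i j => congrArg d.len (Subdivision.index_singles i j).symm) h h
    (W := fun i _ => Y i)
    (fun i j l => congrArg (Y i) (Subdivision.index_whole _ j l).symm)
    fun i j => congrArg (fun s => (E (d.len s)).obj (Y s)) (Subdivision.index_singles i j).symm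

theorem sub₁_subMap (d : Subdivision N k) {X : Fin N → V} {Y : ∀ i, Fin (d.len i) → V}
    (h : ∀ i j, Y i j = X (d.index i j)) :
    S.sub₁ (fun i => (E (d.len i)).obj (Y i)) ≫ S.subMap d (fun i j => eqToHom (h i j)) =
      E.tmap (fun _ => S.subMap d fun i j => eqToHom (h i j)) ≫ S.sub₁ X :=
  S.subMap_eqToHom_assoc d (Subdivision.whole k) (Subdivision.whole N) (fun _ => d)
    d.comp_whole (fun i j => congrArg d.len (Subdivision.index_whole k i j).symm) h
    (Y := fun _ => X) (fun i j => congrArg X (Subdivision.index_whole N i j).symm)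
    (W := fun _ => Y) (fun _ => h)
    fun i j => congrArg (fun s => (E (d.len s)).obj (Y s)) (Subdivision.index_whole k i j).symm

theorem sub₁_sub (d : Subdivision N k) (X : Fin N → V) :
    S.sub₁ (fun i => (E (d.len i)).obj fun j => X (d.index i j)) ≫ S.sub d X =
      E.tmap (fun _ => S.sub d X) ≫ S.sub₁ X := by
  rw [← subMap_id]
  exact S.sub₁_subMap d fun _ _ => rfl

theorem subₛ_sub (d : Subdivision N k) (X : Fin N → V) :
    S.subₛ (fun i => (E (d.len i)).obj fun j => X (d.index i j)) ≫ S.sub d X =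
      E.tmap (fun i => S.sub₁ fun j => X (d.index i j)) ≫ S.sub d X := by
  rw [← subMap_id]
  exact S.subₛ_subMap d fun _ _ => rfl

theorem sub₁_sub₁ (X : Fin N → V) :
    S.sub₁ (fun _ : Fin 1 => (E N).obj X) ≫ S.sub₁ X = E.tmap (fun _ => S.sub₁ X) ≫ S.sub₁ X :=
  S.sub₁_subMap (Subdivision.whole N) _

theorem sub₁_subₛ (X : Fin N → V) :
    S.sub₁ (fun i => (E 1).obj fun _ => X i) ≫ S.subₛ X =
      E.tmap (fun _ => S.subₛ X) ≫ S.sub₁ X :=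
  S.sub₁_subMap (Subdivision.singles N) _

theorem subₛ_subₛ (X : Fin N → V) :
    S.subₛ (fun i => (E 1).obj fun _ => X i) ≫ S.subₛ X =
      E.tmap (fun i => S.sub₁ fun _ : Fin 1 => X i) ≫ S.subₛ X :=
  S.subₛ_subMap (Subdivision.singles N) _

end MultitensorStruct

/-! ### Actions on tensor products and liftings -/

theorem TensorFamily.tmap_comp_assoc (E : TensorFamily V) {n : ℕ} {X Y Z : Fin n → V}
    (f : ∀ i, X i ⟶ Y i) (g : ∀ i, Y i ⟶ Z i) {Q : V} (h : (E n).obj Z ⟶ Q) :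
    E.tmap f ≫ E.tmap g ≫ h = E.tmap (fun i => f i ≫ g i) ≫ h := by
  rw [← Category.assoc, E.tmap_comp]

theorem TensorFamily.tmap_congr (E : TensorFamily V) {n : ℕ} {X Y : Fin n → V}
    {f g : ∀ i, X i ⟶ Y i} (h : ∀ i, f i = g i) : E.tmap f = E.tmap g :=
  congrArg E.tmap (funext h)

theorem algebra_eqToHom_f {T : Monad V} {A B : T.Algebra} (h : A = B) :
    (eqToHom h).f = eqToHom (congrArg Monad.Algebra.A h) :=
  eqToHom_map T.forget h

/-- The lifting of a functor `F` to algebras given by a natural action of `T` on the values of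
`F`. -/
def liftAlgebra {C : Type u₁} [Category.{v₁} C] {T : Monad V} (F : C ⥤ V)
    (act : ∀ X, T.obj (F.obj X) ⟶ F.obj X) (unit : ∀ X, T.η.app (F.obj X) ≫ act X = 𝟙 _)
    (mul : ∀ X, T.μ.app (F.obj X) ≫ act X = T.map (act X) ≫ act X)
    (naturality : ∀ {X Y : C} (f : X ⟶ Y), T.map (F.map f) ≫ act Y = act X ≫ F.map f) :
    C ⥤ T.Algebra where
  obj X := ⟨F.obj X, act X, unit X, mul X⟩
  map f := ⟨F.map f, naturality f⟩

theorem exists_eq_liftAlgebra {C : Type u₁} [Category.{v₁} C] {T : Monad V} (F : C ⥤ V)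
    (G : C ⥤ T.Algebra) (h : G ⋙ T.forget = F) :
    ∃ act unit mul naturality, G = liftAlgebra F act unit mul naturality := by
  subst h
  exact ⟨fun X => (G.obj X).a, fun X => (G.obj X).unit, fun X => (G.obj X).assoc,
    fun f => (G.map f).h, rfl⟩

/-- Natural actions of `T` on the tensor products of the objects underlying `T`-algebras for which
the unit and the substitution of `E` are maps of algebras: the data of a lifting of `E` to
`T`-algebras which is not already prescribed by `E`. -/
@[ext]
structure LiftedActions (E : Multitensor V) (T : Monad V) where
  act : ∀ {n : ℕ} (X : Fin n → T.Algebra),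
    T.obj ((E.tensor n).obj fun i => (X i).A) ⟶ (E.tensor n).obj fun i => (X i).A
  unit_act : ∀ {n : ℕ} (X : Fin n → T.Algebra), T.η.app _ ≫ act X = 𝟙 _
  mul_act : ∀ {n : ℕ} (X : Fin n → T.Algebra), T.μ.app _ ≫ act X = T.map (act X) ≫ act X
  act_naturality : ∀ {n : ℕ} {X Y : Fin n → T.Algebra} (f : ∀ i, X i ⟶ Y i),
    T.map (E.tensor.tmap fun i => (f i).f) ≫ act Y = act X ≫ E.tensor.tmap fun i => (f i).f
  unit_hom : ∀ X : Fin 1 → T.Algebra, T.map (E.str.unit fun i => (X i).A) ≫ act X =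
    (X 0).a ≫ E.str.unit fun i => (X i).A
  sub_hom : ∀ {N k : ℕ} (d : Subdivision N k) (X : Fin N → T.Algebra),
    T.map (E.str.sub d fun s => (X s).A) ≫ act X =
      act (fun i => ⟨(E.tensor (d.len i)).obj fun j => (X (d.index i j)).A,
        act fun j => X (d.index i j), unit_act _, mul_act _⟩) ≫ E.str.sub d fun s => (X s).A

namespace LiftedActions

variable {E : Multitensor V} {T : Monad V} (L : LiftedActions E T)

/-- The tensor product of a sequence of `T`-algebras. -/
def algebra {n : ℕ} (X : Fin n → T.Algebra) : T.Algebra :=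
  ⟨(E.tensor n).obj fun i => (X i).A, L.act X, L.unit_act X, L.mul_act X⟩

/-- The tensor products of algebras, as functors. -/
def tensor : TensorFamily T.Algebra := fun n =>
  liftAlgebra (Functor.pi (fun _ : Fin n => T.forget) ⋙ E.tensor n) L.act L.unit_act L.mul_act
    L.act_naturality

/-- The multitensor structure on the tensor products of algebras. -/
def str : MultitensorStruct L.tensor where
  unit X := ⟨E.str.unit fun i => (X i).A, L.unit_hom X⟩
  sub d X := ⟨E.str.sub d fun s => (X s).A, L.sub_hom d X⟩
  unit_naturality f := Monad.Algebra.Hom.ext (E.str.unit_naturality fun i => (f i).f)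
  sub_naturality {_ _} d {_ _} f :=
    Monad.Algebra.Hom.ext (E.str.sub_naturality d fun i => (f i).f)
  unit_sub X := Monad.Algebra.Hom.ext <| (E.str.unit_sub fun s => (X s).A).trans <|
    E.tensor.tmap_congr fun _ => (algebra_eqToHom_f _).symm
  sub_unit X := Monad.Algebra.Hom.ext (E.str.sub_unit fun s => (X s).A)
  assoc {_ _ _} d c X := Monad.Algebra.Hom.ext <| (E.str.assoc d c fun s => (X s).A).trans <|
    congrArg (· ≫ E.str.sub (d.comp c) fun s => (X s).A) <| E.tensor.tmap_congr fun i =>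
      congrArg (· ≫ E.str.sub (d.restrict c i) fun l => (X ((d.comp c).index i l)).A) <|
        E.tensor.tmap_congr fun _ => E.tensor.tmap_congr fun _ => (algebra_eqToHom_f _).symm

/-- The lifting of `E` determined by actions. -/
def lifting : Lifting E T where
  lift := ⟨L.tensor, L.str⟩
  tensor_forget _ := rfl
  unit_forget _ := HEq.rfl
  sub_forget _ _ := HEq.rfl

theorem lifting_injective : Function.Injective (lifting : LiftedActions E T → Lifting E T) := by
  intro L L' h
  have heq_a : ∀ M M' : Lifting E T, M = M' → ∀ {n : ℕ} (X : Fin n → T.Algebra),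
      HEq ((M.lift.tensor n).obj X).a ((M'.lift.tensor n).obj X).a := by
    rintro M _ rfl n X
    rfl
  refine LiftedActions.ext ?_
  funext n X
  exact eq_of_heq (heq_a _ _ h X)

theorem lifting_surjective : Function.Surjective (lifting : LiftedActions E T → Lifting E T) := by
  rintro ⟨⟨G, S⟩, hG, hu, hs⟩
  choose act unit_act mul_act act_naturality hact using
    fun n => exists_eq_liftAlgebra _ (G n) (hG n)
  obtain rfl : G = fun n => liftAlgebra _ (act n) (unit_act n) (mul_act n) (act_naturality n) :=
    funext hact
  have unit_f (X) : (S.unit X).f = E.str.unit fun i => (X i).A := eq_of_heq (hu X)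
  have sub_f {N k : ℕ} (d : Subdivision N k) (X) : (S.sub d X).f = E.str.sub d fun s => (X s).A :=
    eq_of_heq (hs d X)
  let L : LiftedActions E T :=
    { act := fun {n} X => act n X
      unit_act := fun {n} X => unit_act n X
      mul_act := fun {n} X => mul_act n X
      act_naturality := fun {n _ _} f => act_naturality n f
      unit_hom := fun X => by
        rw [← unit_f]
        exact (S.unit X).h
      sub_hom := fun d X => by
        rw [← sub_f]
        exact (S.sub d X).h }
  have str_eq : L.str = S := by
    refine MultitensorStruct.ext ?_ ?_
    · funext X
      exact Monad.Algebra.Hom.ext (unit_f X).symm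
    · funext N k d X
      exact Monad.Algebra.Hom.ext (sub_f d X).symm
  refine ⟨L, ?_⟩
  simp only [lifting, str_eq]
  rfl

theorem lifting_bijective : Function.Bijective (lifting : LiftedActions E T → Lifting E T) :=
  ⟨lifting_injective, lifting_surjective⟩

/-- The action on a tensor product of free algebras. -/
def freeAct {n : ℕ} (X : Fin n → V) :
    T.obj ((E.tensor n).obj fun i => T.obj (X i)) ⟶ (E.tensor n).obj fun i => T.obj (X i) :=
  L.act fun i => T.free.obj (X i)

/-- The opmonoidal coherence maps determined by actions: the action on a tensor product of free
algebras, restricted along the unit of `T`. -/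
def coherenceMap {n : ℕ} (X : Fin n → V) :
    T.obj ((E.tensor n).obj X) ⟶ (E.tensor n).obj fun i => T.obj (X i) :=
  T.map (E.tensor.tmap fun i => T.η.app (X i)) ≫ L.freeAct X

theorem coherenceMap_tmap {n : ℕ} {X : Fin n → V} (Y : Fin n → T.Algebra)
    (f : ∀ i, X i ⟶ (Y i).A) :
    L.coherenceMap X ≫ E.tensor.tmap (fun i => T.map (f i) ≫ (Y i).a) =
      T.map (E.tensor.tmap f) ≫ L.act Y := by
  have mul_extend (i) : T.map (T.map (f i) ≫ (Y i).a) ≫ (Y i).a =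
      T.μ.app (X i) ≫ T.map (f i) ≫ (Y i).a := by
    rw [T.map_comp, Category.assoc, ← (Y i).assoc]
    exact T.μ.naturality_assoc (f i) (Y i).a
  have h : T.map (E.tensor.tmap fun i => T.map (f i) ≫ (Y i).a) ≫ L.act Y =
      L.freeAct X ≫ E.tensor.tmap fun i => T.map (f i) ≫ (Y i).a :=
    L.act_naturality (X := fun i => T.free.obj (X i)) fun i =>
      ⟨T.map (f i) ≫ (Y i).a, mul_extend i⟩
  have unit_extend (i) : T.η.app (X i) ≫ T.map (f i) ≫ (Y i).a = f i := by
    refine (T.η.naturality_assoc (f i) (Y i).a).symm.trans ?_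
    exact (congrArg (f i ≫ ·) (Y i).unit).trans (Category.comp_id _)
  rw [coherenceMap, Category.assoc, ← h, ← Category.assoc, ← T.map_comp, E.tensor.tmap_comp,
    E.tensor.tmap_congr unit_extend]

theorem act_eq {n : ℕ} (X : Fin n → T.Algebra) :
    L.act X = L.coherenceMap (fun i => (X i).A) ≫ E.tensor.tmap fun i => (X i).a := by
  have h := L.coherenceMap_tmap X fun _ => 𝟙 _
  simp only [E.tensor.tmap_id, T.map_id, Category.id_comp] at h
  exact h.symm

theorem coherenceMap_naturality {n : ℕ} {X Y : Fin n → V} (f : ∀ i, X i ⟶ Y i) :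
    T.map (E.tensor.tmap f) ≫ L.coherenceMap Y =
      L.coherenceMap X ≫ E.tensor.tmap fun i => T.map (f i) := by
  have h : (L.coherenceMap X ≫ E.tensor.tmap fun i => T.map (f i ≫ T.η.app (Y i)) ≫ T.μ.app (Y i)) =
      T.map (E.tensor.tmap fun i => f i ≫ T.η.app (Y i)) ≫ L.freeAct Y :=
    L.coherenceMap_tmap (fun i => T.free.obj (Y i)) fun i => f i ≫ T.η.app (Y i)
  rw [coherenceMap, ← Category.assoc, ← T.map_comp, E.tensor.tmap_comp, ← h]
  refine congrArg (L.coherenceMap X ≫ ·) (E.tensor.tmap_congr fun i => ?_)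
  rw [T.map_comp, Category.assoc, T.right_unit]
  exact Category.comp_id _

theorem coherenceMap_tmap_mu {n : ℕ} (X : Fin n → V) :
    L.coherenceMap (fun i => T.obj (X i)) ≫ E.tensor.tmap (fun i => T.μ.app (X i)) =
      L.freeAct X :=
  (L.act_eq fun i => T.free.obj (X i)).symm

/-- The opmonoidal monad determined by actions. -/
def coherence : OpmonoidalCoherence E T where
  τ X := L.coherenceMap X
  naturality f := L.coherenceMap_naturality f
  unit_τ X := by
    have h : T.map (E.str.unit fun i => T.obj (X i)) ≫ L.freeAct X =
        T.μ.app (X 0) ≫ E.str.unit fun i => T.obj (X i) :=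
      L.unit_hom fun i => T.free.obj (X i)
    rw [coherenceMap, ← Category.assoc, ← T.map_comp, ← E.str.unit_naturality, T.map_comp,
      Category.assoc, h]
    exact T.right_unit_assoc (X 0) _
  sub_τ d X := by
    let P i := L.algebra fun j : Fin (d.len i) => T.free.obj (X (d.index i j))
    have h : T.map (E.str.sub d fun s => T.obj (X s)) ≫ L.freeAct X =
        L.act P ≫ E.str.sub d fun s => T.obj (X s) :=
      L.sub_hom d fun s => T.free.obj (X s)
    have coherenceMap_comp :
        L.coherenceMap (fun i => (E.tensor (d.len i)).obj fun j => X (d.index i j)) ≫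
          E.tensor.tmap (fun i => L.coherenceMap fun j => X (d.index i j)) =
        T.map (E.tensor.tmap fun i => E.tensor.tmap fun j => T.η.app (X (d.index i j))) ≫
          L.act P :=
      L.coherenceMap_tmap P fun i => E.tensor.tmap fun j => T.η.app (X (d.index i j))
    rw [coherenceMap, ← Category.assoc, ← T.map_comp, ← E.str.sub_naturality, T.map_comp,
      Category.assoc, h, ← Category.assoc (L.coherenceMap _), coherenceMap_comp]
    exact (Category.assoc _ _ _).symm
  η_τ X := by
    refine (T.η.naturality_assoc (E.tensor.tmap fun i => T.η.app (X i)) _).symm.trans ?_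
    exact (congrArg (_ ≫ ·) (L.unit_act fun i => T.free.obj (X i))).trans (Category.comp_id _)
  μ_τ X := by
    have h : T.μ.app _ ≫ L.freeAct X = T.map (L.freeAct X) ≫ L.freeAct X :=
      L.mul_act fun i => T.free.obj (X i)
    rw [L.coherenceMap_tmap_mu, coherenceMap, ← T.mu_naturality_assoc, h, T.map_comp,
      Category.assoc]

end LiftedActions

/-- The actions determined by an opmonoidal monad. -/
def OpmonoidalCoherence.actions {E : Multitensor V} {T : Monad V} (c : OpmonoidalCoherence E T) :
    LiftedActions E T where
  act X := c.τ (fun i => (X i).A) ≫ E.tensor.tmap fun i => (X i).a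
  unit_act X := by
    rw [← Category.assoc, c.η_τ, E.tensor.tmap_comp]
    simp only [Monad.Algebra.unit]
    exact E.tensor.tmap_id _
  mul_act X := by
    rw [← Category.assoc, c.μ_τ, T.map_comp]
    simp only [Category.assoc, E.tensor.tmap_comp, Monad.Algebra.assoc]
    rw [reassoc_of% c.naturality fun i => (X i).a, E.tensor.tmap_comp]
  act_naturality f := by
    rw [reassoc_of% c.naturality fun i => (f i).f]
    simp only [Category.assoc, E.tensor.tmap_comp, Monad.Algebra.Hom.h]
  unit_hom X := by
    rw [reassoc_of% c.unit_τ]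
    exact (E.str.unit_naturality fun i => (X i).a).symm
  sub_hom d X := by
    rw [reassoc_of% c.sub_τ]
    simp only [Category.assoc]
    rw [← E.str.sub_naturality, E.tensor.tmap_comp_assoc]

/-- Opmonoidal coherences correspond to actions of `T` on tensor products of algebras. -/
def actionsEquiv (E : Multitensor V) (T : Monad V) :
    OpmonoidalCoherence E T ≃ LiftedActions E T where
  toFun c := c.actions
  invFun L := L.coherence
  left_inv c := by
    refine OpmonoidalCoherence.ext ?_
    funext n X
    change T.map _ ≫ c.τ (fun i => T.obj (X i)) ≫ (E.tensor.tmap fun i => T.μ.app (X i)) = c.τ X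
    rw [reassoc_of% c.naturality fun i => T.η.app (X i), E.tensor.tmap_comp]
    simp only [T.right_unit]
    exact (congrArg (c.τ X ≫ ·) (E.tensor.tmap_id _)).trans (Category.comp_id _)
  right_inv L := LiftedActions.ext <| by
    funext n X
    exact (L.act_eq X).symm

/-- Opmonoidal coherences correspond to liftings of the multitensor. -/
noncomputable def liftingEquiv (E : Multitensor V) (T : Monad V) :
    OpmonoidalCoherence E T ≃ Lifting E T :=
  (actionsEquiv E T).trans (Equiv.ofBijective _ LiftedActions.lifting_bijective)

/-! ### Composite multitensors -/

namespace LiftedActions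

variable {E : Multitensor V} {T : Monad V} (L : LiftedActions E T)

theorem unit_freeAct {n : ℕ} (X : Fin n → V) :
    T.η.app ((E.tensor n).obj fun i => T.obj (X i)) ≫ L.freeAct X = 𝟙 _ :=
  L.unit_act fun i => T.free.obj (X i)

theorem map_unit_freeAct (X : Fin 1 → V) :
    T.map (E.str.unit fun i => T.obj (X i)) ≫ L.freeAct X =
      T.μ.app (X 0) ≫ E.str.unit fun i => T.obj (X i) :=
  L.unit_hom fun i => T.free.obj (X i)

theorem freeAct_naturality {n : ℕ} {X Y : Fin n → V} (f : ∀ i, X i ⟶ Y i) :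
    T.map (E.tensor.tmap fun i => T.map (f i)) ≫ L.freeAct Y =
      L.freeAct X ≫ E.tensor.tmap fun i => T.map (f i) :=
  L.act_naturality fun i => T.free.map (f i)

/-- The substitution `E_i T E_j T X_ij ⟶ E_ij T X_ij` determined by actions. -/
def compositeSub {N k : ℕ} (d : Subdivision N k) (X : Fin N → V) :
    (E.tensor k).obj (fun i => T.obj ((E.tensor (d.len i)).obj fun j => T.obj (X (d.index i j)))) ⟶
      (E.tensor N).obj fun s => T.obj (X s) :=
  E.tensor.tmap (fun i => L.freeAct fun j => X (d.index i j)) ≫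
    E.str.sub d fun s => T.obj (X s)

theorem map_compositeSub_freeAct {N k : ℕ} (d : Subdivision N k) (X : Fin N → V) :
    T.map (L.compositeSub d X) ≫ L.freeAct X =
      L.freeAct (fun i => (E.tensor (d.len i)).obj fun j => T.obj (X (d.index i j))) ≫
        L.compositeSub d X := by
  let P i := L.algebra fun j : Fin (d.len i) => T.free.obj (X (d.index i j))
  have hsub : T.map (E.str.sub d fun s => T.obj (X s)) ≫ L.freeAct X =
      L.act P ≫ E.str.sub d fun s => T.obj (X s) :=
    L.sub_hom d fun s => T.free.obj (X s)
  have hact : T.map (E.tensor.tmap fun i => L.freeAct fun j => X (d.index i j)) ≫ L.act P =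
      L.freeAct (fun i => (E.tensor (d.len i)).obj fun j => T.obj (X (d.index i j))) ≫
        E.tensor.tmap fun i => L.freeAct fun j => X (d.index i j) :=
    L.act_naturality (X := fun i => T.free.obj ((E.tensor (d.len i)).obj
      fun j => T.obj (X (d.index i j)))) fun i => ⟨(P i).a, (P i).assoc.symm⟩
  rw [compositeSub, T.map_comp, Category.assoc, hsub, ← Category.assoc (L.freeAct _), ← hact]
  exact (Category.assoc _ _ _).symm

theorem compositeSub_naturality {N k : ℕ} (d : Subdivision N k) {X Y : Fin N → V}
    (f : ∀ i, X i ⟶ Y i) :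
    E.tensor.tmap (fun i => T.map (E.tensor.tmap fun j => T.map (f (d.index i j)))) ≫
        L.compositeSub d Y =
      L.compositeSub d X ≫ E.tensor.tmap fun s => T.map (f s) := by
  rw [compositeSub, compositeSub, Category.assoc, ← E.str.sub_naturality,
    E.tensor.tmap_comp_assoc, E.tensor.tmap_comp_assoc]
  simp only [L.freeAct_naturality]

theorem map_tmap_compositeSub_freeAct {N k : ℕ} (d : Subdivision N k) {X : Fin N → V}
    {Y : ∀ i, Fin (d.len i) → V} (f : ∀ i j, Y i j ⟶ X (d.index i j)) :
    T.map (E.tensor.tmap (fun i => T.map (E.tensor.tmap fun j => T.map (f i j))) ≫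
        L.compositeSub d X) ≫ L.freeAct X =
      L.freeAct _ ≫ E.tensor.tmap (fun i => L.freeAct (Y i)) ≫
        E.str.subMap d fun i j => T.map (f i j) := by
  rw [T.map_comp, Category.assoc, L.map_compositeSub_freeAct, compositeSub,
    reassoc_of% L.freeAct_naturality, E.tensor.tmap_comp_assoc, MultitensorStruct.subMap,
    E.tensor.tmap_comp_assoc]
  simp only [L.freeAct_naturality]

theorem compositeSub_assoc {N M k : ℕ} (d : Subdivision N M) (c : Subdivision M k)
    (X : Fin N → V) :
    L.compositeSub c (fun a => (E.tensor (d.len a)).obj fun l => T.obj (X (d.index a l))) ≫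
        L.compositeSub d X =
      E.tensor.tmap (fun i => T.map
          (E.tensor.tmap (fun j => T.map (E.tensor.tmap fun l => T.map
            (eqToHom (congrArg X (Subdivision.index_comp d c i j l).symm)))) ≫
          L.compositeSub (d.restrict c i) fun l => X ((d.comp c).index i l))) ≫
        L.compositeSub (d.comp c) X := by
  let f (i j) (l : Fin ((d.restrict c i).len j)) :=
    eqToHom (congrArg X (Subdivision.index_comp d c i j l).symm)
  have hassoc := E.str.assoc d c fun s => T.obj (X s)
  have hsub := E.str.sub_naturality c fun a => L.freeAct fun l => X (d.index a l)
  have hblock (i) := L.map_tmap_compositeSub_freeAct (d.restrict c i)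
    (X := fun l => X ((d.comp c).index i l)) (f i)
  simp only [MultitensorStruct.subMap, f, eqToHom_map] at hblock
  rw [compositeSub, compositeSub, Category.assoc, ← reassoc_of% hsub, hassoc,
    E.tensor.tmap_comp_assoc, E.tensor.tmap_comp_assoc]
  simp only [eqToHom_map]
  rw [compositeSub, E.tensor.tmap_comp_assoc]
  congr 1
  refine E.tensor.tmap_congr fun i => Eq.trans ?_ (hblock i).symm
  exact Category.assoc _ _ _

theorem unit_compositeSub {N : ℕ} (X : Fin N → V) :
    E.str.unit (fun i => T.obj ((E.tensor N).obj fun j =>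
        T.obj (X ((Subdivision.whole N).index i j)))) ≫ L.compositeSub (Subdivision.whole N) X =
      L.freeAct (fun j => X ((Subdivision.whole N).index 0 j)) ≫
        E.tensor.tmap fun j => T.map (eqToHom (congrArg X (Subdivision.index_whole N 0 j))) := by
  have hunit := E.str.unit_naturality fun i =>
    L.freeAct fun j => X ((Subdivision.whole N).index i j)
  simp only [eqToHom_map]
  refine ((reassoc_of% hunit) (E.str.sub (Subdivision.whole N) fun j => T.obj (X j))).symm.trans ?_
  exact congrArg (L.freeAct _ ≫ ·) (E.str.unit_sub fun j => T.obj (X j))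

theorem map_unit_compositeSub_whole {n : ℕ} (X : Fin n → V) :
    T.map (E.tensor.tmap fun j => T.map
        (eqToHom (congrArg X (Subdivision.index_whole n 0 j).symm))) ≫
      E.str.unit (fun i => T.obj ((E.tensor n).obj fun j =>
        T.obj (X ((Subdivision.whole n).index i j)))) ≫
      L.compositeSub (Subdivision.whole n) X = L.freeAct X := by
  have hf (j) : X j = X ((Subdivision.whole n).index 0 j) :=
    congrArg X (Subdivision.index_whole n 0 j).symm
  have hn := L.freeAct_naturality fun j => eqToHom (hf j)
  have hid : E.tensor.tmap (fun j => T.map (eqToHom (hf j))) ≫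
      E.tensor.tmap (fun j => T.map (eqToHom (hf j).symm)) = 𝟙 _ := by
    rw [E.tensor.tmap_comp]
    simp [E.tensor.tmap_id]
  refine (congrArg (T.map _ ≫ ·) (L.unit_compositeSub X)).trans (((reassoc_of% hn) _).trans ?_)
  exact (congrArg (L.freeAct X ≫ ·) hid).trans (Category.comp_id _)

theorem eta_unit_compositeSub {N : ℕ} (X : Fin N → V) :
    (T.η.app ((E.tensor N).obj fun j => T.obj (X ((Subdivision.whole N).index 0 j))) ≫
        E.str.unit fun i => T.obj ((E.tensor N).obj fun j =>
          T.obj (X ((Subdivision.whole N).index i j)))) ≫ L.compositeSub (Subdivision.whole N) X =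
      E.tensor.tmap fun j => T.map (eqToHom (congrArg X (Subdivision.index_whole N 0 j))) := by
  have hact := L.unit_freeAct fun j => X ((Subdivision.whole N).index 0 j)
  refine (Category.assoc _ _ _).trans ((congrArg (T.η.app _ ≫ ·) (L.unit_compositeSub X)).trans ?_)
  exact ((reassoc_of% hact) _)

theorem map_unit_comp_freeAct (X : Fin 1 → V) :
    T.map (T.η.app (X 0) ≫ E.str.unit fun i => T.obj (X i)) ≫ L.freeAct X =
      E.str.unit fun i => T.obj (X i) := by
  rw [T.map_comp, Category.assoc, L.map_unit_freeAct]
  exact T.right_unit_assoc (X 0) _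

theorem tmap_unit_compositeSub {N : ℕ} (X : Fin N → V) :
    E.tensor.tmap (fun i => T.map (T.η.app (X i) ≫
        E.str.unit fun j => T.obj (X ((Subdivision.singles N).index i j)))) ≫
      L.compositeSub (Subdivision.singles N) X = 𝟙 _ := by
  rw [compositeSub]
  refine (E.tensor.tmap_comp_assoc _ _ _).trans (Eq.trans ?_ (E.str.sub_unit fun j => T.obj (X j)))
  exact congrArg (E.tensor.tmap · ≫ _) (funext fun i =>
    L.map_unit_comp_freeAct fun j => X ((Subdivision.singles N).index i j))

/-- The multitensor structure on `EM(T)` determined by actions. -/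
def compositeStr : MultitensorStruct (E.tensor.precomp T.toFunctor) where
  unit X := T.η.app (X 0) ≫ E.str.unit fun i => T.obj (X i)
  sub d X := L.compositeSub d X
  unit_naturality {X Y} f := by
    refine (T.η.naturality_assoc (f 0) _).trans ?_
    exact (congrArg (T.η.app (X 0) ≫ ·) (E.str.unit_naturality fun i => T.map (f i))).trans
      (Category.assoc _ _ _).symm
  sub_naturality d _ _ f := L.compositeSub_naturality d f
  unit_sub X := L.eta_unit_compositeSub X
  sub_unit X := L.tmap_unit_compositeSub X
  assoc d c X := L.compositeSub_assoc d c X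

theorem tmap_unit_compositeSub_middle {n : ℕ} (X : Fin n → V) :
    E.tensor.tmap (fun i =>
        E.str.unit (fun j => T.obj (X ((Subdivision.singles n).index i j))) ≫
          T.η.app ((E.tensor 1).obj fun j => T.obj (X ((Subdivision.singles n).index i j)))) ≫
      L.compositeSub (Subdivision.singles n) X = 𝟙 _ := by
  rw [compositeSub]
  refine (E.tensor.tmap_comp_assoc _ _ _).trans (Eq.trans ?_ (E.str.sub_unit fun j => T.obj (X j)))
  refine congrArg (E.tensor.tmap · ≫ _) (funext fun i => ?_)
  refine (Category.assoc _ _ _).trans ((congrArg (E.str.unit _ ≫ ·) ?_).trans (Category.comp_id _))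
  exact L.unit_freeAct fun j => X ((Subdivision.singles n).index i j)

theorem sub_tmap_eta {N k : ℕ} (d : Subdivision N k) (X : Fin N → V) :
    E.str.sub d X ≫ E.tensor.tmap (fun s => T.η.app (X s)) =
      E.tensor.tmap (fun i => E.tensor.tmap fun j => T.η.app (X (d.index i j))) ≫
        E.tensor.tmap (fun i => T.η.app ((E.tensor (d.len i)).obj
          fun j => T.obj (X (d.index i j)))) ≫
        L.compositeSub d X := by
  have hact (i) : T.η.app ((E.tensor (d.len i)).obj fun j => T.obj (X (d.index i j))) ≫
      L.freeAct (fun j => X (d.index i j)) = 𝟙 _ := L.unit_freeAct _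
  rw [← E.str.sub_naturality, compositeSub]
  refine congrArg (_ ≫ ·) (Eq.symm ?_)
  refine (E.tensor.tmap_comp_assoc _ _ _).trans ((congrArg (· ≫ _) ?_).trans (Category.id_comp _))
  exact (E.tensor.tmap_congr hact).trans (E.tensor.tmap_id _)

/-- The composite multitensor determined by actions. -/
def composite : CompositeMultitensor E T where
  str := L.compositeStr
  unit_eq _ := rfl
  isMultitensorMap :=
    { unit := fun X => (E.str.unit_naturality fun i => T.η.app (X i)).symm
      sub := L.sub_tmap_eta }
  isMonadMap := by
    refine ⟨{ app := fun X => E.str.unit fun _ => T.obj X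
              naturality := fun X Y f => E.str.unit_naturality fun _ => T.map f
              app_η := fun X => rfl
              app_μ := fun X => ?_ }, fun X => rfl⟩
    have h := L.unit_compositeSub fun _ : Fin 1 => X
    simp only [eqToHom_refl, T.map_id, E.tensor.tmap_id, Category.comp_id] at h
    refine Eq.trans ?_ (Category.assoc _ _ _).symm
    exact ((congrArg (T.map _ ≫ ·) h).trans (L.map_unit_freeAct fun _ => X)).symm
  middle_unit X := L.tmap_unit_compositeSub_middle X

end LiftedActions

namespace CompositeMultitensor

variable {E : Multitensor V} {T : Monad V} (S : CompositeMultitensor E T) {N k : ℕ}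

/-- The substitution `E_i T E_j T X_ij ⟶ E_ij T X_ij`. -/
def σ (d : Subdivision N k) (X : Fin N → V) :
    (E.tensor k).obj (fun i => T.obj ((E.tensor (d.len i)).obj fun j => T.obj (X (d.index i j)))) ⟶
      (E.tensor N).obj fun s => T.obj (X s) :=
  S.str.sub d X

/-- The substitution `E₁ T E_i T X_i ⟶ E_i T X_i`. -/
def σ₁ (X : Fin N → V) :
    (E.tensor 1).obj (fun _ => T.obj ((E.tensor N).obj fun i => T.obj (X i))) ⟶
      (E.tensor N).obj fun i => T.obj (X i) :=
  S.str.sub₁ X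

/-- The substitution `E_i T E₁ T X_i ⟶ E_i T X_i`. -/
def σₛ (X : Fin N → V) :
    (E.tensor N).obj (fun i => T.obj ((E.tensor 1).obj fun _ => T.obj (X i))) ⟶
      (E.tensor N).obj fun i => T.obj (X i) :=
  S.str.subₛ X

theorem tmap_σ (d : Subdivision N k) {X Y : Fin N → V} (f : ∀ s, X s ⟶ Y s) :
    E.tensor.tmap (fun i => T.map (E.tensor.tmap fun j => T.map (f (d.index i j)))) ≫ S.σ d Y =
      S.σ d X ≫ E.tensor.tmap fun s => T.map (f s) :=
  S.str.sub_naturality d f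

theorem tmap_σ₁ {X Y : Fin N → V} (f : ∀ i, X i ⟶ Y i) :
    E.tensor.tmap (fun _ => T.map (E.tensor.tmap fun i => T.map (f i))) ≫ S.σ₁ Y =
      S.σ₁ X ≫ E.tensor.tmap fun i => T.map (f i) :=
  S.str.tmap_sub₁ f

theorem σ_σₛ (d : Subdivision N k) (X : Fin N → V) :
    S.σ d (fun s => (E.tensor 1).obj fun _ => T.obj (X s)) ≫ S.σₛ X =
      E.tensor.tmap (fun i => T.map (S.σₛ fun j => X (d.index i j))) ≫ S.σ d X :=
  S.str.sub_subₛ d X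

theorem σₛ_σ (d : Subdivision N k) (X : Fin N → V) :
    S.σₛ (fun i => (E.tensor (d.len i)).obj fun j => T.obj (X (d.index i j))) ≫ S.σ d X =
      E.tensor.tmap (fun i => T.map (S.σ₁ fun j => X (d.index i j))) ≫ S.σ d X :=
  S.str.subₛ_sub d X

theorem σₛ_σₛ (X : Fin N → V) :
    S.σₛ (fun i => (E.tensor 1).obj fun _ => T.obj (X i)) ≫ S.σₛ X =
      E.tensor.tmap (fun i => T.map (S.σ₁ fun _ : Fin 1 => X i)) ≫ S.σₛ X :=
  S.str.subₛ_subₛ X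

/-- The action of `T` on `E_i T X_i`. -/
def freeAct (X : Fin N → V) :
    T.obj ((E.tensor N).obj fun i => T.obj (X i)) ⟶ (E.tensor N).obj fun i => T.obj (X i) :=
  E.str.unit (fun _ => T.obj ((E.tensor N).obj fun i => T.obj (X i))) ≫ S.σ₁ X

theorem map_freeAct {Z : V} {X : Fin N → V} (f : Z ⟶ (E.tensor N).obj fun i => T.obj (X i)) :
    T.map f ≫ S.freeAct X =
      E.str.unit (fun _ => T.obj Z) ≫ E.tensor.tmap (fun _ => T.map f) ≫ S.σ₁ X := by
  rw [freeAct, ← Category.assoc, ← Category.assoc, ← E.str.unit_naturality]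

theorem freeAct_naturality {X Y : Fin N → V} (f : ∀ i, X i ⟶ Y i) :
    T.map (E.tensor.tmap fun i => T.map (f i)) ≫ S.freeAct Y =
      S.freeAct X ≫ E.tensor.tmap fun i => T.map (f i) := by
  rw [map_freeAct, tmap_σ₁, freeAct, Category.assoc]

theorem unit_freeAct (X : Fin N → V) :
    T.η.app ((E.tensor N).obj fun i => T.obj (X i)) ≫ S.freeAct X = 𝟙 _ := by
  refine Eq.trans ?_ (S.str.unit_sub₁ X)
  rw [S.unit_eq]
  exact (Category.assoc _ _ _).symm

theorem map_σ₁_freeAct (X : Fin N → V) :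
    T.map (S.σ₁ X) ≫ S.freeAct X =
      S.freeAct (fun _ : Fin 1 => (E.tensor N).obj fun i => T.obj (X i)) ≫ S.σ₁ X := by
  rw [map_freeAct, freeAct, Category.assoc]
  exact congrArg (E.str.unit _ ≫ ·) (S.str.sub₁_sub₁ X).symm

theorem map_σₛ_freeAct (X : Fin N → V) :
    T.map (S.σₛ X) ≫ S.freeAct X =
      S.freeAct (fun i => (E.tensor 1).obj fun _ => T.obj (X i)) ≫ S.σₛ X := by
  rw [map_freeAct, freeAct, Category.assoc]
  exact congrArg (E.str.unit _ ≫ ·) (S.str.sub₁_subₛ X).symm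

theorem map_σ_freeAct (d : Subdivision N k) (X : Fin N → V) :
    T.map (S.σ d X) ≫ S.freeAct X =
      S.freeAct (fun i => (E.tensor (d.len i)).obj fun j => T.obj (X (d.index i j))) ≫ S.σ d X := by
  rw [map_freeAct, freeAct, Category.assoc]
  exact congrArg (E.str.unit _ ≫ ·) (S.str.sub₁_sub d X).symm

theorem mu_unit (X : V) :
    T.μ.app X ≫ E.str.unit (fun _ => T.obj X) =
      T.map (E.str.unit fun _ => T.obj X) ≫ S.freeAct fun _ : Fin 1 => X := by
  obtain ⟨φ, hφ⟩ := S.isMonadMap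
  have h := φ.app_μ X
  have hσ : S.σ₁ (fun _ : Fin 1 => X) = S.str.sub (Subdivision.whole 1) fun _ => X :=
    S.str.subMap_id (Subdivision.whole 1) fun _ => X
  rw [hφ, hφ] at h
  rw [freeAct, hσ]
  exact h.trans (Category.assoc _ _ _)

theorem mu_freeAct (X : Fin N → V) :
    T.μ.app ((E.tensor N).obj fun i => T.obj (X i)) ≫ S.freeAct X =
      T.map (S.freeAct X) ≫ S.freeAct X := by
  conv_rhs => rw [freeAct, T.map_comp, Category.assoc]
  rw [← freeAct, map_σ₁_freeAct, freeAct, reassoc_of% S.mu_unit]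

theorem tmap_unit_eta_σₛ (X : Fin N → V) :
    E.tensor.tmap (fun i => E.str.unit (fun _ => T.obj (X i)) ≫
      T.η.app ((E.tensor 1).obj fun _ => T.obj (X i))) ≫ S.σₛ X = 𝟙 _ := by
  have h (Y : Fin N → Fin 1 → V) (hY : ∀ i j, Y i j = X ((Subdivision.singles N).index i j)) :
      E.tensor.tmap (fun i => E.str.unit (fun j => T.obj (Y i j)) ≫
          T.η.app ((E.tensor 1).obj fun j => T.obj (Y i j))) ≫
        S.str.subMap (Subdivision.singles N) (fun i j => eqToHom (hY i j)) =
      E.tensor.tmap fun i => T.map (eqToHom (hY i 0)) := by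
    obtain rfl : Y = fun i j => X ((Subdivision.singles N).index i j) :=
      funext fun i => funext fun j => hY i j
    simp only [eqToHom_refl, T.map_id, S.str.subMap_id]
    exact (S.middle_unit X).trans (E.tensor.tmap_id _).symm
  refine (h (fun i _ => X i) fun i j => congrArg X (Subdivision.index_singles i j).symm).trans ?_
  exact (E.tensor.tmap_congr fun i => T.map_id (X i)).trans (E.tensor.tmap_id _)

/-- Associativity of `σ'` turns the multiplication of `T` into a substitution, because `uT` is a
monad map. -/
theorem tmap_mu (X : Fin N → V) :
    E.tensor.tmap (fun i => T.μ.app (X i)) =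
      E.tensor.tmap (fun i => T.map (E.str.unit fun _ => T.obj (X i))) ≫ S.σₛ X := by
  have hmid (Y : Fin N → V) : E.tensor.tmap (fun i => E.str.unit (fun _ => T.obj (Y i)) ≫
      T.η.app ((E.tensor 1).obj fun _ => T.obj (Y i))) ≫ S.σₛ Y = 𝟙 _ := S.tmap_unit_eta_σₛ Y
  have hmu (i) : T.μ.app (X i) ≫ E.str.unit (fun _ => T.obj (X i)) ≫
        T.η.app ((E.tensor 1).obj fun _ => T.obj (X i)) =
      T.map (E.str.unit fun _ => T.obj (X i)) ≫
        (E.str.unit (fun _ => T.obj ((E.tensor 1).obj fun _ => T.obj (X i))) ≫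
          T.η.app ((E.tensor 1).obj fun _ => T.obj ((E.tensor 1).obj fun _ => T.obj (X i)))) ≫
        T.map (S.σ₁ fun _ : Fin 1 => X i) := by
    have h := T.η.naturality (S.σ₁ fun _ : Fin 1 => X i)
    rw [reassoc_of% S.mu_unit, freeAct, Category.assoc, Category.assoc]
    exact congrArg (T.map _ ≫
      E.str.unit (fun _ => T.obj ((E.tensor 1).obj fun _ => T.obj (X i))) ≫ ·) h
  calc
    _ = E.tensor.tmap (fun i => T.μ.app (X i) ≫ E.str.unit (fun _ => T.obj (X i)) ≫
          T.η.app ((E.tensor 1).obj fun _ => T.obj (X i))) ≫ S.σₛ X := by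
      rw [← E.tensor.tmap_comp, Category.assoc, hmid]
      exact (Category.comp_id _).symm
    _ = _ := by
      simp only [hmu]
      rw [← E.tensor.tmap_comp, ← E.tensor.tmap_comp, Category.assoc, Category.assoc, ← σₛ_σₛ,
        reassoc_of% hmid]

theorem σ_tmap_mu (d : Subdivision N k) (X : Fin N → V) :
    S.σ d (fun s => T.obj (X s)) ≫ E.tensor.tmap (fun s => T.μ.app (X s)) =
      E.tensor.tmap (fun i => T.map (E.tensor.tmap fun j => T.μ.app (X (d.index i j)))) ≫
        S.σ d X := by
  rw [S.tmap_mu, ← Category.assoc, ← S.tmap_σ, Category.assoc, σ_σₛ, E.tensor.tmap_comp_assoc]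
  simp only [← T.map_comp, ← S.tmap_mu]

theorem map_tmap_mu_freeAct (X : Fin N → V) :
    T.map (E.tensor.tmap fun i => T.μ.app (X i)) ≫ S.freeAct X =
      S.freeAct (fun i => T.obj (X i)) ≫ E.tensor.tmap fun i => T.μ.app (X i) := by
  rw [S.tmap_mu, T.map_comp, Category.assoc, map_σₛ_freeAct, ← Category.assoc,
    S.freeAct_naturality, Category.assoc]

theorem tmap_eta_σ (d : Subdivision N k) (X : Fin N → V) :
    E.tensor.tmap (fun i => T.η.app ((E.tensor (d.len i)).obj fun j => T.obj (X (d.index i j)))) ≫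
      S.σ d X = E.str.sub d fun s => T.obj (X s) := by
  have hmap : E.str.sub d (fun s => T.obj (X s)) ≫ E.tensor.tmap (fun s => T.η.app (T.obj (X s))) =
      E.tensor.tmap (fun i => E.tensor.tmap fun j => T.η.app (T.obj (X (d.index i j)))) ≫
        E.tensor.tmap (fun i => T.η.app ((E.tensor (d.len i)).obj
          fun j => T.obj (T.obj (X (d.index i j))))) ≫ S.σ d fun s => T.obj (X s) :=
    S.isMultitensorMap.sub d fun s => T.obj (X s)
  have hmu {n : ℕ} (Y : Fin n → V) : E.tensor.tmap (fun i => T.η.app (T.obj (Y i))) ≫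
      E.tensor.tmap (fun i => T.μ.app (Y i)) = 𝟙 _ := by
    rw [E.tensor.tmap_comp]
    exact (E.tensor.tmap_congr fun i => T.left_unit (Y i)).trans (E.tensor.tmap_id _)
  have hη (i) : T.η.app ((E.tensor (d.len i)).obj fun j => T.obj (T.obj (X (d.index i j)))) ≫
        T.map (E.tensor.tmap fun j => T.μ.app (X (d.index i j))) =
      E.tensor.tmap (fun j => T.μ.app (X (d.index i j))) ≫
        T.η.app ((E.tensor (d.len i)).obj fun j => T.obj (X (d.index i j))) :=
    (T.η.naturality _).symm
  have hleft : (E.tensor.tmap (fun i => E.tensor.tmap fun j => T.η.app (T.obj (X (d.index i j)))) ≫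
      E.tensor.tmap (fun i => E.tensor.tmap fun j => T.μ.app (X (d.index i j)))) = 𝟙 _ := by
    rw [E.tensor.tmap_comp]
    exact (E.tensor.tmap_congr fun i => hmu _).trans (E.tensor.tmap_id _)
  calc
    _ = E.tensor.tmap (fun i => E.tensor.tmap fun j => T.η.app (T.obj (X (d.index i j)))) ≫
          E.tensor.tmap (fun i => T.η.app ((E.tensor (d.len i)).obj
            fun j => T.obj (T.obj (X (d.index i j))))) ≫
          (S.σ d fun s => T.obj (X s)) ≫ E.tensor.tmap fun s => T.μ.app (X s) := by
      rw [σ_tmap_mu, E.tensor.tmap_comp_assoc _ _ (S.σ d X)]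
      simp only [hη]
      rw [← E.tensor.tmap_comp_assoc]
      exact ((reassoc_of% hleft) _).symm
    _ = E.str.sub d (fun s => T.obj (X s)) ≫ E.tensor.tmap (fun s => T.η.app (T.obj (X s))) ≫
          E.tensor.tmap (fun s => T.μ.app (X s)) := by
      rw [reassoc_of% hmap]
    _ = _ := (congrArg (E.str.sub d _ ≫ ·) (hmu X)).trans (Category.comp_id _)

theorem tmap_map_freeAct_σ (d : Subdivision N k) (X : Fin N → V) :
    E.tensor.tmap (fun i => T.map (S.freeAct fun j => X (d.index i j))) ≫ S.σ d X =
      E.tensor.tmap (fun i => T.μ.app ((E.tensor (d.len i)).obj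
        fun j => T.obj (X (d.index i j)))) ≫ S.σ d X := by
  rw [S.tmap_mu, Category.assoc, σₛ_σ, E.tensor.tmap_comp_assoc]
  simp only [freeAct, T.map_comp]

theorem σ_eq (d : Subdivision N k) (X : Fin N → V) :
    S.σ d X = E.tensor.tmap (fun i => S.freeAct fun j => X (d.index i j)) ≫
      E.str.sub d fun s => T.obj (X s) := by
  have hη (i) : S.freeAct (fun j => X (d.index i j)) ≫
        T.η.app ((E.tensor (d.len i)).obj fun j => T.obj (X (d.index i j))) =
      T.η.app (T.obj ((E.tensor (d.len i)).obj fun j => T.obj (X (d.index i j)))) ≫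
        T.map (S.freeAct fun j => X (d.index i j)) := T.η.naturality _
  have hμ (i) : T.η.app (T.obj ((E.tensor (d.len i)).obj fun j => T.obj (X (d.index i j)))) ≫
        T.μ.app ((E.tensor (d.len i)).obj fun j => T.obj (X (d.index i j))) = 𝟙 _ :=
    T.left_unit _
  rw [← tmap_eta_σ, E.tensor.tmap_comp_assoc, E.tensor.tmap_congr hη,
    ← E.tensor.tmap_comp_assoc, tmap_map_freeAct_σ, E.tensor.tmap_comp_assoc]
  refine ((congrArg (· ≫ S.σ d X) ?_).trans (Category.id_comp _)).symm
  exact (E.tensor.tmap_congr hμ).trans (E.tensor.tmap_id _)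

/-- The coherence maps of the opmonoidal monad determined by a composite multitensor. -/
def coherenceMap (X : Fin N → V) :
    T.obj ((E.tensor N).obj X) ⟶ (E.tensor N).obj fun i => T.obj (X i) :=
  T.map (E.tensor.tmap fun i => T.η.app (X i)) ≫ S.freeAct X

theorem coherenceMap_naturality {X Y : Fin N → V} (f : ∀ i, X i ⟶ Y i) :
    T.map (E.tensor.tmap f) ≫ S.coherenceMap Y =
      S.coherenceMap X ≫ E.tensor.tmap fun i => T.map (f i) := by
  have hη (i) : f i ≫ T.η.app (Y i) = T.η.app (X i) ≫ T.map (f i) := T.η.naturality (f i)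
  rw [coherenceMap, coherenceMap, Category.assoc, ← S.freeAct_naturality, ← Category.assoc,
    ← Category.assoc, ← T.map_comp, ← T.map_comp, E.tensor.tmap_comp, E.tensor.tmap_comp,
    E.tensor.tmap_congr hη]

theorem map_unit_coherenceMap (X : Fin 1 → V) :
    T.map (E.str.unit X) ≫ S.coherenceMap X = E.str.unit fun i => T.obj (X i) := by
  obtain ⟨Y, rfl⟩ : ∃ Y, X = fun _ => Y := ⟨X 0, funext fun i => by rw [Subsingleton.elim i 0]⟩
  rw [coherenceMap, ← Category.assoc, ← T.map_comp, ← E.str.unit_naturality, T.map_comp,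
    Category.assoc, ← S.mu_unit]
  exact T.right_unit_assoc Y _

theorem map_sub_freeAct (d : Subdivision N k) (X : Fin N → V) :
    T.map (E.str.sub d fun s => T.obj (X s)) ≫ S.freeAct X =
      S.coherenceMap (fun i => (E.tensor (d.len i)).obj fun j => T.obj (X (d.index i j))) ≫
        S.σ d X := by
  rw [← tmap_eta_σ, T.map_comp, Category.assoc, map_σ_freeAct, coherenceMap, Category.assoc]

theorem map_sub_coherenceMap (d : Subdivision N k) (X : Fin N → V) :
    T.map (E.str.sub d X) ≫ S.coherenceMap X =
      S.coherenceMap (fun i => (E.tensor (d.len i)).obj fun j => X (d.index i j)) ≫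
        E.tensor.tmap (fun i => S.coherenceMap fun j => X (d.index i j)) ≫
        E.str.sub d fun s => T.obj (X s) := by
  rw [coherenceMap, ← Category.assoc, ← T.map_comp, ← E.str.sub_naturality, T.map_comp,
    Category.assoc, map_sub_freeAct, ← Category.assoc, S.coherenceMap_naturality, Category.assoc,
    σ_eq, E.tensor.tmap_comp_assoc]
  simp only [coherenceMap]

theorem coherenceMap_tmap_mu (X : Fin N → V) :
    S.coherenceMap (fun i => T.obj (X i)) ≫ E.tensor.tmap (fun i => T.μ.app (X i)) =
      S.freeAct X := by
  rw [coherenceMap, Category.assoc, ← map_tmap_mu_freeAct, ← Category.assoc, ← T.map_comp,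
    E.tensor.tmap_comp]
  have hη : E.tensor.tmap (fun i => T.η.app (T.obj (X i)) ≫ T.μ.app (X i)) = 𝟙 _ :=
    (E.tensor.tmap_congr fun i => T.left_unit (X i)).trans (E.tensor.tmap_id _)
  rw [hη]
  exact (congrArg (· ≫ S.freeAct X) (T.map_id _)).trans (Category.id_comp _)

/-- The opmonoidal monad determined by a composite multitensor. -/
def coherence : OpmonoidalCoherence E T where
  τ X := S.coherenceMap X
  naturality f := S.coherenceMap_naturality f
  unit_τ X := S.map_unit_coherenceMap X
  sub_τ d X := S.map_sub_coherenceMap d X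
  η_τ X := by
    refine (T.η.naturality_assoc (E.tensor.tmap fun i => T.η.app (X i)) _).symm.trans ?_
    exact (congrArg (_ ≫ ·) (S.unit_freeAct X)).trans (Category.comp_id _)
  μ_τ X := by
    rw [coherenceMap_tmap_mu, coherenceMap, ← T.mu_naturality_assoc, mu_freeAct, T.map_comp,
      Category.assoc]

theorem ext_sub {S S' : CompositeMultitensor E T}
    (h : ∀ {N k : ℕ} (d : Subdivision N k) (X : Fin N → V), S.σ d X = S'.σ d X) : S = S' := by
  obtain ⟨⟨unit, sub, _, _, _, _, _⟩, unit_eq, _, _, _⟩ := S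
  obtain ⟨⟨unit', sub', _, _, _, _, _⟩, unit_eq', _, _, _⟩ := S'
  obtain rfl : unit = unit' := funext fun X => (unit_eq X).trans (unit_eq' X).symm
  obtain rfl : @sub = @sub' := by
    funext N k d X
    exact h d X
  rfl

theorem coherence_actions_composite : S.coherence.actions.composite = S :=
  ext_sub fun d X => by
    have h (i) : S.coherence.actions.freeAct (fun j => X (d.index i j)) =
      S.freeAct fun j => X (d.index i j) := S.coherenceMap_tmap_mu _
    rw [S.σ_eq, ← E.tensor.tmap_congr h]
    rfl

end CompositeMultitensor

theorem LiftedActions.composite_freeAct {E : Multitensor V} {T : Monad V} (L : LiftedActions E T)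
    {n : ℕ} (X : Fin n → V) : L.composite.freeAct X = L.freeAct X := by
  have hu := E.str.unit_naturality fun i : Fin 1 => T.map (E.tensor.tmap fun j =>
    T.map (eqToHom (congrArg X (Subdivision.index_whole n i j).symm)))
  exact ((reassoc_of% hu) _).symm.trans (L.map_unit_compositeSub_whole X)

theorem LiftedActions.composite_coherence {E : Multitensor V} {T : Monad V}
    (L : LiftedActions E T) : L.composite.coherence = L.coherence :=
  OpmonoidalCoherence.ext <| by
    funext n X
    exact congrArg (T.map _ ≫ ·) (L.composite_freeAct X)

/-- Opmonoidal coherences correspond to composite multitensors. -/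
def compositeEquiv (E : Multitensor V) (T : Monad V) :
    OpmonoidalCoherence E T ≃ CompositeMultitensor E T where
  toFun c := c.actions.composite
  invFun S := S.coherence
  left_inv c := c.actions.composite_coherence.trans ((actionsEquiv E T).left_inv c)
  right_inv S := S.coherence_actions_composite

/-! ### Enriched categories -/

theorem OpmonoidalCoherence.actions_compositeSub {E : Multitensor V} {T : Monad V}
    (c : OpmonoidalCoherence E T) {N k : ℕ} (d : Subdivision N k) (X : Fin N → V) :
    c.actions.compositeSub d X =
      E.tensor.tmap (fun i => c.τ fun j => T.obj (X (d.index i j))) ≫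
        E.str.sub d (fun s => T.obj (T.obj (X s))) ≫ E.tensor.tmap fun s => T.μ.app (X s) := by
  rw [← E.str.sub_naturality, E.tensor.tmap_comp_assoc]
  rfl

namespace MultitensorCat

theorem κ_congr {M : Multitensor V} (C : MultitensorCat.{v, u, w} M) {a b : C.graph.carrier} {n : ℕ}
    {f g : Fin (n + 1) → C.graph.carrier} (h : f = g) (hf : f 0 = a) (hf' : f (Fin.last n) = b)
    (hg : g 0 = a) (hg' : g (Fin.last n) = b)
    (e : ∀ j : Fin n, C.graph.hom (f j.castSucc) (f j.succ) =
      C.graph.hom (g j.castSucc) (g j.succ)) :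
    M.tensor.tmap (fun j => eqToHom (e j)) ≫ C.κ (⟨n, g, hg, hg'⟩ : Chain a b) =
      C.κ ⟨n, f, hf, hf'⟩ := by
  subst h
  exact (congrArg (· ≫ C.κ (⟨n, f, hf, hf'⟩ : Chain a b)) (M.tensor.tmap_id fun j =>
    C.graph.hom (f j.castSucc) (f j.succ))).trans (Category.id_comp _)

theorem ext_κ {M : Multitensor V} {C D : MultitensorCat.{v, u, w} M} (h : C.graph = D.graph)
    (hκ : HEq (@C.κ) (@D.κ)) : C = D := by
  obtain ⟨X, κ, _, _⟩ := C
  obtain ⟨Y, κ', _, _⟩ := D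
  obtain rfl : X = Y := h
  obtain rfl := eq_of_heq hκ
  rfl

instance forget_faithful (M : Multitensor V) : (forget.{v, u, w} M).Faithful where
  map_injective h := Hom.ext h

end MultitensorCat

instance mapFunctor_faithful {W : Type u₁} [Category.{v₁} W] (F : V ⥤ W) [F.Faithful] :
    (EnrichedGraph.mapFunctor.{v, u, v₁, u₁, w} F).Faithful where
  map_injective {X Y f g} h := by
    obtain ⟨fo, fm⟩ := f
    obtain ⟨go, gm⟩ := g
    obtain rfl : fo = go := congrArg EnrichedGraph.Hom.obj h
    have hmap := eq_of_heq (EnrichedGraph.Hom.mk.inj h).2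
    obtain rfl : fm = gm := by
      funext a b
      exact F.map_injective (congrFun (congrFun hmap a) b)
    rfl

namespace LiftedActions

variable {E : Multitensor V} {T : Monad V} (L : LiftedActions E T)

section

variable (C : MultitensorCat.{v, u, w} L.composite.multitensor)

/-- The compositions of an `EM(T)`-category `C`, with the tensor products of `EM(T)` written out in
terms of `E` and `T`. -/
def outerComp {a b : C.graph.carrier} (p : Chain a b) :
    (E.tensor p.len).obj (fun i => T.obj (C.graph.homs p i)) ⟶ C.graph.hom a b :=
  C.κ p

/-- The action of `T` on the homs of an `EM(T)`-category, given by composing sequences of length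
one. -/
def homAct (a b : C.graph.carrier) : T.obj (C.graph.hom a b) ⟶ C.graph.hom a b :=
  E.str.unit (fun i => T.obj (C.graph.homs (Chain.pair a b) i)) ≫ L.outerComp C (Chain.pair a b)

theorem homAct_eq_unit_outerComp (x : Fin 2 → C.graph.carrier) :
    L.homAct C (x 0) (x (Fin.last 1)) =
      E.str.unit (fun i => T.obj (C.graph.hom (x i.castSucc) (x i.succ))) ≫
        L.outerComp C (⟨1, x, rfl, rfl⟩ : Chain (x 0) (x (Fin.last 1))) := by
  obtain ⟨a, b, rfl⟩ : ∃ a b, x = Fin.cases a fun _ => b :=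
    ⟨x 0, x 1, funext fun i => by fin_cases i <;> rfl⟩
  rfl

theorem compositeSub_outerComp {a b : C.graph.carrier} (p : Chain a b) {k : ℕ}
    (d : Subdivision p.len k) :
    L.compositeSub d (C.graph.homs p) ≫ L.outerComp C p =
      E.tensor.tmap (fun i => T.map (L.outerComp C (p.block d i))) ≫
        L.outerComp C (p.coarse d) :=
  C.sub_κ p d

theorem map_outerComp_homAct {a b : C.graph.carrier} (p : Chain a b) :
    T.map (L.outerComp C p) ≫ L.homAct C a b = L.freeAct (C.graph.homs p) ≫ L.outerComp C p := by
  obtain ⟨n, x, rfl, rfl⟩ := p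
  let p : Chain (x 0) (x (Fin.last n)) := ⟨n, x, rfl, rfl⟩
  let d := Subdivision.whole n
  let θ : (E.tensor n).obj (fun j => T.obj (C.graph.homs p j)) ⟶
      (E.tensor n).obj fun j => T.obj (C.graph.homs p (d.index 0 j)) :=
    E.tensor.tmap fun j => T.map (eqToHom
      (congrArg (C.graph.homs p) (Subdivision.index_whole n 0 j).symm))
  have hblock : T.map θ ≫ T.map (L.outerComp C (p.block d 0)) = T.map (L.outerComp C p) := by
    have hx : ((p.block d 0).pt : Fin (n + 1) → C.graph.carrier) = x := by
      funext j
      exact congrArg x (Fin.ext (Nat.zero_add _))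
    refine (T.map_comp _ _).symm.trans (congrArg T.map ?_)
    exact C.κ_congr hx.symm rfl rfl (p.block d 0).pt_zero (p.block d 0).pt_last _
  have hunit : T.map (L.outerComp C (p.block d 0)) ≫ L.homAct C (x 0) (x (Fin.last n)) =
      E.str.unit (fun i => T.obj ((E.tensor n).obj fun j =>
        T.obj (C.graph.homs p (d.index i j)))) ≫
        L.compositeSub d (C.graph.homs p) ≫ L.outerComp C p := by
    have hnat := E.str.unit_naturality fun i => T.map (L.outerComp C (p.block d i))
    refine (congrArg (_ ≫ ·) (L.homAct_eq_unit_outerComp C (p.coarse d).pt)).trans ?_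
    refine ((reassoc_of% hnat) _).trans (congrArg (E.str.unit _ ≫ ·) ?_)
    exact (L.compositeSub_outerComp C p d).symm
  refine (congrArg (· ≫ L.homAct C _ _) hblock.symm).trans ((Category.assoc _ _ _).trans ?_)
  refine (congrArg (T.map θ ≫ ·) hunit).trans ?_
  have hwhole := L.map_unit_compositeSub_whole (C.graph.homs p)
  refine (congrArg (T.map θ ≫ ·) (Category.assoc _ _ _).symm).trans ?_
  exact (Category.assoc _ _ _).symm.trans (congrArg (· ≫ L.outerComp C p) hwhole)

theorem tmap_homAct_eta_outerComp {a b : C.graph.carrier} (p : Chain a b) :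
    E.tensor.tmap (fun i => L.homAct C (p.pt i.castSucc) (p.pt i.succ) ≫
      T.η.app (C.graph.homs p i)) ≫ L.outerComp C p = L.outerComp C p := by
  let d := Subdivision.singles p.len
  have hact (i) : L.homAct C (p.pt i.castSucc) (p.pt i.succ) ≫ T.η.app (C.graph.homs p i) =
      (E.str.unit (fun j : Fin 1 => T.obj (C.graph.homs p (d.index i j))) ≫
        T.η.app ((E.tensor 1).obj fun j : Fin 1 => T.obj (C.graph.homs p (d.index i j)))) ≫
          T.map (L.outerComp C (p.block d i)) := by
    refine (congrArg (· ≫ _) (L.homAct_eq_unit_outerComp C (p.block d i).pt)).trans ?_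
    refine (Category.assoc _ _ _).trans (Eq.trans ?_ (Category.assoc _ _ _).symm)
    exact congrArg (E.str.unit _ ≫ ·) (T.η.naturality _)
  have hsub := L.compositeSub_outerComp C p d
  have hmid := L.tmap_unit_compositeSub_middle (C.graph.homs p)
  refine (congrArg (· ≫ L.outerComp C p) (E.tensor.tmap_congr hact)).trans ?_
  refine (E.tensor.tmap_comp_assoc _ _ _).symm.trans ?_
  refine (congrArg (E.tensor.tmap _ ≫ ·) hsub.symm).trans ((Category.assoc _ _ _).symm.trans ?_)
  exact (congrArg (· ≫ L.outerComp C p) hmid).trans (Category.id_comp _)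

theorem eta_homAct (a b : C.graph.carrier) :
    T.η.app (C.graph.hom a b) ≫ L.homAct C a b = 𝟙 _ :=
  (Category.assoc _ _ _).symm.trans (C.unit_κ a b)

theorem mu_homAct (a b : C.graph.carrier) :
    T.μ.app (C.graph.hom a b) ≫ L.homAct C a b = T.map (L.homAct C a b) ≫ L.homAct C a b := by
  have hfree := L.map_unit_freeAct (C.graph.homs (Chain.pair a b))
  refine ((reassoc_of% hfree) _).symm.trans ?_
  refine (congrArg (T.map _ ≫ ·) (L.map_outerComp_homAct C (Chain.pair a b)).symm).trans ?_
  exact (Category.assoc _ _ _).symm.trans (congrArg (· ≫ L.homAct C a b) (T.map_comp _ _).symm)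

/-- The homs of an `EM(T)`-category, as `T`-algebras. -/
def homAlgebra (a b : C.graph.carrier) : T.Algebra :=
  ⟨C.graph.hom a b, L.homAct C a b, L.eta_homAct C a b, L.mu_homAct C a b⟩

/-- The compositions of the `E`-category underlying an `EM(T)`-category. -/
def innerComp {a b : C.graph.carrier} (p : Chain a b) :
    (E.tensor p.len).obj (C.graph.homs p) ⟶ C.graph.hom a b :=
  E.tensor.tmap (fun i => T.η.app (C.graph.homs p i)) ≫ L.outerComp C p

theorem tmap_homAct_innerComp {a b : C.graph.carrier} (p : Chain a b) :
    E.tensor.tmap (fun i => L.homAct C (p.pt i.castSucc) (p.pt i.succ)) ≫ L.innerComp C p =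
      L.outerComp C p :=
  (E.tensor.tmap_comp_assoc _ _ _).trans (L.tmap_homAct_eta_outerComp C p)

theorem map_innerComp_homAct {a b : C.graph.carrier} (p : Chain a b) :
    T.map (L.innerComp C p) ≫ L.homAct C a b =
      L.act (fun i => L.homAlgebra C (p.pt i.castSucc) (p.pt i.succ)) ≫ L.innerComp C p := by
  have hact : L.act (fun i => L.homAlgebra C (p.pt i.castSucc) (p.pt i.succ)) =
    L.coherenceMap (C.graph.homs p) ≫
      E.tensor.tmap fun i => L.homAct C (p.pt i.castSucc) (p.pt i.succ) := L.act_eq _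
  have hcomp := L.tmap_homAct_innerComp C p
  refine Eq.trans ?_ ((congrArg (· ≫ _) hact).trans ((Category.assoc _ _ _).trans
    (congrArg (L.coherenceMap _ ≫ ·) hcomp))).symm
  rw [innerComp, T.map_comp, Category.assoc, map_outerComp_homAct, coherenceMap, Category.assoc]

theorem sub_innerComp {a b : C.graph.carrier} (p : Chain a b) {k : ℕ}
    (d : Subdivision p.len k) : E.str.sub d (C.graph.homs p) ≫ L.innerComp C p =
      E.tensor.tmap (fun i => L.innerComp C (p.block d i)) ≫ L.innerComp C (p.coarse d) := by
  have hsub := L.sub_tmap_eta d (C.graph.homs p)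
  refine ((reassoc_of% hsub) _).trans ?_
  rw [compositeSub_outerComp]
  refine Eq.trans ?_ (E.tensor.tmap_comp_assoc _ _ _).symm
  refine (congrArg (E.tensor.tmap _ ≫ ·) (E.tensor.tmap_comp_assoc _ _ _)).trans ?_
  refine (E.tensor.tmap_comp_assoc _ _ _).trans ?_
  refine congrArg (· ≫ L.outerComp C (p.coarse d)) (E.tensor.tmap_congr fun i => ?_)
  refine Eq.trans ?_ (Category.assoc _ _ _).symm
  exact congrArg (E.tensor.tmap _ ≫ ·) (T.η.naturality _).symm

/-- The `E'`-category determined by an `EM(T)`-category, for the lifting `E'` of `E`. -/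
def toLifted : MultitensorCat.{v, max u v, w} L.lifting.lift where
  graph := ⟨C.graph.carrier, fun a b => L.homAlgebra C a b⟩
  κ p := ⟨L.innerComp C p, L.map_innerComp_homAct C p⟩
  unit_κ a b := Monad.Algebra.Hom.ext <| by
    have hnat := E.str.unit_naturality fun i => T.η.app (C.graph.homs (Chain.pair a b) i)
    exact ((reassoc_of% hnat) _).symm.trans (L.eta_homAct C a b)
  sub_κ p _ d := Monad.Algebra.Hom.ext (L.sub_innerComp C p d)

end

end LiftedActions

theorem functor_eq_of_comp_faithful {A : Type*} [Category A] {B : Type*} [Category B] {D : Type*}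
    [Category D] {F G : A ⥤ B} (Φ : B ⥤ D) [Φ.Faithful] (hobj : ∀ X, F.obj X = G.obj X)
    (h : F ⋙ Φ = G ⋙ Φ) : F = G := by
  refine CategoryTheory.Functor.ext hobj fun X Y f => Φ.map_injective ?_
  simpa [eqToHom_map] using Functor.congr_hom h f

theorem algebra_mk_eq {T : Monad V} (A : T.Algebra) {a : T.obj A.A ⟶ A.A} (unit assoc)
    (h : a = A.a) : (⟨A.A, a, unit, assoc⟩ : T.Algebra) = A := by
  subst h
  rfl

theorem MultitensorCat.mk_eq_of_f {T : Monad V} {M : Multitensor T.Algebra} {S : Type w}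
    {h h' : S → S → T.Algebra} (hh : h = h')
    {κ : ∀ {a b : S} (p : Chain a b), (M.tensor p.len).obj
      ((⟨S, h⟩ : EnrichedGraph.{v, max u v, w} T.Algebra).homs p) ⟶ h a b}
    {κ' : ∀ {a b : S} (p : Chain a b), (M.tensor p.len).obj
      ((⟨S, h'⟩ : EnrichedGraph.{v, max u v, w} T.Algebra).homs p) ⟶ h' a b} (hu hs hu' hs')
    (hκ : ∀ {a b : S} (p : Chain a b), HEq (κ p).f (κ' p).f) :
    (⟨⟨S, h⟩, κ, hu, hs⟩ : MultitensorCat.{v, max u v, w} M) = ⟨⟨S, h'⟩, κ', hu', hs'⟩ := by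
  subst hh
  refine MultitensorCat.ext_κ rfl (heq_of_eq ?_)
  funext a b p
  exact Monad.Algebra.Hom.ext (eq_of_heq (hκ p))

namespace LiftedActions

variable {E : Multitensor V} {T : Monad V} (L : LiftedActions E T)

section

variable {C D : MultitensorCat.{v, u, w} L.composite.multitensor} (f : C ⟶ D)

theorem outerComp_map {a b : C.graph.carrier} (p : Chain a b) :
    L.outerComp C p ≫ f.toHom.map a b =
      E.tensor.tmap (fun i => T.map (f.toHom.map (p.pt i.castSucc) (p.pt i.succ))) ≫
        L.outerComp D (p.image f.toHom.obj) :=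
  f.κ_map p

theorem map_homAct (a b : C.graph.carrier) :
    T.map (f.toHom.map a b) ≫ L.homAct D (f.toHom.obj a) (f.toHom.obj b) =
      L.homAct C a b ≫ f.toHom.map a b := by
  have hnat := E.str.unit_naturality fun i : Fin 1 =>
    T.map (f.toHom.map ((Chain.pair a b).pt i.castSucc) ((Chain.pair a b).pt i.succ))
  have hpair := L.homAct_eq_unit_outerComp D ((Chain.pair a b).image f.toHom.obj).pt
  refine (congrArg (_ ≫ ·) hpair).trans (((reassoc_of% hnat) _).trans ?_)
  exact (congrArg (E.str.unit _ ≫ ·) (L.outerComp_map f (Chain.pair a b)).symm).trans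
    (Category.assoc _ _ _).symm

theorem innerComp_map {a b : C.graph.carrier} (p : Chain a b) :
    L.innerComp C p ≫ f.toHom.map a b =
      E.tensor.tmap (fun i => f.toHom.map (p.pt i.castSucc) (p.pt i.succ)) ≫
        L.innerComp D (p.image f.toHom.obj) := by
  have hη (i : Fin p.len) := T.η.naturality (f.toHom.map (p.pt i.castSucc) (p.pt i.succ))
  rw [innerComp, innerComp, Category.assoc, outerComp_map, E.tensor.tmap_comp_assoc,
    E.tensor.tmap_comp_assoc]
  exact congrArg (· ≫ _) (E.tensor.tmap_congr fun i => (hη i).symm)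

end

/-- The comparison functor from `EM(T)`-categories to `E'`-categories. -/
def toLiftedFunctor : MultitensorCat.{v, u, w} L.composite.multitensor ⥤
    MultitensorCat.{v, max u v, w} L.lifting.lift where
  obj C := L.toLifted C
  map f :=
    { toHom := ⟨f.toHom.obj, fun a b => ⟨f.toHom.map a b, L.map_homAct f a b⟩⟩
      κ_map := fun p => Monad.Algebra.Hom.ext (L.innerComp_map f p) }

section

variable (D : MultitensorCat.{v, max u v, w} L.lifting.lift)

/-- The compositions of an `E'`-category, as maps in `V`. -/
def liftedComp {a b : D.graph.carrier} (p : Chain a b) :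
    ((E.tensor p.len).obj fun i => (D.graph.homs p i).A) ⟶ (D.graph.hom a b).A :=
  (D.κ p).f

theorem unit_liftedComp (a b : D.graph.carrier) :
    E.str.unit (fun i => (D.graph.homs (Chain.pair a b) i).A) ≫ L.liftedComp D (Chain.pair a b) =
      𝟙 (D.graph.hom a b).A :=
  congrArg Monad.Algebra.Hom.f (D.unit_κ a b)

theorem sub_liftedComp {a b : D.graph.carrier} (p : Chain a b) {k : ℕ}
    (d : Subdivision p.len k) : E.str.sub d (fun i => (D.graph.homs p i).A) ≫ L.liftedComp D p =
      E.tensor.tmap (fun i => L.liftedComp D (p.block d i)) ≫ L.liftedComp D (p.coarse d) :=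
  congrArg Monad.Algebra.Hom.f (D.sub_κ p d)

theorem map_liftedComp {a b : D.graph.carrier} (p : Chain a b) :
    T.map (L.liftedComp D p) ≫ (D.graph.hom a b).a = L.act (D.graph.homs p) ≫ L.liftedComp D p :=
  (D.κ p).h

/-- The compositions over `EM(T)` of an `E'`-category: act by `T` on each hom, then compose. -/
def actThenComp {a b : D.graph.carrier} (p : Chain a b) :
    (E.tensor p.len).obj (fun i => T.obj (D.graph.homs p i).A) ⟶ (D.graph.hom a b).A :=
  E.tensor.tmap (fun i => (D.graph.homs p i).a) ≫ L.liftedComp D p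

theorem unit_actThenComp (a b : D.graph.carrier) :
    E.str.unit (fun i => T.obj (D.graph.homs (Chain.pair a b) i).A) ≫
      L.actThenComp D (Chain.pair a b) = (D.graph.hom a b).a := by
  rw [actThenComp, ← Category.assoc, ← E.str.unit_naturality, Category.assoc, unit_liftedComp]
  exact Category.comp_id _

theorem tmap_eta_actThenComp {a b : D.graph.carrier} (p : Chain a b) :
    E.tensor.tmap (fun i => T.η.app (D.graph.homs p i).A) ≫ L.actThenComp D p =
      L.liftedComp D p := by
  refine (E.tensor.tmap_comp_assoc _ _ _).trans ?_
  exact (congrArg (· ≫ L.liftedComp D p) ((E.tensor.tmap_congr fun i =>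
    (D.graph.homs p i).unit).trans (E.tensor.tmap_id _))).trans (Category.id_comp _)

theorem map_actThenComp {a b : D.graph.carrier} (p : Chain a b) :
    T.map (L.actThenComp D p) ≫ (D.graph.hom a b).a =
      L.freeAct (fun i => (D.graph.homs p i).A) ≫ L.actThenComp D p := by
  have hact : T.map (E.tensor.tmap fun i => (D.graph.homs p i).a) ≫ L.act (D.graph.homs p) =
      L.freeAct (fun i => (D.graph.homs p i).A) ≫ E.tensor.tmap fun i => (D.graph.homs p i).a :=
    L.act_naturality (X := fun i => T.free.obj (D.graph.homs p i).A) fun i =>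
      ⟨(D.graph.homs p i).a, (D.graph.homs p i).assoc.symm⟩
  rw [actThenComp, T.map_comp, Category.assoc, map_liftedComp, ← Category.assoc, hact,
    Category.assoc]

theorem compositeSub_actThenComp {a b : D.graph.carrier} (p : Chain a b) {k : ℕ}
    (d : Subdivision p.len k) :
    L.compositeSub d (fun s => (D.graph.homs p s).A) ≫ L.actThenComp D p =
      E.tensor.tmap (fun i => T.map (L.actThenComp D (p.block d i))) ≫
        L.actThenComp D (p.coarse d) := by
  have hsub := E.str.sub_naturality d fun s => (D.graph.homs p s).a
  rw [compositeSub, actThenComp, Category.assoc, ← reassoc_of% hsub, sub_liftedComp]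
  refine (congrArg (E.tensor.tmap _ ≫ ·) (E.tensor.tmap_comp_assoc _ _ _)).trans ?_
  refine (E.tensor.tmap_comp_assoc _ _ _).trans (Eq.trans ?_ (E.tensor.tmap_comp_assoc _ _ _).symm)
  exact congrArg (· ≫ L.liftedComp D (p.coarse d)) (E.tensor.tmap_congr fun i =>
    (L.map_actThenComp D (p.block d i)).symm)

/-- The `EM(T)`-category determined by an `E'`-category. -/
def ofLifted : MultitensorCat.{v, u, w} L.composite.multitensor where
  graph := ⟨D.graph.carrier, fun a b => (D.graph.hom a b).A⟩
  κ p := L.actThenComp D p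
  unit_κ a b := (Category.assoc _ _ _).trans
    ((congrArg (T.η.app _ ≫ ·) (L.unit_actThenComp D a b)).trans (D.graph.hom a b).unit)
  sub_κ p _ d := L.compositeSub_actThenComp D p d

end

theorem actThenComp_map {C D : MultitensorCat.{v, max u v, w} L.lifting.lift} (f : C ⟶ D)
    {a b : C.graph.carrier} (p : Chain a b) :
    L.actThenComp C p ≫ (f.toHom.map a b).f =
      E.tensor.tmap (fun i => T.map (f.toHom.map (p.pt i.castSucc) (p.pt i.succ)).f) ≫
        L.actThenComp D (p.image f.toHom.obj) := by
  have hcomp : L.liftedComp C p ≫ (f.toHom.map a b).f =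
      E.tensor.tmap (fun i => (f.toHom.map (p.pt i.castSucc) (p.pt i.succ)).f) ≫
        L.liftedComp D (p.image f.toHom.obj) := congrArg Monad.Algebra.Hom.f (f.κ_map p)
  rw [actThenComp, actThenComp, Category.assoc, hcomp, E.tensor.tmap_comp_assoc,
    E.tensor.tmap_comp_assoc]
  simp only [Monad.Algebra.Hom.h]

/-- The comparison functor from `E'`-categories to `EM(T)`-categories. -/
def ofLiftedFunctor : MultitensorCat.{v, max u v, w} L.lifting.lift ⥤
    MultitensorCat.{v, u, w} L.composite.multitensor where
  obj D := L.ofLifted D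
  map f :=
    { toHom := ⟨f.toHom.obj, fun a b => (f.toHom.map a b).f⟩
      κ_map := L.actThenComp_map f }

theorem toLifted_ofLifted (D : MultitensorCat.{v, max u v, w} L.lifting.lift) :
    L.toLifted (L.ofLifted D) = D :=
  MultitensorCat.mk_eq_of_f (funext fun a => funext fun b =>
      algebra_mk_eq _ _ _ (L.unit_actThenComp D a b))
    _ _ D.unit_κ D.sub_κ fun p => heq_of_eq (L.tmap_eta_actThenComp D p)

theorem ofLifted_toLifted (C : MultitensorCat.{v, u, w} L.composite.multitensor) :
    L.ofLifted (L.toLifted C) = C := by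
  refine MultitensorCat.ext_κ rfl (heq_of_eq ?_)
  funext a b p
  exact L.tmap_homAct_innerComp C p

theorem toLiftedFunctor_comp_ofLiftedFunctor :
    L.toLiftedFunctor ⋙ L.ofLiftedFunctor = 𝟭 (MultitensorCat.{v, u, w} L.composite.multitensor) :=
  functor_eq_of_comp_faithful (MultitensorCat.forget _) (fun C => L.ofLifted_toLifted C) rfl

theorem ofLiftedFunctor_comp_toLiftedFunctor : L.ofLiftedFunctor ⋙ L.toLiftedFunctor =
    𝟭 (MultitensorCat.{v, max u v, w} L.lifting.lift) :=
  functor_eq_of_comp_faithful (MultitensorCat.forget _ ⋙ EnrichedGraph.mapFunctor T.forget)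
    (fun D => L.toLifted_ofLifted D) rfl

end LiftedActions

/-! ### Distributive laws on graphs -/

theorem IsCoprod.isIso_of_unique {J : Type w} {A : J → V} {C : V} {inj : ∀ j, A j ⟶ C}
    (hc : IsCoprod inj) (j₀ : J) (h : ∀ j, j = j₀) : IsIso (inj j₀) := by
  obtain ⟨r, hr, _⟩ := hc (A j₀) fun j => eqToHom (congrArg A (h j))
  have inj_r : inj j₀ ≫ r = 𝟙 _ := hr j₀
  refine ⟨r, inj_r, hc.hom_ext fun j => ?_⟩
  obtain rfl := h j
  rw [← Category.assoc, inj_r, Category.id_comp, Category.comp_id]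

namespace EnrichedGraph

theorem Hom.eq_ofHoms {S : Type w} {A B : S → S → V}
    (f : (⟨S, A⟩ : EnrichedGraph.{v, u, w} V) ⟶ ⟨S, B⟩) (hf : ∀ a, f.obj a = a) :
    ∃ h, f = Hom.ofHoms h := by
  obtain ⟨o, m⟩ := f
  obtain rfl : o = fun a => a := funext hf
  exact ⟨m, rfl⟩

theorem Hom.map_eq {X Y : EnrichedGraph.{v, u, w} V} {o : X.carrier → Y.carrier}
    {m m' : ∀ a b, X.hom a b ⟶ Y.hom (o a) (o b)} (h : (⟨o, m⟩ : Hom X Y) = ⟨o, m'⟩)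
    (a b : X.carrier) : m a b = m' a b := by
  cases h
  rfl

theorem Hom.ext_map {X Y : EnrichedGraph.{v, u, w} V} {o : X.carrier → Y.carrier}
    {m m' : ∀ a b, X.hom a b ⟶ Y.hom (o a) (o b)} (h : ∀ a b, m a b = m' a b) :
    (⟨o, m⟩ : Hom X Y) = ⟨o, m'⟩ := by
  obtain rfl : m = m' := funext fun a => funext fun b => h a b
  rfl

end EnrichedGraph

/-- The sequence of consecutive homs along a chain of objects. -/
abbrev Chain.homs {S : Type w} {a b : S} (p : Chain a b) (A : S → S → V) : Fin p.len → V :=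
  fun i => A (p.pt i.castSucc) (p.pt i.succ)

namespace Gamma

variable [HasCoproducts.{w} V] {E : Multitensor V} {S R : Type w} {A B : S → S → V}
  {C : R → R → V} {a b : S}

/-- The hom of `Γ E` of the graph with homs `A`. Working with `A` rather than with a bundled graph
keeps the objects `a` and `b` in the fixed type `S` when `Γ E` is iterated. -/
noncomputable def hom (E : Multitensor V) (A : S → S → V) (a b : S) : V :=
  (onObj E ⟨S, A⟩).hom a b

/-- The map of `E_i Z_i` into a hom of `Γ E` given by maps of the `Z_i` into the consecutive homs
along a chain of objects. -/
noncomputable def injAlong (p : Chain a b) {Z : Fin p.len → V} (f : ∀ i, Z i ⟶ p.homs A i) :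
    (E.tensor p.len).obj Z ⟶ hom E A a b :=
  E.tensor.tmap f ≫ inj E ⟨S, A⟩ p

/-- The analogue of `injAlong` for `Γ E` iterated twice and a doubly nested sequence. -/
noncomputable def injAlong₂ (p : Chain a b) {k : ℕ} (d : Subdivision p.len k) {Z : Fin p.len → V}
    (f : ∀ s, Z s ⟶ p.homs A s) :
    (E.tensor k).obj (fun i => (E.tensor (d.len i)).obj fun j => Z (d.index i j)) ⟶
      hom E (hom E A) a b :=
  injAlong (p.coarse d) fun i => injAlong (p.block d i) fun j => f (d.index i j)

/-- The hom maps of `Γ E` applied to a morphism of graphs. -/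
noncomputable def map (E : Multitensor V) (o : S → R) (m : ∀ a b, A a b ⟶ C (o a) (o b)) (a b : S) :
    hom E A a b ⟶ hom E C (o a) (o b) :=
  (onMap E (X := ⟨S, A⟩) (Y := ⟨R, C⟩) ⟨o, m⟩).map a b

/-- The hom maps of `Γ E` applied to an identity-on-objects morphism of graphs. -/
noncomputable def mapHoms (E : Multitensor V) (m : ∀ a b, A a b ⟶ B a b) (a b : S) :
    hom E A a b ⟶ hom E B a b :=
  map E (fun a => a) m a b

/-- The hom maps of the multiplication of `Γ E`. -/
noncomputable def mult (hE : Multitensor.IsDistributive.{v, u, w} E) (A : S → S → V) (a b : S) :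
    hom E (hom E A) a b ⟶ hom E A a b :=
  mulHom hE ⟨S, A⟩ a b

theorem injAlong_id (p : Chain a b) :
    (injAlong p fun i => 𝟙 (p.homs A i)) = inj E ⟨S, A⟩ p :=
  (congrArg (· ≫ inj E ⟨S, A⟩ p) (E.tensor.tmap_id _)).trans (Category.id_comp _)

theorem isCoprod_injAlong (E : Multitensor V) (A : S → S → V) (a b : S) :
    IsCoprod fun p : Chain a b => injAlong (E := E) p fun i => 𝟙 (p.homs A i) :=
  (congrArg IsCoprod (funext fun p => injAlong_id p)).mpr (isCoprod_inj E ⟨S, A⟩ a b)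

theorem isCoprod_injAlong₂ (hE : Multitensor.IsDistributive.{v, u, w} E) (A : S → S → V)
    (a b : S) : IsCoprod fun t : Chain.Divided a b =>
      injAlong₂ (E := E) t.1 t.2.2 fun s => 𝟙 (t.1.homs A s) := by
  refine (congrArg IsCoprod (funext fun t => ?_)).mpr (isCoprod_inj₂ hE ⟨S, A⟩ a b)
  exact congrArg (injAlong (t.1.coarse t.2.2)) (funext fun i => injAlong_id (t.1.block t.2.2 i))

theorem tmap_injAlong (p : Chain a b) {Z Z' : Fin p.len → V} (g : ∀ i, Z' i ⟶ Z i)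
    (f : ∀ i, Z i ⟶ p.homs A i) :
    E.tensor.tmap g ≫ injAlong p f = injAlong p fun i => g i ≫ f i :=
  E.tensor.tmap_comp_assoc _ _ _

theorem injAlong_map (o : S → R) (m : ∀ a b, A a b ⟶ C (o a) (o b)) (p : Chain a b)
    {Z : Fin p.len → V} (f : ∀ i, Z i ⟶ p.homs A i) :
    injAlong p f ≫ map E o m a b = injAlong (p.image o) fun i => f i ≫ m _ _ := by
  refine (Category.assoc _ _ _).trans ((congrArg (E.tensor.tmap f ≫ ·) ?_).trans
    (tmap_injAlong (p.image o) f fun i => m (p.pt i.castSucc) (p.pt i.succ)))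
  exact inj_onMap E (X := ⟨S, A⟩) (Y := ⟨R, C⟩) ⟨o, m⟩ p

theorem injAlong_mapHoms (m : ∀ a b, A a b ⟶ B a b) (p : Chain a b) {Z : Fin p.len → V}
    (f : ∀ i, Z i ⟶ p.homs A i) :
    injAlong p f ≫ mapHoms E m a b = injAlong p fun i => f i ≫ m _ _ :=
  injAlong_map (fun a => a) m p f

theorem injAlong₂_mult (hE : Multitensor.IsDistributive.{v, u, w} E) (p : Chain a b) {k : ℕ}
    (d : Subdivision p.len k) {Z : Fin p.len → V} (f : ∀ s, Z s ⟶ p.homs A s) :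
    injAlong₂ p d f ≫ mult hE A a b = E.str.sub d Z ≫ injAlong p f := by
  have factor : injAlong₂ p d f =
      E.tensor.tmap (fun i => E.tensor.tmap fun j => f (d.index i j)) ≫ inj₂ E ⟨S, A⟩ p d :=
    (E.tensor.tmap_comp_assoc _ _ _).symm
  refine (congrArg (· ≫ mult hE A a b) factor).trans ((Category.assoc _ _ _).trans ?_)
  refine (congrArg (E.tensor.tmap _ ≫ ·) (inj₂_mul hE ⟨S, A⟩ p d)).trans ?_
  exact (reassoc_of% E.str.sub_naturality d f) _

end Gamma

/-- Families of maps of the type of coherence maps `T E_i X_i ⟶ E_i T X_i`, with no condition. -/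
abbrev CoherenceMaps (E : Multitensor V) (T : Monad V) :=
  ∀ (n : ℕ) (X : Fin n → V), T.obj ((E.tensor n).obj X) ⟶ (E.tensor n).obj fun i => T.obj (X i)

/-- Families of maps of the type of the hom maps of an identity-on-objects distributive law of `Γ E`
over `G T`, with no condition. -/
abbrev LawMaps [HasCoproducts.{w} V] (E : Multitensor V) (T : Monad V) :=
  ∀ (S : Type w) (A : S → S → V) (a b : S),
    T.obj (Gamma.hom E A a b) ⟶ Gamma.hom E (fun a b => T.obj (A a b)) a b

/-- The relation between coherence maps `τ` and the hom maps `l` of a distributive law. It includes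
the naturality of `τ`, as it refers to `injAlong` rather than to the coproduct inclusions. -/
def Corresponds [HasCoproducts.{w} V] {E : Multitensor V} {T : Monad V} (τ : CoherenceMaps E T)
    (l : LawMaps.{v, u, w} E T) : Prop :=
  ∀ ⦃S : Type w⦄ ⦃A : S → S → V⦄ ⦃a b : S⦄ (p : Chain a b) ⦃X : Fin p.len → V⦄
    (f : ∀ i, X i ⟶ p.homs A i), T.map (Gamma.injAlong p f) ≫ l S A a b =
      τ p.len X ≫ Gamma.injAlong (A := fun a b => T.obj (A a b)) p fun i => T.map (f i)

namespace Corresponds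

variable [HasCoproducts.{w} V] {E : Multitensor V} {T : Monad V} {τ : CoherenceMaps E T}
  {l : LawMaps.{v, u, w} E T} (h : Corresponds τ l) {S R : Type w} {A : S → S → V}
  {C : R → R → V} {a b : S} (p : Chain a b) {X : Fin p.len → V} (f : ∀ i, X i ⟶ p.homs A i)

include h

theorem map_injAlong_naturality (o : S → R) (m : ∀ a b, A a b ⟶ C (o a) (o b)) :
    T.map (Gamma.injAlong p f) ≫ T.map (Gamma.map E o m a b) ≫ l R C (o a) (o b) =
      T.map (Gamma.injAlong p f) ≫ l S A a b ≫
        Gamma.map E o (C := fun a b => T.obj (C a b)) (fun a b => T.map (m a b)) a b := by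
  rw [← T.map_comp_assoc, Gamma.injAlong_map, h (p.image o), reassoc_of% h p f,
    Gamma.injAlong_map]
  simp only [T.map_comp]

theorem injAlong_eta :
    Gamma.injAlong p f ≫ T.η.app (Gamma.hom E A a b) ≫ l S A a b =
      (T.η.app _ ≫ τ p.len X) ≫
        Gamma.injAlong (A := fun a b => T.obj (A a b)) p fun i => T.map (f i) := by
  rw [Category.assoc, ← h p f]
  exact T.η.naturality_assoc _ _

theorem map_map_injAlong_mu :
    T.map (T.map (Gamma.injAlong p f)) ≫ T.μ.app (Gamma.hom E A a b) ≫ l S A a b =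
      (T.μ.app _ ≫ τ p.len X) ≫
        Gamma.injAlong (A := fun a b => T.obj (A a b)) p fun i => T.map (f i) := by
  rw [T.mu_naturality_assoc, h p f, Category.assoc]

theorem map_map_injAlong_comp_mu :
    T.map (T.map (Gamma.injAlong p f)) ≫ T.map (l S A a b) ≫ l S (fun a b => T.obj (A a b)) a b ≫
        Gamma.mapHoms E (fun a b => T.μ.app (A a b)) a b =
      (T.map (τ p.len X) ≫ τ p.len (fun i => T.obj (X i)) ≫
        E.tensor.tmap fun i => T.μ.app (X i)) ≫
          Gamma.injAlong (A := fun a b => T.obj (A a b)) p fun i => T.map (f i) := by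
  rw [← T.map_comp_assoc, h p f, T.map_comp_assoc, reassoc_of% h (A := fun a b => T.obj (A a b)),
    Gamma.injAlong_mapHoms, Category.assoc, Category.assoc, Gamma.tmap_injAlong]
  simp only [T.mu_naturality]

theorem map_injAlong₂_mult (hE : Multitensor.IsDistributive.{v, u, w} E) {k : ℕ}
    (d : Subdivision p.len k) :
    T.map (Gamma.injAlong₂ p d f) ≫ T.map (Gamma.mult hE A a b) ≫ l S A a b =
      (T.map (E.str.sub d X) ≫ τ p.len X) ≫
        Gamma.injAlong (A := fun a b => T.obj (A a b)) p fun i => T.map (f i) := by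
  rw [← T.map_comp_assoc, Gamma.injAlong₂_mult, T.map_comp_assoc, h p f, Category.assoc]

theorem map_injAlong₂_comp_mult (hE : Multitensor.IsDistributive.{v, u, w} E) {k : ℕ}
    (d : Subdivision p.len k) :
    T.map (Gamma.injAlong₂ p d f) ≫ l S (Gamma.hom E A) a b ≫
        Gamma.mapHoms E (l S A) a b ≫ Gamma.mult hE (fun a b => T.obj (A a b)) a b =
      (τ k (fun i => (E.tensor (d.len i)).obj fun j => X (d.index i j)) ≫
        E.tensor.tmap (fun i => τ (d.len i) fun j => X (d.index i j)) ≫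
          E.str.sub d fun s => T.obj (X s)) ≫
            Gamma.injAlong (A := fun a b => T.obj (A a b)) p fun i => T.map (f i) := by
  have inner : Gamma.injAlong (p.coarse d)
        (fun i => T.map (Gamma.injAlong (p.block d i) fun j => f (d.index i j)) ≫ l S A _ _) =
      E.tensor.tmap (fun i => τ (d.len i) fun j => X (d.index i j)) ≫
        Gamma.injAlong₂ (A := fun a b => T.obj (A a b)) p d fun s => T.map (f s) := by
    refine Eq.trans ?_ (Gamma.tmap_injAlong (p.coarse d) _ _).symm
    exact congrArg (Gamma.injAlong (p.coarse d)) (funext fun i => h (p.block d i) _)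
  rw [Gamma.injAlong₂, reassoc_of% h (p.coarse d), reassoc_of% Gamma.injAlong_mapHoms, inner,
    Category.assoc, Gamma.injAlong₂_mult]
  simp only [Category.assoc]

end Corresponds

end

namespace Chain

/-- The vertices of the linear graph with `n` edges. -/
abbrev Vertex (n : ℕ) := ULift.{w} (Fin (n + 1))

/-- The edges of the linear graph with `n` edges from `i` to `j`: there is at most one. -/
abbrev Edge {n : ℕ} (i j : Vertex.{w} n) : Type w :=
  ULift.{w} { s : Fin n // s.castSucc = i.down ∧ s.succ = j.down }

/-- The sequence of all vertices of the linear graph. -/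
abbrev standard (n : ℕ) : Chain (S := Vertex.{w} n) ⟨0⟩ ⟨Fin.last n⟩ where
  len := n
  pt := ULift.up
  pt_zero := rfl
  pt_last := rfl

/-- The edge with a given number. -/
abbrev edge {n : ℕ} (s : Fin n) :
    Edge.{w} ((standard n).pt s.castSucc) ((standard n).pt s.succ) :=
  ⟨s, rfl, rfl⟩

theorem eq_standard {n : ℕ} (y : Σ p : Chain (S := Vertex.{w} n) ⟨0⟩ ⟨Fin.last n⟩,
      ∀ i : Fin p.len, Edge.{w} (p.pt i.castSucc) (p.pt i.succ)) :
    y = ⟨standard n, fun s => edge s⟩ := by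
  obtain ⟨⟨m, f, h_zero, h_last⟩, e⟩ := y
  have f_val : ∀ j : Fin (m + 1), ((f j).down : ℕ) = j := by
    intro j
    induction j using Fin.induction with
    | zero => rw [h_zero]; rfl
    | succ i ih =>
      have source := congrArg Fin.val (e i).down.2.1
      have target := congrArg Fin.val (e i).down.2.2
      simp only [Fin.val_castSucc, Fin.val_succ] at source target ih ⊢
      omega
  have len_eq := f_val (Fin.last m)
  rw [h_last] at len_eq
  obtain rfl : n = m := len_eq
  obtain rfl : f = ULift.up := funext fun j => ULift.ext _ _ (Fin.ext (f_val j))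
  congr 1
  funext i
  exact ULift.ext _ _ (Subtype.ext (Fin.castSucc_injective _ (e i).down.2.1))

end Chain

section

variable {V : Type u} [Category.{v} V] [HasCoproducts.{w} V] {E : Multitensor V} {T : Monad V}

namespace Gamma

variable {S : Type w} {A : S → S → V} {a b : S}

/-- The hom maps of the unit of `Γ E`. -/
noncomputable def unitMap (E : Multitensor V) (A : S → S → V) (a b : S) :
    A a b ⟶ hom E A a b :=
  unitHom E ⟨S, A⟩ a b

theorem unit_injAlong (pt : Fin 2 → S) {Z : Fin 1 → V}
    (f : ∀ i : Fin 1, Z i ⟶ A (pt i.castSucc) (pt i.succ)) :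
    E.str.unit Z ≫ injAlong (⟨1, pt, rfl, rfl⟩ : Chain (pt 0) (pt (Fin.last 1))) f =
      f 0 ≫ unitMap E A (pt 0) (pt (Fin.last 1)) := by
  have pt_eq : pt = (Chain.pair (pt 0) (pt (Fin.last 1))).pt :=
    funext fun i => Fin.cases rfl (fun j => Fin.cases rfl (fun j => j.elim0) j) i
  have unit_inj := eq_of_heq (unit_inj_congr (E := E) ⟨S, A⟩ pt_eq rfl rfl rfl rfl)
  refine Eq.trans ?_ (congrArg (f 0 ≫ ·) unit_inj)
  exact (reassoc_of% E.str.unit_naturality f) _ |>.symm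

end Gamma

/-- The homs of the linear graph whose edges are labelled by the entries of a sequence: those
between consecutive vertices are the entries, and the others are initial. -/
noncomputable def seqHoms {n : ℕ} (X : Fin n → V) (i j : Chain.Vertex.{w} n) : V :=
  ∐ fun x : Chain.Edge i j => X x.down.1

namespace seqHoms

variable {n : ℕ} (X : Fin n → V)

/-- The inclusion of the entries into the homs of the linear graph. -/
noncomputable def incl {i j : Chain.Vertex.{w} n} (x : Chain.Edge i j) :
    X x.down.1 ⟶ seqHoms X i j :=
  Sigma.ι (fun x : Chain.Edge i j => X x.down.1) x

theorem isCoprod_incl (i j : Chain.Vertex.{w} n) :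
    IsCoprod fun x : Chain.Edge i j => incl X x :=
  IsCoprod.sigma _

variable {X} {S : Type w} {A : S → S → V} (pt : Fin (n + 1) → S)
  (f : ∀ s : Fin n, X s ⟶ A (pt s.castSucc) (pt s.succ))

/-- The hom maps of the morphism of graphs that sends the linear graph to a given path. -/
noncomputable def desc (i j : Chain.Vertex.{w} n) : seqHoms X i j ⟶ A (pt i.down) (pt j.down) :=
  Sigma.desc fun x => f x.down.1 ≫
    eqToHom (congrArg₂ (fun a b => A (pt a) (pt b)) x.down.2.1 x.down.2.2)

theorem incl_desc (s : Fin n) : incl X (Chain.edge.{w} s) ≫ desc pt f _ _ = f s :=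
  (Sigma.ι_desc _ _).trans (Category.comp_id _)

end seqHoms

theorem isIso_injAlong_standard (hE : Multitensor.IsDistributive.{v, u, w} E) {n : ℕ}
    {X : Fin n → V} {A : Chain.Vertex.{w} n → Chain.Vertex.{w} n → V}
    (q : ∀ {i j} (x : Chain.Edge.{w} i j), X x.down.1 ⟶ A i j)
    (hq : ∀ i j, IsCoprod (q (i := i) (j := j))) :
    IsIso (Gamma.injAlong (E := E) (Chain.standard n) fun s => q (Chain.edge.{w} s)) :=
  ((Gamma.isCoprod_inj E ⟨_, A⟩ ⟨0⟩ ⟨Fin.last n⟩).trans fun p =>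
    isCoprod_multi (E.tensor p.len) (preservesInEach_of_slot _ (hE p.len))
      (fun (i : Fin p.len) (x : Chain.Edge (p.pt i.castSucc) (p.pt i.succ)) => q x)
      fun _ => hq _ _).isIso_of_unique ⟨Chain.standard n, fun s => Chain.edge s⟩ Chain.eq_standard

/-- The inclusion of `E_i X_i` as a hom of `Γ E` of a linear graph. -/
noncomputable abbrev seqInj (E : Multitensor V) {n : ℕ} (X : Fin n → V) :
    (E.tensor n).obj X ⟶ Gamma.hom E (seqHoms.{v, u, w} X) ⟨0⟩ ⟨Fin.last n⟩ :=
  Gamma.injAlong (Chain.standard n) fun s => seqHoms.incl X (Chain.edge.{w} s)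

/-- The inclusion of `E_i T X_i` as a hom of `Γ E` of a linear graph to whose homs `T` has been
applied. -/
noncomputable abbrev seqMapInj (E : Multitensor V) (T : Monad V) {n : ℕ} (X : Fin n → V) :
    (E.tensor n).obj (fun i => T.obj (X i)) ⟶
      Gamma.hom E (fun i j => T.obj (seqHoms.{v, u, w} X i j)) ⟨0⟩ ⟨Fin.last n⟩ :=
  Gamma.injAlong (Chain.standard n) fun s => T.map (seqHoms.incl X (Chain.edge.{w} s))

theorem isIso_seqMapInj (hE : Multitensor.IsDistributive.{v, u, w} E)
    (hT : ∀ J : Type w, PreservesColimitsOfShape (Discrete J) T.toFunctor) {n : ℕ}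
    (X : Fin n → V) : IsIso (seqMapInj.{v, u, w} E T X) :=
  isIso_injAlong_standard hE (X := fun i => T.obj (X i)) (fun x => T.map (seqHoms.incl X x))
    fun i j =>
      haveI := hT (Chain.Edge.{w} i j)
      (seqHoms.isCoprod_incl X i j).map T.toFunctor

theorem eq_of_comp_seqMapInj (hE : Multitensor.IsDistributive.{v, u, w} E)
    (hT : ∀ J : Type w, PreservesColimitsOfShape (Discrete J) T.toFunctor) {n : ℕ}
    {X : Fin n → V} {Z : V} {f g : Z ⟶ (E.tensor n).obj fun i => T.obj (X i)}
    (h : f ≫ seqMapInj.{v, u, w} E T X = g ≫ seqMapInj.{v, u, w} E T X) : f = g :=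
  haveI := isIso_seqMapInj.{v, u, w} hE hT X
  (cancel_mono _).1 h

namespace Corresponds

variable {τ τ' : CoherenceMaps E T} {l l' : LawMaps.{v, u, w} E T}

theorem coherenceMaps_unique (hE : Multitensor.IsDistributive.{v, u, w} E)
    (hT : ∀ J : Type w, PreservesColimitsOfShape (Discrete J) T.toFunctor)
    (h : Corresponds τ l) (h' : Corresponds τ' l) : τ = τ' :=
  funext fun n => funext fun _ => eq_of_comp_seqMapInj hE hT
    ((h (Chain.standard n) _).symm.trans (h' (Chain.standard n) _))

theorem lawMaps_unique
    (hT : ∀ J : Type w, PreservesColimitsOfShape (Discrete J) T.toFunctor)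
    (h : Corresponds τ l) (h' : Corresponds τ l') : l = l' := by
  funext S A a b
  have := hT (Chain a b)
  exact ((Gamma.isCoprod_injAlong E A a b).map T.toFunctor).hom_ext fun p =>
    (h p _).trans (h' p _).symm

end Corresponds

namespace Gamma

variable {S : Type w} {A : S → S → V} {a b : S} (p : Chain a b) {X : Fin p.len → V}
  (f : ∀ i, X i ⟶ p.homs A i)

theorem injAlong_mapHoms_eta :
    injAlong p f ≫ mapHoms E (fun a b => T.η.app (A a b)) a b =
      E.tensor.tmap (fun i => T.η.app (X i)) ≫
        injAlong (A := fun a b => T.obj (A a b)) p fun i => T.map (f i) := by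
  rw [injAlong_mapHoms, tmap_injAlong]
  exact congrArg (injAlong p) (funext fun i => T.η.naturality (f i))

end Gamma

namespace Corresponds

variable (hE : Multitensor.IsDistributive.{v, u, w} E)
  (hT : ∀ J : Type w, PreservesColimitsOfShape (Discrete J) T.toFunctor)
  {τ : CoherenceMaps E T} {l : LawMaps.{v, u, w} E T} (h : Corresponds τ l)

include h

theorem map_unitMap {S : Type w} {A : S → S → V} (pt : Fin 2 → S) {X : Fin 1 → V}
    (f : ∀ i : Fin 1, X i ⟶ A (pt i.castSucc) (pt i.succ)) :
    T.map (f 0) ≫ T.map (Gamma.unitMap E A (pt 0) (pt (Fin.last 1))) ≫ l S A _ _ =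
      (T.map (E.str.unit X) ≫ τ 1 X) ≫
        Gamma.injAlong (A := fun a b => T.obj (A a b))
          (⟨1, pt, rfl, rfl⟩ : Chain (pt 0) (pt (Fin.last 1))) fun i => T.map (f i) := by
  rw [Category.assoc, ← h ⟨1, pt, rfl, rfl⟩ f, ← T.map_comp_assoc, ← T.map_comp_assoc,
    Gamma.unit_injAlong]

include hE hT

theorem unit_iff :
    (∀ X : Fin 1 → V, T.map (E.str.unit X) ≫ τ 1 X = E.str.unit fun i => T.obj (X i)) ↔
      ∀ (S : Type w) (A : S → S → V) (a b : S), T.map (Gamma.unitMap E A a b) ≫ l S A a b =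
        Gamma.unitMap E (fun a b => T.obj (A a b)) a b := by
  constructor
  · intro hτ S A a b
    have key := h.map_unitMap (A := A) (Chain.pair a b).pt fun _ => 𝟙 _
    rw [hτ, Gamma.unit_injAlong] at key
    simp only [T.map_id, Category.id_comp] at key
    exact key
  · intro hl X
    refine eq_of_comp_seqMapInj hE hT ?_
    refine (h.map_unitMap ULift.up fun s => seqHoms.incl X (Chain.edge.{w} s)).symm.trans ?_
    rw [hl]
    exact (Gamma.unit_injAlong (Z := fun i => T.obj (X i))
      (A := fun i j => T.obj (seqHoms.{v, u, w} X i j)) ULift.up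
        fun s => T.map (seqHoms.incl X (Chain.edge.{w} s))).symm

theorem eta_iff :
    (∀ (n : ℕ) (X : Fin n → V), T.η.app _ ≫ τ n X = E.tensor.tmap fun i => T.η.app (X i)) ↔
      ∀ (S : Type w) (A : S → S → V) (a b : S),
        T.η.app (Gamma.hom E A a b) ≫ l S A a b =
          Gamma.mapHoms E (fun a b => T.η.app (A a b)) a b := by
  constructor
  · intro hτ S A a b
    refine (Gamma.isCoprod_injAlong E A a b).hom_ext fun p => ?_
    rw [h.injAlong_eta, hτ, Gamma.injAlong_mapHoms_eta]
  · intro hl n X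
    refine eq_of_comp_seqMapInj hE hT ?_
    exact (h.injAlong_eta (Chain.standard n) _).symm.trans
      ((congrArg (seqInj.{v, u, w} E X ≫ ·) (hl _ _ _ _)).trans
        (Gamma.injAlong_mapHoms_eta (Chain.standard n) _))

theorem mu_iff :
    (∀ (n : ℕ) (X : Fin n → V), T.μ.app _ ≫ τ n X =
        T.map (τ n X) ≫ τ n (fun i => T.obj (X i)) ≫ E.tensor.tmap fun i => T.μ.app (X i)) ↔
      ∀ (S : Type w) (A : S → S → V) (a b : S), T.μ.app (Gamma.hom E A a b) ≫ l S A a b =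
        T.map (l S A a b) ≫ l S (fun a b => T.obj (A a b)) a b ≫
          Gamma.mapHoms E (fun a b => T.μ.app (A a b)) a b := by
  constructor
  · intro hτ S A a b
    have := hT (Chain a b)
    refine (((Gamma.isCoprod_injAlong E A a b).map T.toFunctor).map T.toFunctor).hom_ext
      fun p => ?_
    rw [h.map_map_injAlong_mu, hτ, h.map_map_injAlong_comp_mu]
  · intro hl n X
    refine eq_of_comp_seqMapInj hE hT ?_
    exact (h.map_map_injAlong_mu (Chain.standard n) _).symm.trans
      ((congrArg (T.map (T.map (seqInj.{v, u, w} E X)) ≫ ·) (hl _ _ _ _)).trans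
        (h.map_map_injAlong_comp_mu (Chain.standard n) _))

theorem sub_iff :
    (∀ (N k : ℕ) (d : Subdivision N k) (X : Fin N → V), T.map (E.str.sub d X) ≫ τ N X =
        τ k (fun i => (E.tensor (d.len i)).obj fun j => X (d.index i j)) ≫
          E.tensor.tmap (fun i => τ (d.len i) fun j => X (d.index i j)) ≫
            E.str.sub d fun s => T.obj (X s)) ↔
      ∀ (S : Type w) (A : S → S → V) (a b : S), T.map (Gamma.mult hE A a b) ≫ l S A a b =
        l S (Gamma.hom E A) a b ≫ Gamma.mapHoms E (l S A) a b ≫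
          Gamma.mult hE (fun a b => T.obj (A a b)) a b := by
  constructor
  · intro hτ S A a b
    have := hT (Chain.Divided a b)
    refine ((Gamma.isCoprod_injAlong₂ hE A a b).map T.toFunctor).hom_ext fun t => ?_
    rw [h.map_injAlong₂_mult, hτ, h.map_injAlong₂_comp_mult]
  · intro hl N k d X
    refine eq_of_comp_seqMapInj hE hT ?_
    exact (h.map_injAlong₂_mult (Chain.standard N) _ hE d).symm.trans
      ((congrArg (T.map (Gamma.injAlong₂ (Chain.standard N) d _) ≫ ·) (hl _ _ _ _)).trans
        (h.map_injAlong₂_comp_mult (Chain.standard N) _ hE d))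

end Corresponds

theorem seqInj_map_desc {S : Type w} {A : S → S → V} {n : ℕ} {X : Fin n → V}
    (pt : Fin (n + 1) → S) (f : ∀ s : Fin n, X s ⟶ A (pt s.castSucc) (pt s.succ)) :
    seqInj.{v, u, w} E X ≫ Gamma.map E (fun i => pt i.down) (seqHoms.desc pt f) _ _ =
      Gamma.injAlong (⟨n, pt, rfl, rfl⟩ : Chain (pt 0) (pt (Fin.last n))) f :=
  (Gamma.injAlong_map _ _ _ _).trans
    (congrArg (Gamma.injAlong _) (funext fun s => seqHoms.incl_desc pt f s))

theorem seqMapInj_map_desc {S : Type w} {A : S → S → V} {n : ℕ} {X : Fin n → V}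
    (pt : Fin (n + 1) → S) (f : ∀ s : Fin n, X s ⟶ A (pt s.castSucc) (pt s.succ)) :
    seqMapInj.{v, u, w} E T X ≫ Gamma.map E (C := fun a b => T.obj (A a b)) (fun i => pt i.down)
        (fun i j => T.map (seqHoms.desc pt f i j)) _ _ =
      Gamma.injAlong (A := fun a b => T.obj (A a b))
        (⟨n, pt, rfl, rfl⟩ : Chain (pt 0) (pt (Fin.last n))) fun s => T.map (f s) :=
  (Gamma.injAlong_map _ _ _ _).trans (congrArg (Gamma.injAlong _) (funext fun s =>
    (T.map_comp _ _).symm.trans (congrArg T.map (seqHoms.incl_desc pt f s))))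

namespace LawMaps

/-- Naturality in the graph of the morphisms with given hom maps. -/
def IsNatural (l : LawMaps.{v, u, w} E T) : Prop :=
  ∀ ⦃S R : Type w⦄ ⦃A : S → S → V⦄ ⦃C : R → R → V⦄ (o : S → R)
    (m : ∀ a b, A a b ⟶ C (o a) (o b)) (a b : S),
    T.map (Gamma.map E o m a b) ≫ l R C (o a) (o b) =
      l S A a b ≫ Gamma.map E o (C := fun a b => T.obj (C a b)) (fun a b => T.map (m a b)) a b

variable (hE : Multitensor.IsDistributive.{v, u, w} E)
  (hT : ∀ J : Type w, PreservesColimitsOfShape (Discrete J) T.toFunctor)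
  (l : LawMaps.{v, u, w} E T)

/-- The coherence maps that correspond to a natural family of hom maps, read off on linear
graphs. -/
noncomputable def coherenceMaps : CoherenceMaps E T := fun _ X =>
  haveI := isIso_seqMapInj.{v, u, w} hE hT X
  T.map (seqInj.{v, u, w} E X) ≫ l _ (seqHoms X) _ _ ≫ inv (seqMapInj.{v, u, w} E T X)

theorem coherenceMaps_seqMapInj {n : ℕ} (X : Fin n → V) :
    l.coherenceMaps hE hT n X ≫ seqMapInj.{v, u, w} E T X =
      T.map (seqInj.{v, u, w} E X) ≫ l _ (seqHoms X) _ _ := by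
  have := isIso_seqMapInj.{v, u, w} hE hT X
  rw [coherenceMaps, Category.assoc, Category.assoc, IsIso.inv_hom_id, Category.comp_id]

variable {l}

theorem IsNatural.corresponds (hl : l.IsNatural) : Corresponds (l.coherenceMaps hE hT) l := by
  intro S A a b p X f
  obtain ⟨n, pt, rfl, rfl⟩ := p
  rw [← seqInj_map_desc pt f, T.map_comp_assoc, hl, ← reassoc_of% l.coherenceMaps_seqMapInj hE hT X]
  exact congrArg (l.coherenceMaps hE hT n X ≫ ·) (seqMapInj_map_desc pt f)

end LawMaps

namespace Corresponds

variable {τ : CoherenceMaps E T} {l : LawMaps.{v, u, w} E T} (h : Corresponds τ l)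

include h

theorem isNatural (hT : ∀ J : Type w, PreservesColimitsOfShape (Discrete J) T.toFunctor) :
    l.IsNatural := by
  intro S R A C o m a b
  have := hT (Chain a b)
  exact ((Gamma.isCoprod_injAlong E A a b).map T.toFunctor).hom_ext fun p =>
    h.map_injAlong_naturality p _ o m

theorem naturality (hE : Multitensor.IsDistributive.{v, u, w} E)
    (hT : ∀ J : Type w, PreservesColimitsOfShape (Discrete J) T.toFunctor) {n : ℕ}
    {X Y : Fin n → V} (f : ∀ i, X i ⟶ Y i) :
    T.map (E.tensor.tmap f) ≫ τ n Y = τ n X ≫ E.tensor.tmap fun i => T.map (f i) := by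
  refine eq_of_comp_seqMapInj hE hT ?_
  have at_Y := h (Chain.standard n) fun s => seqHoms.incl Y (Chain.edge.{w} s)
  have at_X := h (Chain.standard n) fun s => f s ≫ seqHoms.incl Y (Chain.edge.{w} s)
  rw [← Gamma.tmap_injAlong (Chain.standard n), T.map_comp_assoc, at_Y] at at_X
  simp only [T.map_comp, ← Gamma.tmap_injAlong (Chain.standard n)] at at_X
  simpa only [Category.assoc] using at_X

end Corresponds

namespace OpmonoidalCoherence

variable (c : OpmonoidalCoherence E T)
  (hT : ∀ J : Type w, PreservesColimitsOfShape (Discrete J) T.toFunctor)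

/-- The coherence maps of `c`, with the length of sequences explicit. -/
def maps : CoherenceMaps E T := fun _ X => c.τ X

/-- The hom maps of the distributive law that corresponds to coherence maps. -/
noncomputable def lawMaps : LawMaps.{v, u, w} E T := fun _ A a b =>
  haveI := hT (Chain a b)
  ((Gamma.isCoprod_inj E ⟨_, A⟩ a b).map T.toFunctor _ fun p =>
    c.τ (p.homs A) ≫ Gamma.inj E ⟨_, fun a b => T.obj (A a b)⟩ p).choose

theorem map_inj_lawMaps {S : Type w} (A : S → S → V) {a b : S} (p : Chain a b) :
    T.map (Gamma.inj E ⟨S, A⟩ p) ≫ c.lawMaps hT S A a b =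
      c.τ (p.homs A) ≫ Gamma.inj E ⟨S, fun a b => T.obj (A a b)⟩ p :=
  haveI := hT (Chain a b)
  ((Gamma.isCoprod_inj E ⟨_, A⟩ a b).map T.toFunctor _ fun p =>
    c.τ (p.homs A) ≫ Gamma.inj E ⟨_, fun a b => T.obj (A a b)⟩ p).choose_spec.1 p

theorem corresponds_lawMaps : Corresponds c.maps (c.lawMaps hT) := by
  intro S A a b p X f
  refine (congrArg (· ≫ c.lawMaps hT S A a b) (T.map_comp _ _)).trans ?_
  refine (Category.assoc _ _ _).trans ?_
  refine (congrArg (T.map (E.tensor.tmap f) ≫ ·) (c.map_inj_lawMaps hT A p)).trans ?_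
  exact (reassoc_of% c.naturality f) _

end OpmonoidalCoherence

end

section

variable {V : Type u} [Category.{v} V] [HasCoproducts.{w} V] {E : Multitensor V} {T : Monad V}
  {hE : Multitensor.IsDistributive.{v, u, w} E}

namespace GraphDistributiveLaw

variable (L : GraphDistributiveLaw hE T)

/-- The hom maps of a distributive law whose components are identities on objects. -/
noncomputable def homMaps : LawMaps.{v, u, w} E T := fun S A =>
  (EnrichedGraph.Hom.eq_ofHoms (L.1.law.app ⟨S, A⟩) (L.2 ⟨S, A⟩)).choose

theorem app_eq (S : Type w) (A : S → S → V) :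
    L.1.law.app ⟨S, A⟩ = EnrichedGraph.Hom.ofHoms (L.homMaps S A) :=
  (EnrichedGraph.Hom.eq_ofHoms (L.1.law.app ⟨S, A⟩) (L.2 ⟨S, A⟩)).choose_spec

theorem isNatural_homMaps : L.homMaps.IsNatural := by
  intro S R A C o m a b
  have h := L.1.law.naturality (X := ⟨S, A⟩) (Y := ⟨R, C⟩) ⟨o, m⟩
  rw [app_eq, app_eq] at h
  exact EnrichedGraph.Hom.map_eq h a b

theorem map_unitMap_homMaps (S : Type w) (A : S → S → V) (a b : S) :
    T.map (Gamma.unitMap E A a b) ≫ L.homMaps S A a b =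
      Gamma.unitMap E (fun a b => T.obj (A a b)) a b := by
  have h := L.1.map_η_law ⟨S, A⟩
  rw [app_eq] at h
  exact EnrichedGraph.Hom.map_eq h a b

theorem eta_homMaps (S : Type w) (A : S → S → V) (a b : S) :
    T.η.app (Gamma.hom E A a b) ≫ L.homMaps S A a b =
      Gamma.mapHoms E (fun a b => T.η.app (A a b)) a b := by
  have h := L.1.η_law ⟨S, A⟩
  rw [app_eq] at h
  exact EnrichedGraph.Hom.map_eq h a b

theorem map_mult_homMaps (S : Type w) (A : S → S → V) (a b : S) :
    T.map (Gamma.mult hE A a b) ≫ L.homMaps S A a b =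
      L.homMaps S (Gamma.hom E A) a b ≫ Gamma.mapHoms E (L.homMaps S A) a b ≫
        Gamma.mult hE (fun a b => T.obj (A a b)) a b := by
  have h := L.1.map_μ_law ⟨S, A⟩
  rw [app_eq] at h
  replace h := h.trans (congrArg (· ≫ _) (L.app_eq S (Gamma.hom E A)))
  exact EnrichedGraph.Hom.map_eq h a b

theorem mu_homMaps (S : Type w) (A : S → S → V) (a b : S) :
    T.μ.app (Gamma.hom E A a b) ≫ L.homMaps S A a b =
      T.map (L.homMaps S A a b) ≫ L.homMaps S (fun a b => T.obj (A a b)) a b ≫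
        Gamma.mapHoms E (fun a b => T.μ.app (A a b)) a b := by
  have h := L.1.μ_law ⟨S, A⟩
  rw [app_eq, app_eq] at h
  exact EnrichedGraph.Hom.map_eq h a b

variable (hT : ∀ J : Type w, PreservesColimitsOfShape (Discrete J) T.toFunctor)

/-- The coherence maps that correspond to a distributive law. -/
noncomputable def coherence : OpmonoidalCoherence E T :=
  have corr := L.isNatural_homMaps.corresponds hE hT
  { τ := fun X => L.homMaps.coherenceMaps hE hT _ X
    naturality := corr.naturality hE hT
    unit_τ := (corr.unit_iff hE hT).2 L.map_unitMap_homMaps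
    sub_τ := (corr.sub_iff hE hT).2 L.map_mult_homMaps _ _
    η_τ := (corr.eta_iff hE hT).2 L.eta_homMaps _
    μ_τ := (corr.mu_iff hE hT).2 L.mu_homMaps _ }

end GraphDistributiveLaw

namespace OpmonoidalCoherence

variable (c : OpmonoidalCoherence E T) (hE : Multitensor.IsDistributive.{v, u, w} E)
  (hT : ∀ J : Type w, PreservesColimitsOfShape (Discrete J) T.toFunctor)

/-- The distributive law that corresponds to coherence maps. -/
noncomputable def graphLaw : GraphDistributiveLaw hE T :=
  have corr := c.corresponds_lawMaps hT
  { val :=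
      { law :=
          { app := fun X => EnrichedGraph.Hom.ofHoms (c.lawMaps hT X.carrier X.hom)
            naturality := fun _ _ f => EnrichedGraph.Hom.ext_map
              (corr.isNatural hT f.obj f.map) }
        map_η_law := fun X => EnrichedGraph.Hom.ext_map
          ((corr.unit_iff hE hT).1 c.unit_τ X.carrier X.hom)
        η_law := fun X => EnrichedGraph.Hom.ext_map
          ((corr.eta_iff hE hT).1 (fun _ => c.η_τ) X.carrier X.hom)
        map_μ_law := fun X => EnrichedGraph.Hom.ext_map
          ((corr.sub_iff hE hT).1 (fun _ _ => c.sub_τ) X.carrier X.hom)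
        μ_law := fun X => EnrichedGraph.Hom.ext_map
          ((corr.mu_iff hE hT).1 (fun _ => c.μ_τ) X.carrier X.hom) }
    property := fun _ _ => rfl }

theorem homMaps_graphLaw : (c.graphLaw hE hT).homMaps = c.lawMaps hT := by
  funext S A a b
  have h : EnrichedGraph.Hom.ofHoms (c.lawMaps hT S A) = _ := (c.graphLaw hE hT).app_eq S A
  exact (EnrichedGraph.Hom.map_eq h a b).symm

end OpmonoidalCoherence

/-- Opmonoidal monad coherences for `T` are the same thing as identity-on-objects distributive laws
of `Γ E` over `G T`. -/
noncomputable def graphLawEquiv (hE : Multitensor.IsDistributive.{v, u, w} E)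
    (hT : ∀ J : Type w, PreservesColimitsOfShape (Discrete J) T.toFunctor) :
    OpmonoidalCoherence E T ≃ GraphDistributiveLaw hE T where
  toFun c := c.graphLaw hE hT
  invFun L := L.coherence hT
  left_inv c := by
    have corr := (c.graphLaw hE hT).isNatural_homMaps.corresponds hE hT
    have corr' := c.corresponds_lawMaps hT
    rw [← c.homMaps_graphLaw hE hT] at corr'
    exact OpmonoidalCoherence.ext (corr.coherenceMaps_unique hE hT corr')
  right_inv L := by
    have corr := (L.coherence hT).corresponds_lawMaps hT
    have homs_eq := corr.lawMaps_unique hT (L.isNatural_homMaps.corresponds hE hT)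
    refine Subtype.ext (DistributiveLaw.ext (NatTrans.ext (funext fun X => ?_)))
    exact (congrArg (fun l : LawMaps.{v, u, w} E T => EnrichedGraph.Hom.ofHoms (l X.carrier X.hom))
      homs_eq).trans (L.app_eq X.carrier X.hom).symm

end

end MultitensorLaw

theorem mainTheorem6 {V : Type u} [Category.{v} V] (E : Multitensor V) (T : Monad V) :
    ∃ (e₁ : OpmonoidalCoherence E T ≃ CompositeMultitensor E T)
      (e₂ : OpmonoidalCoherence E T ≃ Lifting E T),
      (∀ (c : OpmonoidalCoherence E T) {N k : ℕ} (d : Subdivision N k) (X : Fin N → V),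
        (e₁ c).str.sub d X =
          E.tensor.tmap (fun i => c.τ fun j => T.obj (X (d.index i j))) ≫
            E.str.sub d (fun s => T.obj (T.obj (X s))) ≫
              E.tensor.tmap fun s => T.μ.app (X s)) ∧
      (∀ (c : OpmonoidalCoherence E T) {n : ℕ} (X : Fin n → T.Algebra),
        HEq (((e₂ c).lift.tensor n).obj X).a
          (c.τ (fun i => (X i).A) ≫ E.tensor.tmap fun i => (X i).a)) ∧
      (∀ c : OpmonoidalCoherence E T,
        ∃ (F : MultitensorCat.{v, u, w} (e₁ c).multitensor ⥤
              MultitensorCat.{v, max u v, w} (e₂ c).lift)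
          (G : MultitensorCat.{v, max u v, w} (e₂ c).lift ⥤ MultitensorCat.{v, u, w} (e₁ c).multitensor),
          F ⋙ G = 𝟭 _ ∧ G ⋙ F = 𝟭 _ ∧
          F ⋙ MultitensorCat.forget (e₂ c).lift ⋙ EnrichedGraph.mapFunctor T.forget =
            MultitensorCat.forget (e₁ c).multitensor) ∧
      (∀ [HasCoproducts.{w} V] (hE : Multitensor.IsDistributive.{v, u, w} E),
        (∀ J : Type w, PreservesColimitsOfShape (Discrete J) T.toFunctor) →
        ∃ e₃ : OpmonoidalCoherence E T ≃ GraphDistributiveLaw hE T,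
          ∀ (c : OpmonoidalCoherence E T) (X : EnrichedGraph.{v, u, w} V),
            ∃ h : ∀ a b : X.carrier, T.obj ((Gamma.onObj E X).hom a b) ⟶
                (Gamma.onObj E ((EnrichedGraph.mapFunctor T.toFunctor).obj X)).hom a b,
              (e₃ c).1.law.app X = EnrichedGraph.Hom.ofHoms h ∧
              ∀ {a b : X.carrier} (p : Chain a b),
                T.map (Gamma.inj E X p) ≫ h a b =
                  c.τ (X.homs p) ≫
                    Gamma.inj E ((EnrichedGraph.mapFunctor T.toFunctor).obj X) p) := by
  refine ⟨compositeEquiv E T, liftingEquiv E T, fun c _ _ d X => c.actions_compositeSub d X,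
    fun _ _ _ => HEq.rfl, fun c => ?_, fun hE hT => ?_⟩
  · exact ⟨c.actions.toLiftedFunctor, c.actions.ofLiftedFunctor,
      c.actions.toLiftedFunctor_comp_ofLiftedFunctor,
      c.actions.ofLiftedFunctor_comp_toLiftedFunctor, rfl⟩
  · exact ⟨graphLawEquiv hE hT, fun c X => ⟨c.lawMaps hT X.carrier X.hom, rfl,
      fun p => c.map_inj_lawMaps hT X.hom p⟩⟩
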